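/- Let $\Bbbk$ be a field, $H$ a bialgebra over $\Bbbk$, and $V$ a finite-dimensional quasi-Yetter–Drinfeld module over $H$: a left $H$-module with a linear map $\delta\colon V\to H\otimes V$, $v\mapsto v^{[-1]}\otimes v^{[0]}$, such that $(h_{(1)}\triangleright v)^{[-1]}h_{(2)}\otimes(h_{(1)}\triangleright v)^{[0]}=h_{(1)}v^{[-1]}\otimes h_{(2)}\triangleright v^{[0]}$ for all $h\in H$, $v\in V$. Let $H$ act on $V^*$ on the right by $\langle f\triangleleft h,v\rangle=\langle f,h\triangleright v\rangle$, and put $\beta(f,v)=v^{[-1]}\langle f,v^{[0]}\rangle$. Let $\tilde A=\tilde A(V,\delta)$ be the free braided double: the algebra generated by $V$, $H$, $V^*$ subject to the relations of $H$ (with $1_H=1$), $hv=(h_{(1)}\triangleright v)h_{(2)}$, $fh=h_{(1)}(f\triangleleft h_{(2)})$ and $fv-vf=\beta(f,v)$. A triangular ideal of $\tilde A$ is a two-sided ideal of the form $I^-\otimes H\otimes T(V^*)+T(V)\otimes H\otimes I^+$ (the image in $\tilde A$ under multiplication) with subspaces $I^-\subseteq T^{>0}(V)$, $I^+\subseteq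 T^{>0}(V^*)$. A $(V,\delta)$-braided double is a quotient of $\tilde A$ by a triangular ideal; a quotient double of a braided double $A$ is a quotient of $A$ by a two-sided ideal that is again a $(V,\delta)$-braided double; a minimal double is a braided double without proper quotient doubles. **1.** A triangular ideal determines $I^-$ and $I^+$, as its preimages in $T(V)$ and $T(V^*)$, and for every braided double $A$ multiplication gives a bijection $T(V)/I^-\otimes H\otimes T(V^*)/I^+\to A$. The sum of all triangular ideals of $\tilde A$ is the largest triangular ideal $I_{\tilde A}$; a braided double is minimal if and only if it is the quotient of $\tilde A$ by $I_{\tilde A}$; and every braided double has a unique quotient double that is a minimal double. **2.** Let $I(V,\delta)\subset T(V)$ and $I(V^*,\delta)\subset T(V^*)$ be the preimages of $I_{\tilde A}$. Then $I_{\tilde A}=I(V,\delta)\otimes H\otimes T(V^*)+T(V)\otimes H\otimes I(V^*,\delta)$, and $I(V,\delta)\subseteq T^{>0}(V)$, $I(V^*,\delta)\subseteq T^{>0}(V^*)$ are $H$-invariant graded two-sided ideals. **3.** If $H$ is a Hopf algebra, then $$I(V,\delta)=\bigoplus_{n\ge1}\ker\widetilde{[n]}!_\delta,\qquad I(V^*,\delta)=\bigoplus_{n\ge1}\ker\widetilde{[n]}!_{\delta_r}.$$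 Here the quasibraided integers $\widetilde{[n]}_\delta\colon V^{\otimes n}\to V^{\otimes n-1}\otimes H\otimes V$ are $$\widetilde{[n]}_\delta(v_1\otimes\dots\otimes v_n)=\sum_{i=1}^n v_1\otimes\dots\otimes v_{i-1}\otimes {v_i^{[-1]}}_{(1)}\triangleright(v_{i+1}\otimes\dots\otimes v_n)\otimes {v_i^{[-1]}}_{(2)}\otimes v_i^{[0]},$$ and the quasibraided factorials $\widetilde{[n]}!_\delta\colon V^{\otimes n}\to(H\otimes V)^{\otimes n}$ are given by $\widetilde{[0]}!_\delta=1$, $\widetilde{[n]}!_\delta=(\widetilde{[n-1]}!_\delta\otimes\mathrm{id}_{H\otimes V})\circ\widetilde{[n]}_\delta$. On the right side, $\delta_r\colon V^*\to V^*\otimes H$, $f\mapsto f^{[0]}\otimes f^{[1]}$, is determined by $\beta(f,v)=\langle f^{[0]},v\rangle f^{[1]}$, and $\widetilde{[n]}_{\delta_r}\colon V^{*\otimes n}\to V^*\otimes H\otimes V^{*\otimes n-1}$ is $$\widetilde{[n]}_{\delta_r}(f_1\otimes\dots\otimes f_n)=\sum_{i=1}^n f_i^{[0]}\otimes {f_i^{[1]}}_{(1)}\otimes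 (f_1\otimes\dots\otimes f_{i-1})\triangleleft {f_i^{[1]}}_{(2)}\otimes f_{i+1}\otimes\dots\otimes f_n,$$ with $\widetilde{[0]}!_{\delta_r}=1$ and $\widetilde{[n]}!_{\delta_r}=(\mathrm{id}_{V^*\otimes H}\otimes\widetilde{[n-1]}!_{\delta_r})\circ\widetilde{[n]}_{\delta_r}\colon V^{*\otimes n}\to(V^*\otimes H)^{\otimes n}$. -/

import Mathlib

open scoped TensorProduct

noncomputable section

namespace BraidedDouble

universe u v w x

section TensorPowers

variable (k : Type u) (M : Type v) [CommRing k] [AddCommGroup M] [Module k M]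

/-- `m ⊗ (m₁ ⊗ ⋯ ⊗ mₙ) ↦ m ⊗ m₁ ⊗ ⋯ ⊗ mₙ`, as an isomorphism `M ⊗ M^{⊗n} ≃ M^{⊗(n+1)}`. -/
def consEquiv (n : ℕ) : M ⊗[k] (⨂[k]^n M) ≃ₗ[k] (⨂[k]^(n + 1) M) :=
  (TensorProduct.congr (PiTensorProduct.subsingletonEquiv (R := k) (s := fun _ : Fin 1 => M) 0).symm
      (LinearEquiv.refl k (⨂[k]^n M))).trans
    ((TensorPower.mulEquiv (R := k) (M := M) (n := 1) (m := n)).trans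
      (TensorPower.cast k M (Nat.add_comm 1 n)))

/-- `(m₁ ⊗ ⋯ ⊗ mₙ) ⊗ m ↦ m₁ ⊗ ⋯ ⊗ mₙ ⊗ m`, as an isomorphism `M^{⊗n} ⊗ M ≃ M^{⊗(n+1)}`. -/
def snocEquiv (n : ℕ) : (⨂[k]^n M) ⊗[k] M ≃ₗ[k] (⨂[k]^(n + 1) M) :=
  (TensorProduct.congr (LinearEquiv.refl k (⨂[k]^n M))
      (PiTensorProduct.subsingletonEquiv (R := k) (s := fun _ : Fin 1 => M) 0).symm).trans
    (TensorPower.mulEquiv (R := k) (M := M) (n := n) (m := 1))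

variable {k M}

lemma subsingletonEquiv_symm_eq (m : M) :
    (PiTensorProduct.subsingletonEquiv (R := k) (s := fun _ : Fin 1 => M) 0).symm m =
      PiTensorProduct.tprod k (fun _ : Fin 1 => m) := by
  rw [LinearEquiv.symm_apply_eq, PiTensorProduct.subsingletonEquiv_apply_tprod]

theorem consEquiv_tprod (n : ℕ) (m : M) (a : Fin n → M) :
    consEquiv k M n (m ⊗ₜ PiTensorProduct.tprod k a) =
      PiTensorProduct.tprod k (Fin.cons m a : Fin (n + 1) → M) := by
  have h := TensorPower.tprod_mul_tprod k (fun _ : Fin 1 => m) a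
  rw [TensorPower.gMul_def] at h
  simp only [consEquiv, LinearEquiv.trans_apply, TensorProduct.congr_tmul, LinearEquiv.refl_apply,
    subsingletonEquiv_symm_eq, h, TensorPower.cast_tprod]
  congr 1
  rw [Fin.append_left_eq_cons]
  funext i
  simp

theorem snocEquiv_tprod (n : ℕ) (m : M) (a : Fin n → M) :
    snocEquiv k M n (PiTensorProduct.tprod k a ⊗ₜ m) =
      PiTensorProduct.tprod k (Fin.snoc a m : Fin (n + 1) → M) := by
  have h := TensorPower.tprod_mul_tprod k a (fun _ : Fin 1 => m)
  rw [TensorPower.gMul_def] at h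
  simp only [snocEquiv, LinearEquiv.trans_apply, TensorProduct.congr_tmul, LinearEquiv.refl_apply,
    subsingletonEquiv_symm_eq, h]
  congr 1
  rw [Fin.append_right_eq_snoc]

end TensorPowers

variable {k : Type u} {H : Type v} {V : Type w}
variable [Field k] [Ring H] [Bialgebra k H]

/-- Given a (left or right) action of the bialgebra `H` on `M`, the action on `M^{⊗n}` through the
coproduct: `h · 1 = ε(h)` for `n = 0`, and `h · (m ⊗ t) = (h₍₁₎ · m) ⊗ (h₍₂₎ · t)`. -/
def powAct {M : Type w} [AddCommGroup M] [Module k M] (act : H →ₗ[k] M →ₗ[k] M) :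
    (n : ℕ) → H →ₗ[k] (⨂[k]^n M) →ₗ[k] (⨂[k]^n M)
  | 0 => LinearMap.smulRight (Coalgebra.counit (R := k) (A := H)) LinearMap.id
  | n + 1 =>
      (consEquiv k M n).conj.toLinearMap ∘ₗ
        TensorProduct.lift (TensorProduct.mapBilinear (RingHom.id k) M (⨂[k]^n M) M (⨂[k]^n M)) ∘ₗ
          TensorProduct.map act (powAct act n) ∘ₗ Coalgebra.comul

/-- The bialgebra `H` is a Hopf algebra (it has an antipode). -/
def IsHopf (k : Type u) (H : Type v) [Field k] [Ring H] [B : Bialgebra k H] : Prop :=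
  ∃ A : HopfAlgebra k H, A.toBialgebra = B

variable [AddCommGroup V] [Module k V] [Module H V] [IsScalarTower k H V]

/-- The left action `h ↦ (v ↦ h ▷ v)` of `H` on `V`. -/
def lact (k : Type u) (H : Type v) (V : Type w) [Field k] [Ring H] [Bialgebra k H]
    [AddCommGroup V] [Module k V] [Module H V] [IsScalarTower k H V] : H →ₗ[k] V →ₗ[k] V :=
  (Algebra.lsmul k k V).toLinearMap

/-- The right action `h ↦ (f ↦ f ◁ h)` of `H` on `V*`: `⟨f ◁ h, v⟩ = ⟨f, h ▷ v⟩`. -/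
def ract (k : Type u) (H : Type v) (V : Type w) [Field k] [Ring H] [Bialgebra k H]
    [AddCommGroup V] [Module k V] [Module H V] [IsScalarTower k H V] :
    H →ₗ[k] Module.Dual k V →ₗ[k] Module.Dual k V :=
  (LinearMap.llcomp k V V k).flip ∘ₗ lact k H V

/-- The Yetter–Drinfeld compatibility condition for a quasicoaction `δ : V → H ⊗ V`,
`v ↦ v⁻¹ ⊗ v⁰` (an arbitrary linear map):
`(h₍₁₎ ▷ v)⁻¹ h₍₂₎ ⊗ (h₍₁₎ ▷ v)⁰ = h₍₁₎ v⁻¹ ⊗ h₍₂₎ ▷ v⁰`. With it, `(V, δ)` is a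
quasi-Yetter–Drinfeld module over `H`. -/
def IsQuasiYD (δ : V →ₗ[k] H ⊗[k] V) : Prop :=
  ∀ (h : H) (v : V),
    TensorProduct.lift
        (LinearMap.mk₂ k (fun a b : H => LinearMap.rTensor V (LinearMap.mulRight k b) (δ (a • v)))
          (fun a a' b => by simp [add_smul])
          (fun c a b => by simp)
          (fun a b b' => by
            rw [show LinearMap.mulRight k (b + b') =
              LinearMap.mulRight k b + LinearMap.mulRight k b' by ext; simp [mul_add],
              LinearMap.rTensor_add, LinearMap.add_apply])
          (fun c a b => by
            rw [show LinearMap.mulRight k (c • b) = c • LinearMap.mulRight k b by ext; simp,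
              LinearMap.rTensor_smul, LinearMap.smul_apply]))
        (Coalgebra.comul (R := k) h) =
      TensorProduct.map
          (TensorProduct.lift (LinearMap.mul k H)) (TensorProduct.lift (lact k H V))
        (TensorProduct.tensorTensorTensorComm k H H H V (Coalgebra.comul (R := k) h ⊗ₜ δ v))

/-- The `H`-valued pairing `β(f, v) = v⁻¹ ⟨f, v⁰⟩` between `V*` and `V`. -/
def pairing (δ : V →ₗ[k] H ⊗[k] V) (f : Module.Dual k V) : V →ₗ[k] H :=
  (TensorProduct.rid k H).toLinearMap ∘ₗ LinearMap.lTensor H f ∘ₗ δ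

section Double

/-- The free algebra on `V`, `H` and `V*` (tensor algebra of the direct sum of these spaces). -/
abbrev Pre (k : Type u) (H : Type v) (V : Type w) [Field k] [Ring H] [Bialgebra k H]
    [AddCommGroup V] [Module k V] :=
  TensorAlgebra k (V × H × Module.Dual k V)

/-- The generators `v ∈ V`. -/
def preV (k : Type u) (H : Type v) (V : Type w) [Field k] [Ring H] [Bialgebra k H]
    [AddCommGroup V] [Module k V] : V →ₗ[k] Pre k H V :=
  TensorAlgebra.ι k ∘ₗ LinearMap.inl k V (H × Module.Dual k V)

/-- The generators `h ∈ H`. -/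
def preH (k : Type u) (H : Type v) (V : Type w) [Field k] [Ring H] [Bialgebra k H]
    [AddCommGroup V] [Module k V] : H →ₗ[k] Pre k H V :=
  TensorAlgebra.ι k ∘ₗ LinearMap.inr k V (H × Module.Dual k V) ∘ₗ
    LinearMap.inl k H (Module.Dual k V)

/-- The generators `f ∈ V*`. -/
def preF (k : Type u) (H : Type v) (V : Type w) [Field k] [Ring H] [Bialgebra k H]
    [AddCommGroup V] [Module k V] : Module.Dual k V →ₗ[k] Pre k H V :=
  TensorAlgebra.ι k ∘ₗ LinearMap.inr k V (H × Module.Dual k V) ∘ₗ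
    LinearMap.inr k H (Module.Dual k V)

/-- The defining relations of the double. -/
inductive Rel (δ : V →ₗ[k] H ⊗[k] V) : Pre k H V → Pre k H V → Prop
  /-- the unity of `H` is the unity -/
  | one : Rel δ (preH k H V 1) 1
  /-- all relations between elements of `H` hold -/
  | mul (a b : H) : Rel δ (preH k H V (a * b)) (preH k H V a * preH k H V b)
  /-- `h v = (h₍₁₎ ▷ v) h₍₂₎` -/
  | left (h : H) (v : V) : Rel δ (preH k H V h * preV k H V v)
      (LinearMap.mul' k _ (TensorProduct.map (preV k H V ∘ₗ (lact k H V).flip v) (preH k H V)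
        (Coalgebra.comul (R := k) h)))
  /-- `f h = h₍₁₎ (f ◁ h₍₂₎)` -/
  | right (f : Module.Dual k V) (h : H) : Rel δ (preF k H V f * preH k H V h)
      (LinearMap.mul' k _ (TensorProduct.map (preH k H V) (preF k H V ∘ₗ (ract k H V).flip f)
        (Coalgebra.comul (R := k) h)))
  /-- `f v - v f = β(f, v)` -/
  | comm (f : Module.Dual k V) (v : V) : Rel δ
      (preF k H V f * preV k H V v - preV k H V v * preF k H V f) (preH k H V (pairing δ f v))

variable (δ : V →ₗ[k] H ⊗[k] V)

/-- The algebra `Ã(V, δ)`, given by generators and relations; when `(V, δ)` is a quasi-YD module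
it is the free braided double of `(V, δ)`. -/
abbrev FreeDouble : Type _ := RingQuot (Rel δ)

/-- The canonical map `T(V) → Ã(V, δ)`. -/
def incV : TensorAlgebra k V →ₐ[k] FreeDouble δ :=
  TensorAlgebra.lift k ((RingQuot.mkAlgHom k (Rel δ)).toLinearMap ∘ₗ preV k H V)

/-- The canonical map `H → Ã(V, δ)`. -/
def incH : H →ₗ[k] FreeDouble δ :=
  (RingQuot.mkAlgHom k (Rel δ)).toLinearMap ∘ₗ preH k H V

/-- The canonical map `T(V*) → Ã(V, δ)`. -/
def incF : TensorAlgebra k (Module.Dual k V) →ₐ[k] FreeDouble δ :=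
  TensorAlgebra.lift k ((RingQuot.mkAlgHom k (Rel δ)).toLinearMap ∘ₗ preF k H V)

/-- The ideal `T^{>0}(M) = ⊕_{n>0} M^{⊗n}` of the tensor algebra. -/
def posPart (k : Type u) (M : Type x) [Field k] [AddCommGroup M] [Module k M] :
    Submodule k (TensorAlgebra k M) :=
  LinearMap.ker (TensorAlgebra.algebraMapInv (R := k) (M := M)).toLinearMap

/-- `J` is a two-sided ideal of the form `I⁻ ⊗ H ⊗ T(V*) + T(V) ⊗ H ⊗ I⁺` with subspaces
`I⁻ ⊆ T^{>0}(V)` and `I⁺ ⊆ T^{>0}(V*)`. -/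
structure HasTriangularForm (J : Ideal (FreeDouble δ)) (Im : Submodule k (TensorAlgebra k V))
    (Ip : Submodule k (TensorAlgebra k (Module.Dual k V))) : Prop where
  twoSided : J.IsTwoSided
  minus_le : Im ≤ posPart k V
  plus_le : Ip ≤ posPart k (Module.Dual k V)
  eq : J.restrictScalars k =
    Im.map (incV δ).toLinearMap * LinearMap.range (incH δ) *
        LinearMap.range (incF δ).toLinearMap ⊔
      LinearMap.range (incV δ).toLinearMap * LinearMap.range (incH δ) *
        Ip.map (incF δ).toLinearMap

/-- Triangular ideals of `Ã(V, δ)`. -/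
def IsTriangularIdeal (J : Ideal (FreeDouble δ)) : Prop :=
  ∃ Im Ip, HasTriangularForm δ J Im Ip

/-- `A`, as a quotient of `Ã(V, δ)` through `q`, is a `(V, δ)`-braided double: `q` is onto and its
kernel is a triangular ideal. -/
def IsBraidedDouble {A : Type x} [Ring A] [Algebra k A] (q : FreeDouble δ →ₐ[k] A) : Prop :=
  Function.Surjective q ∧ IsTriangularIdeal δ (RingHom.ker q)

/-- The ideal `K` of the `(V, δ)`-braided double `A` is two-sided, and `A / K` is again a
`(V, δ)`-braided double. -/
def IsQuotientDouble {A : Type x} [Ring A] [Algebra k A] (q : FreeDouble δ →ₐ[k] A)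
    (K : Ideal A) : Prop :=
  ∃ _ : K.IsTwoSided, IsBraidedDouble δ ((Ideal.Quotient.mkₐ k K).comp q)

/-- A minimal double: a braided double without proper quotient doubles. -/
def IsMinimalDouble {A : Type x} [Ring A] [Algebra k A] (q : FreeDouble δ →ₐ[k] A) : Prop :=
  IsBraidedDouble δ q ∧ ∀ K : Ideal A, IsQuotientDouble δ q K → K = ⊥

/-- The sum of all triangular ideals of `Ã(V, δ)`. -/
def sumTriangular : Ideal (FreeDouble δ) := sSup {J | IsTriangularIdeal δ J}

/-- The defining ideal `I(V, δ)` of the minimal double in `T(V)`. -/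
def idealV : Ideal (TensorAlgebra k V) := (sumTriangular δ).comap (incV δ)

/-- The defining ideal `I(V*, δ)` of the minimal double in `T(V*)`. -/
def idealF : Ideal (TensorAlgebra k (Module.Dual k V)) := (sumTriangular δ).comap (incF δ)

/-- For a quotient `q : Ã(V, δ) → A`, with `I⁻`, `I⁺` the kernels of `T(V) → A`, `T(V*) → A`, the
map `T(V)/I⁻ ⊗ H ⊗ T(V*)/I⁺ → A` given by multiplication in `A`. -/
def triangularMap {A : Type x} [Ring A] [Algebra k A] (q : FreeDouble δ →ₐ[k] A) :
    (TensorAlgebra k V ⧸ LinearMap.ker (q.comp (incV δ)).toLinearMap) ⊗[k] H ⊗[k]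
      (TensorAlgebra k (Module.Dual k V) ⧸ LinearMap.ker (q.comp (incF δ)).toLinearMap) →ₗ[k] A :=
  LinearMap.mul' k A ∘ₗ TensorProduct.map
    (LinearMap.mul' k A ∘ₗ TensorProduct.map
      (Submodule.liftQ _ (q.comp (incV δ)).toLinearMap le_rfl) (q.toLinearMap ∘ₗ incH δ))
    (Submodule.liftQ _ (q.comp (incF δ)).toLinearMap le_rfl)

end Double

section LeftFactorials

variable (δ : V →ₗ[k] H ⊗[k] V)

/-- `v ⊗ t ↦ (v⁻¹₍₁₎ ▷ t) ⊗ v⁻¹₍₂₎ ⊗ v⁰` for `v ∈ V`, `t ∈ V^{⊗n}`. -/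
def headTerm (n : ℕ) : V ⊗[k] (⨂[k]^n V) →ₗ[k] (⨂[k]^n V) ⊗[k] (H ⊗[k] V) :=
  LinearMap.rTensor (H ⊗[k] V) (TensorProduct.lift (powAct (lact k H V) n)) ∘ₗ
    (TensorProduct.rightComm k H (H ⊗[k] V) (⨂[k]^n V)).toLinearMap ∘ₗ
      LinearMap.rTensor (⨂[k]^n V)
        ((TensorProduct.assoc k H H V).toLinearMap ∘ₗ
          LinearMap.rTensor V (Coalgebra.comul (R := k) (A := H)) ∘ₗ δ)

/-- `quasiInt δ n` is the quasibraided integer `[n+1]~ : V^{⊗(n+1)} → V^{⊗n} ⊗ (H ⊗ V)`,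
`v₁ ⊗ ⋯ ⊗ vₙ₊₁ ↦ ∑ᵢ v₁ ⊗ ⋯ ⊗ vᵢ₋₁ ⊗ (vᵢ⁻¹₍₁₎ ▷ (vᵢ₊₁ ⊗ ⋯ ⊗ vₙ₊₁)) ⊗ vᵢ⁻¹₍₂₎ ⊗ vᵢ⁰`.
The term `i = 1` is `headTerm`; the terms with `i > 1` are `v₁ ⊗ [n]~(v₂ ⊗ ⋯ ⊗ vₙ₊₁)`. -/
def quasiInt : (n : ℕ) → (⨂[k]^(n + 1) V) →ₗ[k] (⨂[k]^n V) ⊗[k] (H ⊗[k] V)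
  | 0 => headTerm δ 0 ∘ₗ (consEquiv k V 0).symm.toLinearMap
  | n + 1 =>
      (headTerm δ (n + 1) +
        LinearMap.rTensor (H ⊗[k] V) (consEquiv k V n).toLinearMap ∘ₗ
          (TensorProduct.assoc k V (⨂[k]^n V) (H ⊗[k] V)).symm.toLinearMap ∘ₗ
            LinearMap.lTensor V (quasiInt n)) ∘ₗ
        (consEquiv k V (n + 1)).symm.toLinearMap

/-- The quasibraided factorial `[n]~! : V^{⊗n} → (H ⊗ V)^{⊗n}`: `[0]~! = 1` and
`[n+1]~! = ([n]~! ⊗ id_{H ⊗ V}) ∘ [n+1]~`. -/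
def quasiFactorial : (n : ℕ) → (⨂[k]^n V) →ₗ[k] (⨂[k]^n (H ⊗[k] V))
  | 0 => ((PiTensorProduct.isEmptyEquiv (R := k) (s := fun _ : Fin 0 => V) (Fin 0)).trans
      (PiTensorProduct.isEmptyEquiv (R := k) (s := fun _ : Fin 0 => H ⊗[k] V)
        (Fin 0)).symm).toLinearMap
  | n + 1 =>
      (snocEquiv k (H ⊗[k] V) n).toLinearMap ∘ₗ
        LinearMap.rTensor (H ⊗[k] V) (quasiFactorial n) ∘ₗ quasiInt δ n

end LeftFactorials

section RightFactorials

variable [Module.Finite k V] (δ : V →ₗ[k] H ⊗[k] V)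

/-- The right quasicoaction `δᵣ : V* → V* ⊗ H`, `f ↦ f⁰ ⊗ f¹`, determined by
`β(f, v) = ⟨f⁰, v⟩ f¹`. -/
def rightQuasicoaction : Module.Dual k V →ₗ[k] Module.Dual k V ⊗[k] H :=
  (dualTensorHomEquiv k V H).symm.toLinearMap ∘ₗ
    LinearMap.mk₂ k (fun f v => pairing δ f v)
      (fun f f' v => by simp [pairing, LinearMap.lTensor_add])
      (fun c f v => by simp [pairing, LinearMap.lTensor_smul])
      (fun f v v' => by simp)
      (fun c f v => by simp)

/-- `t ⊗ f ↦ f⁰ ⊗ f¹₍₁₎ ⊗ (t ◁ f¹₍₂₎)` for `t ∈ V*^{⊗n}`, `f ∈ V*`. -/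
def tailTerm (n : ℕ) : (⨂[k]^n (Module.Dual k V)) ⊗[k] Module.Dual k V →ₗ[k]
    (Module.Dual k V ⊗[k] H) ⊗[k] (⨂[k]^n (Module.Dual k V)) :=
  LinearMap.lTensor (Module.Dual k V ⊗[k] H)
      (TensorProduct.lift (powAct (ract k H V) n).flip) ∘ₗ
    (TensorProduct.leftComm k (⨂[k]^n (Module.Dual k V)) (Module.Dual k V ⊗[k] H) H).toLinearMap ∘ₗ
      LinearMap.lTensor (⨂[k]^n (Module.Dual k V))
        ((TensorProduct.assoc k (Module.Dual k V) H H).symm.toLinearMap ∘ₗ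
          LinearMap.lTensor (Module.Dual k V) (Coalgebra.comul (R := k) (A := H)) ∘ₗ
            rightQuasicoaction δ)

/-- `quasiIntRight δ n` is the right-handed quasibraided integer
`[n+1]~ : V*^{⊗(n+1)} → (V* ⊗ H) ⊗ V*^{⊗n}`,
`f₁ ⊗ ⋯ ⊗ fₙ₊₁ ↦ ∑ᵢ fᵢ⁰ ⊗ fᵢ¹₍₁₎ ⊗ ((f₁ ⊗ ⋯ ⊗ fᵢ₋₁) ◁ fᵢ¹₍₂₎) ⊗ fᵢ₊₁ ⊗ ⋯ ⊗ fₙ₊₁`.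
The term `i = n+1` is `tailTerm`; the other terms are `[n]~(f₁ ⊗ ⋯ ⊗ fₙ) ⊗ fₙ₊₁`. -/
def quasiIntRight : (n : ℕ) → (⨂[k]^(n + 1) (Module.Dual k V)) →ₗ[k]
    (Module.Dual k V ⊗[k] H) ⊗[k] (⨂[k]^n (Module.Dual k V))
  | 0 => tailTerm δ 0 ∘ₗ (snocEquiv k (Module.Dual k V) 0).symm.toLinearMap
  | n + 1 =>
      (tailTerm δ (n + 1) +
        LinearMap.lTensor (Module.Dual k V ⊗[k] H) (snocEquiv k (Module.Dual k V) n).toLinearMap ∘ₗ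
          (TensorProduct.assoc k (Module.Dual k V ⊗[k] H) (⨂[k]^n (Module.Dual k V))
            (Module.Dual k V)).toLinearMap ∘ₗ
            LinearMap.rTensor (Module.Dual k V) (quasiIntRight n)) ∘ₗ
        (snocEquiv k (Module.Dual k V) (n + 1)).symm.toLinearMap

/-- The right-handed quasibraided factorial `[n]~! : V*^{⊗n} → (V* ⊗ H)^{⊗n}`: `[0]~! = 1` and
`[n+1]~! = (id_{V* ⊗ H} ⊗ [n]~!) ∘ [n+1]~`. -/
def quasiFactorialRight :
    (n : ℕ) → (⨂[k]^n (Module.Dual k V)) →ₗ[k] (⨂[k]^n (Module.Dual k V ⊗[k] H))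
  | 0 => ((PiTensorProduct.isEmptyEquiv (R := k) (s := fun _ : Fin 0 => Module.Dual k V)
      (Fin 0)).trans
      (PiTensorProduct.isEmptyEquiv (R := k) (s := fun _ : Fin 0 => Module.Dual k V ⊗[k] H)
        (Fin 0)).symm).toLinearMap
  | n + 1 =>
      (consEquiv k (Module.Dual k V ⊗[k] H) n).toLinearMap ∘ₗ
        LinearMap.lTensor (Module.Dual k V ⊗[k] H) (quasiFactorialRight n) ∘ₗ quasiIntRight δ n

end RightFactorials

end BraidedDouble

end

/-! The structural assertions rest on the triangular decomposition `T(V) ⊗ H ⊗ T(V*) ≅ Ã(V, δ)`.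
Multiplication is onto because the relations move `V` to the left and `V*` to the right. For
injectivity, `normalRep` lets `Ã` act on `T(V) ⊗ (H ⊗ T(V*))` as left multiplication ought to act,
and evaluation at `1 ⊗ 1 ⊗ 1` recovers normal forms. The Yetter–Drinfeld condition is what makes the
relation `f h = h₍₁₎ (f ◁ h₍₂₎)` hold for this action (`fAct_hAct`).

With normal forms at hand, a functional on `H` and the augmentation of `T(V*)` give a projection `Ã
→ T(V)`. It sends a triangular ideal into `I⁻`, because the augmentation kills `I⁺`; so the halves
are the preimages. A sum of triangular ideals is triangular, its halves being the sums of the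
halves, and the statements on minimal doubles follow from the correspondence of ideals. The
homogeneous hull of a triangular ideal is again triangular, so the largest one is graded; invariance
under `H` comes from projecting `h t` with the counit.

For the kernels, the commutator of `f ∈ V*` with `u ∈ V^{⊗n}` is the contraction of `[n]~ u` with
`f` (`incF_ι_mul_incV`). If `u ∈ I(V, δ)`, projecting `f u - u f` shows that all contractions of
`[n]~ u` lie in `I(V, δ)`, and induction gives `[n]~! u = 0`; this inclusion holds over any
bialgebra. Conversely, let `K` be the sum of the kernels. Exactness of tensor products over a field
gives `[f, K] ⊆ K H`, so `V*` can be moved to the right past `K`. The antipode gives `h ▷ u = h₍₁₎ u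
S(h₍₂₎)`, so the two-sided ideal generated by `K` contains the `H`-translates of `K`. It is
therefore triangular with `I⁺ = 0`, and lies in the largest triangular ideal (`iSup_le_idealV`). The
statement for `V*` is the mirror image; there finite dimension provides `δᵣ` and identifies
functionals on `V*` with vectors. -/

noncomputable section

namespace BraidedDouble

universe u v w x

/-! ### Actions of `H` and `V*` on free `T(V)`-modules. -/

section FreeActions

section Sweedler

variable {k : Type u} {H : Type v} [CommSemiring k] [AddCommMonoid H] [Module k H] [Coalgebra k H]
variable {X : Type*} [AddCommMonoid X] [Module k X]

/-- `h ↦ B h₍₁₎ h₍₂₎` for a bilinear map `B`. -/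
def sweedler (B : H →ₗ[k] H →ₗ[k] X) : H →ₗ[k] X :=
  TensorProduct.lift B ∘ₗ Coalgebra.comul

theorem sweedler_eq_sum {ι : Type*} (B : H →ₗ[k] H →ₗ[k] X) {h : H} (r : Coalgebra.Repr k h ι) :
    sweedler B h = ∑ i ∈ r.index, B (r.left i) (r.right i) := by
  simp [sweedler, ← r.eq]

/-- Coassociativity tested against a trilinear map; each re-bracketing of an iterated coproduct
below is an instance with a suitable `φ`. -/
theorem sum_coassoc {ι : Type*} {κ κ' : ι → Type*} (φ : H →ₗ[k] H →ₗ[k] H →ₗ[k] X) {h : H}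
    (r : Coalgebra.Repr k h ι)
    (a₁ : ∀ i, Coalgebra.Repr k (r.left i) (κ i)) (a₂ : ∀ i, Coalgebra.Repr k (r.right i) (κ' i)) :
    ∑ i ∈ r.index, ∑ j ∈ (a₁ i).index, φ ((a₁ i).left j) ((a₁ i).right j) (r.right i) =
      ∑ i ∈ r.index, ∑ j ∈ (a₂ i).index, φ (r.left i) ((a₂ i).left j) ((a₂ i).right j) := by
  have := congrArg (TensorProduct.lift (TensorProduct.uncurry (RingHom.id k) H H X ∘ₗ φ))
    (Coalgebra.sum_tmul_tmul_eq r a₁ a₂)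
  simpa using this

end Sweedler

section Induction

variable {k : Type u} {V : Type w} [Field k] [AddCommGroup V] [Module k V]
variable {N : Type*} [AddCommGroup N] [Module k N] {W : Type*} [AddCommGroup W] [Module k W]

/-- Multiplication by the generators of `T(V)` on the free module `T(V) ⊗ N`. -/
def freeMul (k : Type u) (V : Type w) (N : Type*) [Field k] [AddCommGroup V] [Module k V]
    [AddCommGroup N] [Module k N] :
    V →ₗ[k] (TensorAlgebra k V ⊗[k] N) →ₗ[k] (TensorAlgebra k V ⊗[k] N) :=
  LinearMap.rTensorHom N ∘ₗ LinearMap.mul k (TensorAlgebra k V) ∘ₗ TensorAlgebra.ι k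

@[simp] theorem freeMul_tmul (v : V) (t : TensorAlgebra k V) (n : N) :
    freeMul k V N v (t ⊗ₜ n) = (TensorAlgebra.ι k v * t) ⊗ₜ n := by
  simp [freeMul]

/-- The linear map out of `T(V) ⊗ N` with prescribed values on `1 ⊗ N` and a prescribed rule for
multiplication by generators from the left. -/
def freeRec (b : N →ₗ[k] W) (s : V →ₗ[k] W →ₗ[k] W) : TensorAlgebra k V ⊗[k] N →ₗ[k] W :=
  TensorProduct.lift ((LinearMap.lcomp k W b) ∘ₗ
    (TensorAlgebra.lift k (A := Module.End k W) s).toLinearMap)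

@[simp] theorem freeRec_one_tmul (b : N →ₗ[k] W) (s : V →ₗ[k] W →ₗ[k] W) (n : N) :
    freeRec b s ((1 : TensorAlgebra k V) ⊗ₜ n) = b n := by
  simp [freeRec]

@[simp] theorem freeRec_freeMul (b : N →ₗ[k] W) (s : V →ₗ[k] W →ₗ[k] W) (v : V)
    (m : TensorAlgebra k V ⊗[k] N) :
    freeRec b s (freeMul k V N v m) = s v (freeRec b s m) := by
  induction m using TensorProduct.induction_on with
  | zero => simp
  | add x y hx hy => simp [hx, hy]
  | tmul t n => simp [freeRec]

/-- The free module is generated by `1 ⊗ N` under left multiplication by `V`, so identities between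
operators need checking only in these cases. -/
theorem free_induction {p : TensorAlgebra k V ⊗[k] N → Prop}
    (add : ∀ x y, p x → p y → p (x + y)) (one : ∀ n, p (1 ⊗ₜ n))
    (mul : ∀ v m, p m → p (freeMul k V N v m)) (m : TensorAlgebra k V ⊗[k] N) : p m := by
  induction m using TensorProduct.induction_on with
  | zero => simpa using one 0
  | add x y hx hy => exact add x y hx hy
  | tmul t n =>
    -- The claim is strengthened to a multiplier `a` on any `s`, for all `n` at once: products in
    -- `a` then split, and a scalar is absorbed into `n`.
    suffices h : ∀ a s : TensorAlgebra k V, (∀ n : N, p (s ⊗ₜ n)) → ∀ n : N, p ((a * s) ⊗ₜ n) by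
      simpa using h t 1 one n
    intro a
    induction a using TensorAlgebra.induction with
    | algebraMap r =>
      intro s hs n
      rw [← Algebra.smul_def, TensorProduct.smul_tmul]
      exact hs _
    | ι v =>
      intro s hs n
      rw [← freeMul_tmul]
      exact mul _ _ (hs n)
    | mul a b ha hb =>
      intro s hs n
      rw [mul_assoc]
      exact ha _ (hb _ hs) n
    | add a b ha hb =>
      intro s hs n
      rw [add_mul, TensorProduct.add_tmul]
      exact add _ _ (ha s hs n) (hb s hs n)

end Induction

variable {k : Type u} {H : Type v} {V : Type w}
variable [Field k] [Ring H] [Bialgebra k H]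

theorem sweedler_mul {X : Type*} [AddCommGroup X] [Module k X] (B : H →ₗ[k] H →ₗ[k] X)
    {ι κ : Type*} {a b : H} (r : Coalgebra.Repr k a ι) (s : Coalgebra.Repr k b κ) :
    sweedler B (a * b) =
      ∑ i ∈ r.index, ∑ j ∈ s.index, B (r.left i * s.left j) (r.right i * s.right j) := by
  simp only [sweedler, LinearMap.comp_apply, Bialgebra.comul_mul]
  rw [← r.eq, ← s.eq, Finset.sum_mul_sum]
  simp

theorem sweedler_one {X : Type*} [AddCommGroup X] [Module k X] (B : H →ₗ[k] H →ₗ[k] X) :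
    sweedler B 1 = B 1 1 := by
  simp [sweedler, Algebra.TensorProduct.one_def]

variable [AddCommGroup V] [Module k V] [Module H V] [IsScalarTower k H V]

@[simp] theorem lact_apply (h : H) (v : V) : lact k H V h v = h • v := rfl

theorem ract_one (f : Module.Dual k V) : ract k H V 1 f = f := by
  ext v; simp [ract]

theorem ract_mul (a b : H) (f : Module.Dual k V) :
    ract k H V (a * b) f = ract k H V b (ract k H V a f) := by
  ext v; simp [ract, mul_smul]

theorem ract_apply (h : H) (f : Module.Dual k V) (v : V) : ract k H V h f v = f (h • v) := rfl

/-- The pairing `β`, as a bilinear map. -/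
def pairingₗ (δ : V →ₗ[k] H ⊗[k] V) : Module.Dual k V →ₗ[k] V →ₗ[k] H :=
  LinearMap.mk₂ k (fun f v => pairing δ f v)
      (fun f f' v => by simp [pairing, LinearMap.lTensor_add])
      (fun c f v => by simp [pairing, LinearMap.lTensor_smul])
      (fun f v v' => by simp)
      (fun c f v => by simp)

@[simp] theorem pairingₗ_apply (δ : V →ₗ[k] H ⊗[k] V) (f : Module.Dual k V) (v : V) :
    pairingₗ δ f v = pairing δ f v := rfl

/-- The Yetter–Drinfeld condition in terms of the pairing:
`β(f, h₍₁₎ ▷ v) h₍₂₎ = h₍₁₎ β(f ◁ h₍₂₎, v)`. -/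
theorem IsQuasiYD.pairing_eq {δ : V →ₗ[k] H ⊗[k] V} (hδ : IsQuasiYD δ) (f : Module.Dual k V)
    (v : V) {ι : Type*} {h : H} (r : Coalgebra.Repr k h ι) :
    ∑ i ∈ r.index, pairing δ f (r.left i • v) * r.right i =
      ∑ i ∈ r.index, r.left i * pairing δ (ract k H V (r.right i) f) v := by
  have h1 := congrArg (TensorProduct.rid k H ∘ LinearMap.lTensor H f) (hδ h v)
  rw [← r.eq] at h1
  simp only [map_sum, TensorProduct.lift.tmul, LinearMap.mk₂_apply, Function.comp_apply,
    TensorProduct.sum_tmul] at h1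
  have key : ∀ (b : H) (z : H ⊗[k] V),
      TensorProduct.rid k H (LinearMap.lTensor H f
        (LinearMap.rTensor V (LinearMap.mulRight k b) z)) =
      TensorProduct.rid k H (LinearMap.lTensor H f z) * b := by
    intro b z
    induction z using TensorProduct.induction_on with
    | zero => simp
    | add x y hx hy => simp only [map_add, hx, hy, add_mul]
    | tmul a v => simp
  have key' : ∀ (a b : H) (z : H ⊗[k] V),
      TensorProduct.rid k H (LinearMap.lTensor H f
        (TensorProduct.map (TensorProduct.lift (LinearMap.mul k H))
          (TensorProduct.lift (lact k H V))
          (TensorProduct.tensorTensorTensorComm k H H H V ((a ⊗ₜ b) ⊗ₜ z)))) =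
      a * TensorProduct.rid k H (LinearMap.lTensor H (ract k H V b f) z) := by
    intro a b z
    induction z using TensorProduct.induction_on with
    | zero => simp
    | add x y hx hy => simp only [TensorProduct.tmul_add, map_add, hx, hy, mul_add]
    | tmul c v => simp [ract_apply]
  simp only [key, key'] at h1
  exact h1

section FreeModule

variable {N : Type x} [AddCommGroup N] [Module k N]

/-- The action of `H` on `T(V) ⊗ N` with `h (v m) = (h₍₁₎ ▷ v) (h₍₂₎ m)`. -/
def hAct (ρ : H →ₗ[k] N →ₗ[k] N) :
    H →ₗ[k] (TensorAlgebra k V ⊗[k] N) →ₗ[k] (TensorAlgebra k V ⊗[k] N) :=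
  -- Passing `v` replaces `h` by `h₍₂₎`, so the recursion carries all `h` at once: its values are
  -- functions of `h`.
  (freeRec (W := H →ₗ[k] (TensorAlgebra k V ⊗[k] N))
    (LinearMap.llcomp k H N _ (TensorProduct.mk k (TensorAlgebra k V) N 1) ∘ₗ ρ.flip)
    (LinearMap.mk₂ k
      (fun v g => sweedler ((freeMul k V N).compl₁₂ ((lact k H V).flip v) g))
      (fun v v' g => by
        ext h; simp [sweedler_eq_sum _ (Coalgebra.Repr.arbitrary k h), Finset.sum_add_distrib])
      (fun c v g => by
        ext h; simp [sweedler_eq_sum _ (Coalgebra.Repr.arbitrary k h), Finset.smul_sum])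
      (fun v g g' => by
        ext h; simp [sweedler_eq_sum _ (Coalgebra.Repr.arbitrary k h), Finset.sum_add_distrib])
      (fun c v g => by
        ext h; simp [sweedler_eq_sum _ (Coalgebra.Repr.arbitrary k h), Finset.smul_sum]))).flip

variable (ρ : H →ₗ[k] N →ₗ[k] N)

@[simp] theorem hAct_one_tmul (h : H) (n : N) :
    hAct (V := V) ρ h (1 ⊗ₜ n) = 1 ⊗ₜ ρ h n := by
  simp [hAct]

theorem hAct_freeMul {ι : Type*} {h : H} (r : Coalgebra.Repr k h ι) (v : V)
    (m : TensorAlgebra k V ⊗[k] N) :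
    hAct ρ h (freeMul k V N v m) =
      ∑ i ∈ r.index, freeMul k V N (r.left i • v) (hAct ρ (r.right i) m) := by
  simp [hAct, sweedler_eq_sum _ r]

theorem hAct_freeMul' (h : H) (v : V) (m : TensorAlgebra k V ⊗[k] N) :
    hAct ρ h (freeMul k V N v m) =
      sweedler ((freeMul k V N).compl₁₂ ((lact k H V).flip v) ((hAct ρ).flip m)) h := by
  simp [hAct_freeMul ρ (Coalgebra.Repr.arbitrary k h),
    sweedler_eq_sum _ (Coalgebra.Repr.arbitrary k h)]

theorem hAct_one (h1 : ρ 1 = LinearMap.id) (m : TensorAlgebra k V ⊗[k] N) : hAct ρ 1 m = m := by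
  induction m using free_induction with
  | add x y hx hy => simp [hx, hy]
  | one n => simp [h1]
  | mul v m hm => simp [hAct_freeMul', sweedler_one, hm]

/-- The inductive step is multiplicativity of the coproduct together with `(a b) ▷ v = a ▷ (b ▷ v)`.
-/
theorem hAct_mul (hmul : ∀ a b, ρ (a * b) = ρ a ∘ₗ ρ b) (a b : H)
    (m : TensorAlgebra k V ⊗[k] N) : hAct ρ (a * b) m = hAct ρ a (hAct ρ b m) := by
  induction m using free_induction generalizing a b with
  | add x y hx hy => simp [hx, hy]
  | one n => simp [hmul]
  | mul v m hm =>
    rw [hAct_freeMul', sweedler_mul _ (Coalgebra.Repr.arbitrary k a)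
      (Coalgebra.Repr.arbitrary k b), hAct_freeMul ρ (Coalgebra.Repr.arbitrary k b), map_sum]
    simp_rw [hAct_freeMul ρ (Coalgebra.Repr.arbitrary k a)]
    rw [Finset.sum_comm]
    simp [hm, mul_smul]

variable (δ : V →ₗ[k] H ⊗[k] V)
variable (σ : Module.Dual k V →ₗ[k] N →ₗ[k] N)

/-- The recursion underlying `fAct`: the first component is the action of `V*`, the second one
is the identity. -/
def fActAux : TensorAlgebra k V ⊗[k] N →ₗ[k]
    (Module.Dual k V →ₗ[k] (TensorAlgebra k V ⊗[k] N)) × (TensorAlgebra k V ⊗[k] N) :=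
  freeRec
    ((LinearMap.llcomp k (Module.Dual k V) N _ (TensorProduct.mk k (TensorAlgebra k V) N 1) ∘ₗ
      σ.flip).prod (TensorProduct.mk k (TensorAlgebra k V) N 1))
    (LinearMap.mk₂ k
      -- The term `β(f, v) m` involves `m` itself and not only the value of the recursion at `m`, so
      -- `m` is carried along as second component.
      (fun v g => (freeMul k V N v ∘ₗ g.1 + (hAct ρ).flip g.2 ∘ₗ (pairingₗ δ).flip v,
        freeMul k V N v g.2))
      (fun v v' g => by ext <;> simp; abel)
      (fun c v g => by ext <;> simp)
      (fun v g g' => by ext <;> simp; abel)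
      (fun c v g => by ext <;> simp))

/-- The action of `V*` on `T(V) ⊗ N` with `f (v m) = v (f m) + β(f, v) m`. -/
def fAct : Module.Dual k V →ₗ[k] (TensorAlgebra k V ⊗[k] N) →ₗ[k] (TensorAlgebra k V ⊗[k] N) :=
  (LinearMap.fst k _ _ ∘ₗ fActAux ρ δ σ).flip

@[simp] theorem fAct_one_tmul (f : Module.Dual k V) (n : N) :
    fAct ρ δ σ f (1 ⊗ₜ n) = 1 ⊗ₜ σ f n := by
  simp [fAct, fActAux]

theorem fActAux_snd (m : TensorAlgebra k V ⊗[k] N) : (fActAux ρ δ σ m).2 = m := by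
  induction m using free_induction with
  | add x y hx hy => simp [hx, hy]
  | one n => simp [fActAux]
  | mul v m hm =>
    conv_rhs => rw [← hm]
    simp [fActAux]

theorem fAct_freeMul (f : Module.Dual k V) (v : V) (m : TensorAlgebra k V ⊗[k] N) :
    fAct ρ δ σ f (freeMul k V N v m) =
      freeMul k V N v (fAct ρ δ σ f m) + hAct ρ (pairing δ f v) m := by
  have h : fAct ρ δ σ f (freeMul k V N v m) =
      freeMul k V N v (fAct ρ δ σ f m) + hAct ρ (pairing δ f v) (fActAux ρ δ σ m).2 := by
    simp [fAct, fActAux]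
  rwa [fActAux_snd] at h

/-- On `v m` both sides split into a part where `f` passes `v` and a commutator part. The first
parts agree by induction and coassociativity, the commutator parts by the Yetter–Drinfeld condition
in the form `pairing_eq`. -/
theorem fAct_hAct {δ : V →ₗ[k] H ⊗[k] V} (hδ : IsQuasiYD δ)
    (hmul : ∀ a b, ρ (a * b) = ρ a ∘ₗ ρ b)
    (hσ : ∀ f h n, σ f (ρ h n) = sweedler (ρ.compl₁₂ LinearMap.id
      (σ.flip n ∘ₗ (ract k H V).flip f)) h)
    (f : Module.Dual k V) (h : H) (m : TensorAlgebra k V ⊗[k] N) :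
    fAct ρ δ σ f (hAct ρ h m) =
      sweedler ((hAct ρ).compl₁₂ LinearMap.id ((fAct ρ δ σ).flip m ∘ₗ (ract k H V).flip f)) h := by
  induction m using free_induction generalizing h f with
  | add x y hx hy =>
    rw [map_add, map_add, hx, hy]
    simp [sweedler_eq_sum _ (Coalgebra.Repr.arbitrary k h), Finset.sum_add_distrib]
  | one n =>
    simp only [hAct_one_tmul, fAct_one_tmul, hσ]
    simp [sweedler_eq_sum _ (Coalgebra.Repr.arbitrary k h), TensorProduct.tmul_sum]
  | mul v m hm =>
    have r := Coalgebra.Repr.arbitrary k h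
    -- `φ(a, b, c) = (a ▷ v) (b ((f ◁ c) m))`.
    let φ : H →ₗ[k] H →ₗ[k] H →ₗ[k] (TensorAlgebra k V ⊗[k] N) :=
      LinearMap.mk₂ k (fun a b => freeMul k V N (a • v) ∘ₗ hAct ρ b ∘ₗ (fAct ρ δ σ).flip m ∘ₗ
          (ract k H V).flip f)
        (fun a a' b => by ext; simp [add_smul]) (fun c a b => by ext; simp)
        (fun a b b' => by ext; simp) (fun c a b => by ext; simp)
    have e := sum_coassoc φ r (fun i => Coalgebra.Repr.arbitrary k _)
      (fun i => Coalgebra.Repr.arbitrary k _)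
    have yd := congrArg ((hAct ρ).flip m) (hδ.pairing_eq f v r)
    simp only [map_sum, LinearMap.flip_apply, hAct_mul ρ hmul] at yd
    rw [hAct_freeMul ρ r, map_sum, sweedler_eq_sum _ r]
    simp only [fAct_freeMul, Finset.sum_add_distrib, LinearMap.compl₁₂_apply,
      LinearMap.comp_apply, LinearMap.flip_apply, LinearMap.id_apply, map_add]
    rw [yd]
    congr 1
    simp only [hm, sweedler_eq_sum _ (Coalgebra.Repr.arbitrary k _),
      hAct_freeMul ρ (Coalgebra.Repr.arbitrary k _), map_sum]
    simpa [φ] using e.symm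

end FreeModule

end FreeActions

/-! ### Universal property and triangular decomposition of `Ã(V, δ)`. -/

section TriangularDecomposition

variable {k : Type u} {H : Type v} {V : Type w}
variable [Field k] [Ring H] [Bialgebra k H]
variable [AddCommGroup V] [Module k V] [Module H V] [IsScalarTower k H V]
variable (δ : V →ₗ[k] H ⊗[k] V)

section Lift

variable {A : Type*} [Ring A] [Algebra k A]

theorem mul'_map_comul (a b : H →ₗ[k] A) (h : H) :
    LinearMap.mul' k A (TensorProduct.map a b (Coalgebra.comul (R := k) h)) =
      sweedler ((LinearMap.mul k A).compl₁₂ a b) h := by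
  have r := Coalgebra.Repr.arbitrary k h
  rw [sweedler_eq_sum _ r, ← r.eq]
  simp

theorem map_sweedler_mul {B : Type*} [Ring B] [Algebra k B] (φ : A →ₐ[k] B)
    (a b : H →ₗ[k] A) (h : H) :
    φ (sweedler ((LinearMap.mul k A).compl₁₂ a b) h) =
      sweedler ((LinearMap.mul k B).compl₁₂ (φ.toLinearMap ∘ₗ a) (φ.toLinearMap ∘ₗ b)) h := by
  have r := Coalgebra.Repr.arbitrary k h
  simp [sweedler_eq_sum _ r]

/-- The universal property of `Ã(V, δ)`. -/
def freeDoubleLift (a : V →ₗ[k] A) (b : H →ₗ[k] A) (c : Module.Dual k V →ₗ[k] A)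
    (one : b 1 = 1) (mul : ∀ x y, b (x * y) = b x * b y)
    (left : ∀ h v, b h * a v =
      sweedler ((LinearMap.mul k A).compl₁₂ (a ∘ₗ (lact k H V).flip v) b) h)
    (right : ∀ f h, c f * b h =
      sweedler ((LinearMap.mul k A).compl₁₂ b (c ∘ₗ (ract k H V).flip f)) h)
    (comm : ∀ f v, c f * a v = a v * c f + b (pairing δ f v)) : FreeDouble δ →ₐ[k] A :=
  RingQuot.liftAlgHom k ⟨TensorAlgebra.lift k (a.coprod (b.coprod c)), by
    have hV : (TensorAlgebra.lift k (a.coprod (b.coprod c))).toLinearMap ∘ₗ preV k H V = a := by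
      ext; simp [preV]
    have hH : (TensorAlgebra.lift k (a.coprod (b.coprod c))).toLinearMap ∘ₗ preH k H V = b := by
      ext; simp [preH]
    have hF : (TensorAlgebra.lift k (a.coprod (b.coprod c))).toLinearMap ∘ₗ preF k H V = c := by
      ext; simp [preF]
    have hV' := fun v => LinearMap.congr_fun hV v
    have hH' := fun v => LinearMap.congr_fun hH v
    have hF' := fun v => LinearMap.congr_fun hF v
    simp only [LinearMap.comp_apply, AlgHom.toLinearMap_apply] at hV' hH' hF'
    intro x y hxy
    induction hxy with
    | one => simp [hH', one]
    | mul x y => simp [hH', mul]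
    | left h v =>
      rw [mul'_map_comul, map_sweedler_mul, map_mul, ← LinearMap.comp_assoc, hV, hH, hH', hV', left]
    | right f h =>
      rw [mul'_map_comul, map_sweedler_mul, map_mul, ← LinearMap.comp_assoc, hF, hH, hH', hF',
        right]
    | comm f v => simp [hH', hV', hF', comm]⟩

end Lift

theorem incV_ι (v : V) : incV δ (TensorAlgebra.ι k v) =
    RingQuot.mkAlgHom k (Rel δ) (preV k H V v) := by
  simp [incV]

theorem incF_ι (f : Module.Dual k V) : incF δ (TensorAlgebra.ι k f) =
    RingQuot.mkAlgHom k (Rel δ) (preF k H V f) := by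
  simp [incF]

section LiftApply

variable {δ} {A : Type*} [Ring A] [Algebra k A] {a : V →ₗ[k] A} {b : H →ₗ[k] A}
  {c : Module.Dual k V →ₗ[k] A} (one : b 1 = 1) (mul : ∀ x y, b (x * y) = b x * b y)
  (left : ∀ h v, b h * a v =
    sweedler ((LinearMap.mul k A).compl₁₂ (a ∘ₗ (lact k H V).flip v) b) h)
  (right : ∀ f h, c f * b h =
    sweedler ((LinearMap.mul k A).compl₁₂ b (c ∘ₗ (ract k H V).flip f)) h)
  (comm : ∀ f v, c f * a v = a v * c f + b (pairing δ f v))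

theorem freeDoubleLift_incV_ι (v : V) :
    freeDoubleLift δ a b c one mul left right comm (incV δ (TensorAlgebra.ι k v)) = a v := by
  simp [freeDoubleLift, incV_ι, preV]

theorem freeDoubleLift_incH (h : H) :
    freeDoubleLift δ a b c one mul left right comm (incH δ h) = b h := by
  simp [freeDoubleLift, incH, preH]

theorem freeDoubleLift_incF_ι (f : Module.Dual k V) :
    freeDoubleLift δ a b c one mul left right comm (incF δ (TensorAlgebra.ι k f)) = c f := by
  simp [freeDoubleLift, incF_ι, preF]

end LiftApply

section Rep

variable {M : Type*} [AddCommGroup M] [Module k M] (a : V →ₗ[k] M →ₗ[k] M) (b : H →ₗ[k] M →ₗ[k] M)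
  (c : Module.Dual k V →ₗ[k] M →ₗ[k] M) (one : ∀ m, b 1 m = m)
  (mul : ∀ x y m, b (x * y) m = b x (b y m))
  (left : ∀ h v m, b h (a v m) = sweedler (a.compl₁₂ ((lact k H V).flip v) (b.flip m)) h)
  (right : ∀ f h m, c f (b h m) =
    sweedler (b.compl₁₂ LinearMap.id (c.flip m ∘ₗ (ract k H V).flip f)) h)
  (comm : ∀ f v m, c f (a v m) = a v (c f m) + b (pairing δ f v) m)

/-- Representations of `Ã(V, δ)` in terms of operators satisfying the defining relations. -/
def freeDoubleRep : FreeDouble δ →ₐ[k] Module.End k M :=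
  freeDoubleLift δ (A := Module.End k M) a b c (LinearMap.ext one)
    (fun x y => LinearMap.ext (mul x y))
    (fun h v => LinearMap.ext fun m => by
      have r := Coalgebra.Repr.arbitrary k h
      simp [left, sweedler_eq_sum _ r])
    (fun f h => LinearMap.ext fun m => by
      have r := Coalgebra.Repr.arbitrary k h
      simp [right, sweedler_eq_sum _ r])
    (fun f v => LinearMap.ext fun m => by simp [comm])

variable {δ}

theorem freeDoubleRep_incV_ι (v : V) (m : M) :
    freeDoubleRep δ a b c one mul left right comm (incV δ (TensorAlgebra.ι k v)) m = a v m := by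
  rw [freeDoubleRep, freeDoubleLift_incV_ι]

theorem freeDoubleRep_incH (h : H) (m : M) :
    freeDoubleRep δ a b c one mul left right comm (incH δ h) m = b h m := by
  rw [freeDoubleRep, freeDoubleLift_incH]

theorem freeDoubleRep_incF_ι (f : Module.Dual k V) (m : M) :
    freeDoubleRep δ a b c one mul left right comm (incF δ (TensorAlgebra.ι k f)) m = c f m := by
  rw [freeDoubleRep, freeDoubleLift_incF_ι]

end Rep

theorem incH_one : incH δ 1 = 1 := by
  simpa [incH] using RingQuot.mkAlgHom_rel k (Rel.one (δ := δ))

theorem incH_mul (a b : H) : incH δ (a * b) = incH δ a * incH δ b := by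
  simpa [incH] using RingQuot.mkAlgHom_rel k (Rel.mul (δ := δ) a b)

theorem incH_mul_incV_ι (h : H) (v : V) : incH δ h * incV δ (TensorAlgebra.ι k v) =
    sweedler ((LinearMap.mul k (FreeDouble δ)).compl₁₂
      ((incV δ).toLinearMap ∘ₗ TensorAlgebra.ι k ∘ₗ (lact k H V).flip v) (incH δ)) h := by
  have := RingQuot.mkAlgHom_rel k (Rel.left (δ := δ) h v)
  rw [mul'_map_comul, map_sweedler_mul, map_mul, ← incV_ι] at this
  have hV : (incV δ).toLinearMap ∘ₗ TensorAlgebra.ι k =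
      (RingQuot.mkAlgHom k (Rel δ)).toLinearMap ∘ₗ preV k H V := LinearMap.ext (incV_ι δ)
  rw [← LinearMap.comp_assoc, ← hV, LinearMap.comp_assoc] at this
  exact this

theorem incF_ι_mul_incH (f : Module.Dual k V) (h : H) :
    incF δ (TensorAlgebra.ι k f) * incH δ h =
      sweedler ((LinearMap.mul k (FreeDouble δ)).compl₁₂ (incH δ)
        ((incF δ).toLinearMap ∘ₗ TensorAlgebra.ι k ∘ₗ (ract k H V).flip f)) h := by
  have := RingQuot.mkAlgHom_rel k (Rel.right (δ := δ) f h)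
  rw [mul'_map_comul, map_sweedler_mul, map_mul, ← incF_ι] at this
  have hF : (incF δ).toLinearMap ∘ₗ TensorAlgebra.ι k =
      (RingQuot.mkAlgHom k (Rel δ)).toLinearMap ∘ₗ preF k H V := LinearMap.ext (incF_ι δ)
  rw [← LinearMap.comp_assoc, ← hF, LinearMap.comp_assoc] at this
  exact this

theorem incF_ι_mul_incV_ι (f : Module.Dual k V) (v : V) :
    incF δ (TensorAlgebra.ι k f) * incV δ (TensorAlgebra.ι k v) =
      incV δ (TensorAlgebra.ι k v) * incF δ (TensorAlgebra.ι k f) + incH δ (pairing δ f v) := by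
  have := RingQuot.mkAlgHom_rel k (Rel.comm (δ := δ) f v)
  rw [map_sub, map_mul, map_mul, ← incV_ι, ← incF_ι, sub_eq_iff_eq_add'] at this
  exact this

@[elab_as_elim]
theorem freeDouble_induction {p : FreeDouble δ → Prop}
    (add : ∀ x y, p x → p y → p (x + y)) (scalar : ∀ c : k, p (algebraMap k _ c))
    (mul : ∀ x y, p x → p y → p (x * y)) (hV : ∀ v, p (incV δ (TensorAlgebra.ι k v)))
    (hH : ∀ h, p (incH δ h)) (hF : ∀ f, p (incF δ (TensorAlgebra.ι k f)))
    (a : FreeDouble δ) : p a := by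
  obtain ⟨a, rfl⟩ := RingQuot.mkAlgHom_surjective k (Rel δ) a
  induction a using TensorAlgebra.induction with
  | algebraMap r => simpa using scalar r
  | ι z =>
    obtain ⟨v, h, f⟩ := z
    have : TensorAlgebra.ι k (v, h, f) = preV k H V v + (preH k H V h + preF k H V f) := by
      simp [preV, preH, preF, ← map_add]
    rw [this, map_add, map_add]
    refine add _ _ ?_ (add _ _ (hH h) ?_)
    · rw [← incV_ι]; exact hV v
    · rw [← incF_ι]; exact hF f
  | mul a b ha hb => rw [map_mul]; exact mul _ _ ha hb
  | add a b ha hb => rw [map_add]; exact add _ _ ha hb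

section NormalForm

/-- The space `H ⊗ T(V*)`. -/
abbrev PlusHalf (k : Type u) (H : Type v) (V : Type w) [Field k] [Ring H] [Bialgebra k H]
    [AddCommGroup V] [Module k V] :=
  H ⊗[k] TensorAlgebra k (Module.Dual k V)

/-- Left multiplication by `H` on `H ⊗ T(V*)`. -/
def plusH (k : Type u) (H : Type v) (V : Type w) [Field k] [Ring H] [Bialgebra k H]
    [AddCommGroup V] [Module k V] : H →ₗ[k] PlusHalf k H V →ₗ[k] PlusHalf k H V :=
  LinearMap.rTensorHom _ ∘ₗ LinearMap.mul k H

@[simp] theorem plusH_tmul (h x : H) (s : TensorAlgebra k (Module.Dual k V)) :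
    plusH k H V h (x ⊗ₜ s) = (h * x) ⊗ₜ s := by
  simp [plusH]

/-- The bilinear map `(a, b) ↦ (s ↦ a ⊗ (f ◁ b) s)`. -/
def plusFAux (f : Module.Dual k V) :
    H →ₗ[k] H →ₗ[k] TensorAlgebra k (Module.Dual k V) →ₗ[k] PlusHalf k H V :=
  LinearMap.mk₂ k
    (fun a b => TensorProduct.mk k H _ a ∘ₗ
      LinearMap.mulLeft k (TensorAlgebra.ι k (ract k H V b f)))
    (fun a a' b => by ext; simp)
    (fun c a b => by ext; simp)
    (fun a b b' => by ext; simp [add_mul, TensorProduct.tmul_add])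
    (fun c a b => by ext; simp)

@[simp] theorem plusFAux_apply (f : Module.Dual k V) (a b : H)
    (s : TensorAlgebra k (Module.Dual k V)) :
    plusFAux f a b s = a ⊗ₜ (TensorAlgebra.ι k (ract k H V b f) * s) := rfl

/-- Left multiplication by `V*` on `H ⊗ T(V*)`: `f (x ⊗ s) = x₍₁₎ ⊗ (f ◁ x₍₂₎) s`. -/
def plusF (k : Type u) (H : Type v) (V : Type w) [Field k] [Ring H] [Bialgebra k H]
    [AddCommGroup V] [Module k V] [Module H V] [IsScalarTower k H V] :
    Module.Dual k V →ₗ[k] PlusHalf k H V →ₗ[k] PlusHalf k H V where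
  toFun f := TensorProduct.lift (sweedler (plusFAux f))
  map_add' f f' := by
    refine TensorProduct.ext' fun x s => ?_
    simp [sweedler_eq_sum _ (Coalgebra.Repr.arbitrary k x), TensorProduct.tmul_add, add_mul,
      Finset.sum_add_distrib]
  map_smul' c f := by
    refine TensorProduct.ext' fun x s => ?_
    simp [sweedler_eq_sum _ (Coalgebra.Repr.arbitrary k x), Finset.smul_sum]

theorem plusF_tmul (f : Module.Dual k V) {ι : Type*} {x : H} (r : Coalgebra.Repr k x ι)
    (s : TensorAlgebra k (Module.Dual k V)) :
    plusF k H V f (x ⊗ₜ s) =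
      ∑ i ∈ r.index, r.left i ⊗ₜ (TensorAlgebra.ι k (ract k H V (r.right i) f) * s) := by
  simp [plusF, sweedler_eq_sum _ r]

theorem plusF_tmul' (f : Module.Dual k V) (x : H) (s : TensorAlgebra k (Module.Dual k V)) :
    plusF k H V f (x ⊗ₜ s) = sweedler (plusFAux f) x s := by
  simp [plusF]

/-- This is the hypothesis on `σ` in `fAct_hAct` for `N = H ⊗ T(V*)`; it holds because `Δ` is
multiplicative and `V*` is a right `H`-module. -/
theorem plusF_plusH (f : Module.Dual k V) (h : H) (n : PlusHalf k H V) :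
    plusF k H V f (plusH k H V h n) = sweedler ((plusH k H V).compl₁₂ LinearMap.id
      ((plusF k H V).flip n ∘ₗ (ract k H V).flip f)) h := by
  have r := Coalgebra.Repr.arbitrary k h
  rw [sweedler_eq_sum _ r]
  induction n using TensorProduct.induction_on with
  | zero => simp
  | add x y hx hy => simp only [map_add, hx, hy]; simp [Finset.sum_add_distrib]
  | tmul x s =>
    have q := Coalgebra.Repr.arbitrary k x
    rw [plusH_tmul, plusF_tmul', sweedler_mul _ r q]
    simp [plusF_tmul _ q, ract_mul]

/-- The space `T(V) ⊗ (H ⊗ T(V*))` underlying `Ã(V, δ)`. -/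
abbrev NormalForm (k : Type u) (H : Type v) (V : Type w) [Field k] [Ring H] [Bialgebra k H]
    [AddCommGroup V] [Module k V] :=
  TensorAlgebra k V ⊗[k] PlusHalf k H V

theorem plusH_one : plusH k H V 1 = LinearMap.id := by
  ext; simp

theorem plusH_mul (a b : H) : plusH k H V (a * b) = plusH k H V a ∘ₗ plusH k H V b := by
  ext; simp [mul_assoc]

variable {δ} (hδ : IsQuasiYD δ)

/-- The action of `Ã(V, δ)` on `T(V) ⊗ (H ⊗ T(V*))`. -/
def normalRep : FreeDouble δ →ₐ[k] Module.End k (NormalForm k H V) :=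
  freeDoubleRep δ (freeMul k V (PlusHalf k H V)) (hAct (plusH k H V))
    (fAct (plusH k H V) δ (plusF k H V)) (hAct_one _ plusH_one) (hAct_mul _ plusH_mul)
    (hAct_freeMul' _) (fAct_hAct _ _ hδ plusH_mul plusF_plusH) (fAct_freeMul _ _ _)

@[simp] theorem normalRep_incV_ι (v : V) (m : NormalForm k H V) :
    normalRep hδ (incV δ (TensorAlgebra.ι k v)) m = freeMul k V _ v m :=
  freeDoubleRep_incV_ι ..

@[simp] theorem normalRep_incH (h : H) (m : NormalForm k H V) :
    normalRep hδ (incH δ h) m = hAct (plusH k H V) h m :=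
  freeDoubleRep_incH ..

@[simp] theorem normalRep_incF_ι (f : Module.Dual k V) (m : NormalForm k H V) :
    normalRep hδ (incF δ (TensorAlgebra.ι k f)) m = fAct (plusH k H V) δ (plusF k H V) f m :=
  freeDoubleRep_incF_ι ..

theorem normalRep_incV (t t' : TensorAlgebra k V) (n : PlusHalf k H V) :
    normalRep hδ (incV δ t) (t' ⊗ₜ n) = (t * t') ⊗ₜ n := by
  induction t using TensorAlgebra.induction generalizing t' with
  | algebraMap r => simp [TensorProduct.smul_tmul', Algebra.smul_def]
  | ι v => simp
  | mul a b ha hb => simp [ha, hb, mul_assoc]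
  | add a b ha hb => simp [ha, hb, add_mul, TensorProduct.add_tmul]

/-- When the middle factor is `1`, its coproduct is `1 ⊗ 1` and `f` acts by plain multiplication;
`toNormal_mul` needs only this case. -/
theorem normalRep_incF (s s' : TensorAlgebra k (Module.Dual k V)) :
    normalRep hδ (incF δ s) (1 ⊗ₜ (1 ⊗ₜ s')) = 1 ⊗ₜ (1 ⊗ₜ (s * s')) := by
  induction s using TensorAlgebra.induction generalizing s' with
  | algebraMap r =>
    rw [AlgHom.commutes, AlgHom.commutes, Module.algebraMap_end_apply, ← Algebra.smul_def,
      TensorProduct.tmul_smul, TensorProduct.tmul_smul]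
  | ι f => simp [plusF_tmul', sweedler_one, ract_one]
  | mul a b ha hb => simp [ha, hb, mul_assoc]
  | add a b ha hb => simp [ha, hb, add_mul, TensorProduct.tmul_add]

/-- The normal form of an element of `Ã(V, δ)`. -/
def toNormal : FreeDouble δ →ₗ[k] NormalForm k H V :=
  LinearMap.applyₗ (1 ⊗ₜ (1 ⊗ₜ 1)) ∘ₗ (normalRep hδ).toLinearMap

theorem toNormal_apply (a : FreeDouble δ) :
    toNormal hδ a = normalRep hδ a (1 ⊗ₜ (1 ⊗ₜ 1)) := rfl

-- The cyclic vector `1 ⊗ 1 ⊗ 1` reproduces the normal form, so multiplication `T(V) ⊗ H ⊗ T(V*) →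
-- Ã(V, δ)` is injective.
@[simp] theorem toNormal_mul (t : TensorAlgebra k V) (h : H)
    (s : TensorAlgebra k (Module.Dual k V)) :
    toNormal hδ (incV δ t * incH δ h * incF δ s) = t ⊗ₜ (h ⊗ₜ s) := by
  simp [toNormal_apply, normalRep_incF, normalRep_incV]

variable (δ)

/-- Multiplication `H ⊗ T(V*) → Ã(V, δ)`. -/
def ofPlus : PlusHalf k H V →ₗ[k] FreeDouble δ :=
  LinearMap.mul' k _ ∘ₗ TensorProduct.map (incH δ) (incF δ).toLinearMap

/-- Multiplication `T(V) ⊗ (H ⊗ T(V*)) → Ã(V, δ)`. -/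
def ofNormal : NormalForm k H V →ₗ[k] FreeDouble δ :=
  LinearMap.mul' k _ ∘ₗ TensorProduct.map (incV δ).toLinearMap (ofPlus δ)

@[simp] theorem ofPlus_tmul (h : H) (s : TensorAlgebra k (Module.Dual k V)) :
    ofPlus δ (h ⊗ₜ s) = incH δ h * incF δ s := by
  simp [ofPlus]

@[simp] theorem ofNormal_tmul (t : TensorAlgebra k V) (n : PlusHalf k H V) :
    ofNormal δ (t ⊗ₜ n) = incV δ t * ofPlus δ n := by
  simp [ofNormal]

theorem ofNormal_freeMul (v : V) (m : NormalForm k H V) :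
    ofNormal δ (freeMul k V _ v m) = incV δ (TensorAlgebra.ι k v) * ofNormal δ m := by
  induction m using TensorProduct.induction_on with
  | zero => simp
  | add x y hx hy => simp [hx, hy, mul_add]
  | tmul t n => simp [mul_assoc]

theorem ofNormal_hAct (h : H) (m : NormalForm k H V) :
    ofNormal δ (hAct (plusH k H V) h m) = incH δ h * ofNormal δ m := by
  induction m using free_induction generalizing h with
  | add x y hx hy => simp [hx, hy, mul_add]
  | one n =>
    induction n using TensorProduct.induction_on with
    | zero => simp
    | add x y hx hy => simp only [TensorProduct.tmul_add, map_add, hx, hy, mul_add]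
    | tmul x s => simp [incH_mul, mul_assoc]
  | mul v m hm =>
    rw [ofNormal_freeMul, ← mul_assoc, incH_mul_incV_ι,
      hAct_freeMul _ (Coalgebra.Repr.arbitrary k h), map_sum,
      sweedler_eq_sum _ (Coalgebra.Repr.arbitrary k h), Finset.sum_mul]
    simp [ofNormal_freeMul, hm, mul_assoc]

theorem ofNormal_fAct (f : Module.Dual k V) (m : NormalForm k H V) :
    ofNormal δ (fAct (plusH k H V) δ (plusF k H V) f m) =
      incF δ (TensorAlgebra.ι k f) * ofNormal δ m := by
  induction m using free_induction with
  | add x y hx hy => simp [hx, hy, mul_add]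
  | one n =>
    induction n using TensorProduct.induction_on with
    | zero => simp
    | add x y hx hy =>
      simp only [fAct_one_tmul, map_add, TensorProduct.tmul_add, mul_add] at hx hy ⊢
      rw [hx, hy]
    | tmul x s =>
      simp only [fAct_one_tmul, ofNormal_tmul, map_one, one_mul, ofPlus_tmul, ← mul_assoc,
        incF_ι_mul_incH, plusF_tmul _ (Coalgebra.Repr.arbitrary k x), map_sum,
        sweedler_eq_sum _ (Coalgebra.Repr.arbitrary k x), Finset.sum_mul]
      simp [mul_assoc]
  | mul v m hm =>
    rw [ofNormal_freeMul, ← mul_assoc, incF_ι_mul_incV_ι, fAct_freeMul, map_add,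
      ofNormal_freeMul, hm, ofNormal_hAct, add_mul, mul_assoc]

variable {δ}

/-- Each operator was defined by the rule that the relations of `Ã` impose on left multiplication,
so multiplication intertwines the two actions. At the cyclic vector this yields surjectivity,
`ofNormal_toNormal`. -/
theorem ofNormal_normalRep (a : FreeDouble δ) (m : NormalForm k H V) :
    ofNormal δ (normalRep hδ a m) = a * ofNormal δ m := by
  induction a using freeDouble_induction generalizing m with
  | add x y hx hy => simp [hx, hy, add_mul]
  | scalar c => simp [Algebra.smul_def]
  | mul x y hx hy => simp [hx, hy, mul_assoc]
  | hV v => simp [ofNormal_freeMul]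
  | hH h => simp [ofNormal_hAct]
  | hF f => simp [ofNormal_fAct]

theorem ofNormal_toNormal (a : FreeDouble δ) : ofNormal δ (toNormal hδ a) = a := by
  simp [toNormal_apply, ofNormal_normalRep, incH_one]

include hδ in
@[elab_as_elim]
theorem normal_induction {p : FreeDouble δ → Prop} (add : ∀ x y, p x → p y → p (x + y))
    (mul : ∀ t h s, p (incV δ t * incH δ h * incF δ s)) (a : FreeDouble δ) : p a := by
  rw [← ofNormal_toNormal hδ a]
  induction toNormal hδ a using TensorProduct.induction_on with
  | zero => simpa using mul 0 0 0
  | add x y hx hy => rw [map_add]; exact add _ _ hx hy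
  | tmul t n =>
    induction n using TensorProduct.induction_on with
    | zero => simpa using mul 0 0 0
    | add x y hx hy => rw [TensorProduct.tmul_add, map_add]; exact add _ _ hx hy
    | tmul h s => simpa [mul_assoc] using mul t h s

end NormalForm

end TriangularDecomposition

/-! ### Triangular ideals, braided doubles and minimal doubles. -/

section TriangularIdeals

variable {k : Type u} {H : Type v} {V : Type w}
variable [Field k] [Ring H] [Bialgebra k H]
variable [AddCommGroup V] [Module k V] [Module H V] [IsScalarTower k H V]
variable {δ : V →ₗ[k] H ⊗[k] V} (hδ : IsQuasiYD δ)

section Projections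

/-- The projection `t ⊗ h ⊗ s ↦ g(h) ε(s) t` of `Ã(V, δ)` onto `T(V)`. -/
def projV (g : Module.Dual k H) : FreeDouble δ →ₗ[k] TensorAlgebra k V :=
  (TensorProduct.rid k _).toLinearMap ∘ₗ LinearMap.lTensor _ (LinearMap.mul' k k ∘ₗ
    TensorProduct.map g (TensorAlgebra.algebraMapInv (R := k) (M := Module.Dual k V)).toLinearMap)
    ∘ₗ toNormal hδ

/-- The projection `t ⊗ h ⊗ s ↦ ε(t) g(h) s` of `Ã(V, δ)` onto `T(V*)`. -/
def projF (g : Module.Dual k H) : FreeDouble δ →ₗ[k] TensorAlgebra k (Module.Dual k V) :=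
  (TensorProduct.lid k _).toLinearMap ∘ₗ
    TensorProduct.map (TensorAlgebra.algebraMapInv (R := k) (M := V)).toLinearMap
      ((TensorProduct.lid k _).toLinearMap ∘ₗ LinearMap.rTensor _ g) ∘ₗ toNormal hδ

@[simp] theorem projV_mul (g : Module.Dual k H) (t : TensorAlgebra k V) (h : H)
    (s : TensorAlgebra k (Module.Dual k V)) :
    projV hδ g (incV δ t * incH δ h * incF δ s) =
      (g h * TensorAlgebra.algebraMapInv s) • t := by
  simp [projV]

@[simp] theorem projF_mul (g : Module.Dual k H) (t : TensorAlgebra k V) (h : H)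
    (s : TensorAlgebra k (Module.Dual k V)) :
    projF hδ g (incV δ t * incH δ h * incF δ s) =
      (TensorAlgebra.algebraMapInv t * g h) • s := by
  simpa [projF, mul_smul] using smul_comm _ _ _

theorem projV_incV_mul_incH (g : Module.Dual k H) (t : TensorAlgebra k V) (h : H) :
    projV hδ g (incV δ t * incH δ h) = g h • t := by
  simpa using projV_mul hδ g t h 1

theorem projF_incH_mul_incF (g : Module.Dual k H) (h : H)
    (s : TensorAlgebra k (Module.Dual k V)) :
    projF hδ g (incH δ h * incF δ s) = g h • s := by
  simpa using projF_mul hδ g 1 h s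

theorem projV_incV (t : TensorAlgebra k V) :
    projV hδ (Coalgebra.counit (R := k) (A := H)) (incV δ t) = t := by
  simpa [incH_one] using projV_incV_mul_incH hδ (Coalgebra.counit (R := k) (A := H)) t 1

theorem projF_incF (s : TensorAlgebra k (Module.Dual k V)) :
    projF hδ (Coalgebra.counit (R := k) (A := H)) (incF δ s) = s := by
  simpa [incH_one] using projF_incH_mul_incF hδ (Coalgebra.counit (R := k) (A := H)) 1 s

end Projections

section TriangularForm

theorem mul_mul_le {R A : Type*} [CommSemiring R] [Semiring A] [Algebra R A]
    {M N P S : Submodule R A} (h : ∀ a ∈ M, ∀ b ∈ N, ∀ c ∈ P, a * b * c ∈ S) : M * N * P ≤ S :=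
  Submodule.mul_le.2 fun m hm c hc => Submodule.mul_induction_on hm
    (fun a ha b hb => h a ha b hb c hc)
    (fun x y hx hy => by rw [add_mul]; exact add_mem hx hy)

variable (δ) in
/-- The subspace `I⁻ ⊗ H ⊗ T(V*) + T(V) ⊗ H ⊗ I⁺` of `Ã(V, δ)`. -/
def triangularForm (Im : Submodule k (TensorAlgebra k V))
    (Ip : Submodule k (TensorAlgebra k (Module.Dual k V))) : Submodule k (FreeDouble δ) :=
  Im.map (incV δ).toLinearMap * LinearMap.range (incH δ) *
      LinearMap.range (incF δ).toLinearMap ⊔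
    LinearMap.range (incV δ).toLinearMap * LinearMap.range (incH δ) *
      Ip.map (incF δ).toLinearMap

variable {Im Im' : Submodule k (TensorAlgebra k V)}
variable {Ip Ip' : Submodule k (TensorAlgebra k (Module.Dual k V))}
variable {J : Ideal (FreeDouble δ)}

theorem mul_mem_triangularForm_left {t : TensorAlgebra k V} (ht : t ∈ Im) (h : H)
    (s : TensorAlgebra k (Module.Dual k V)) :
    incV δ t * incH δ h * incF δ s ∈ triangularForm δ Im Ip :=
  Submodule.mem_sup_left (Submodule.mul_mem_mul (Submodule.mul_mem_mul
    (Submodule.mem_map_of_mem (f := (incV δ).toLinearMap) ht) (LinearMap.mem_range_self _ h))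
    (LinearMap.mem_range_self (incF δ).toLinearMap s))

theorem mul_mem_triangularForm_right (t : TensorAlgebra k V) (h : H)
    {s : TensorAlgebra k (Module.Dual k V)} (hs : s ∈ Ip) :
    incV δ t * incH δ h * incF δ s ∈ triangularForm δ Im Ip :=
  Submodule.mem_sup_right (Submodule.mul_mem_mul (Submodule.mul_mem_mul
    (LinearMap.mem_range_self (incV δ).toLinearMap t) (LinearMap.mem_range_self _ h))
    (Submodule.mem_map_of_mem (f := (incF δ).toLinearMap) hs))

theorem triangularForm_le {S : Submodule k (FreeDouble δ)}
    (hm : ∀ t ∈ Im, ∀ (h : H) (s : TensorAlgebra k (Module.Dual k V)),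
      incV δ t * incH δ h * incF δ s ∈ S)
    (hp : ∀ (t : TensorAlgebra k V) (h : H), ∀ s ∈ Ip, incV δ t * incH δ h * incF δ s ∈ S) :
    triangularForm δ Im Ip ≤ S := by
  refine sup_le (mul_mul_le ?_) (mul_mul_le ?_)
  · rintro _ ⟨t, ht, rfl⟩ _ ⟨h, rfl⟩ _ ⟨s, rfl⟩
    exact hm t ht h s
  · rintro _ ⟨t, rfl⟩ _ ⟨h, rfl⟩ _ ⟨s, hs, rfl⟩
    exact hp t h s hs

theorem triangularForm_mono (hm : Im ≤ Im') (hp : Ip ≤ Ip') :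
    triangularForm δ Im Ip ≤ triangularForm δ Im' Ip' :=
  triangularForm_le (fun _ ht h s => mul_mem_triangularForm_left (hm ht) h s)
    (fun t h _ hs => mul_mem_triangularForm_right t h (hp hs))

/-- A two-sided ideal has triangular form once it contains both halves and is contained in the
subspace they span. -/
theorem HasTriangularForm.mk_of_le (tw : J.IsTwoSided) (minus_le : Im ≤ posPart k V)
    (plus_le : Ip ≤ posPart k (Module.Dual k V)) (hm : ∀ t ∈ Im, incV δ t ∈ J)
    (hp : ∀ s ∈ Ip, incF δ s ∈ J) (hJ : J.restrictScalars k ≤ triangularForm δ Im Ip) :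
    HasTriangularForm δ J Im Ip where
  twoSided := tw
  minus_le := minus_le
  plus_le := plus_le
  eq := le_antisymm hJ (triangularForm_le (S := J.restrictScalars k)
    (fun _ ht _ _ => J.mul_mem_right _ (J.mul_mem_right _ (hm _ ht)))
    (fun _ _ _ hs => J.mul_mem_left _ (hp _ hs)))

theorem HasTriangularForm.le (hJ : HasTriangularForm δ J Im Ip) :
    J.restrictScalars k ≤ triangularForm δ Im Ip := hJ.eq.le

theorem HasTriangularForm.incV_mem (hJ : HasTriangularForm δ J Im Ip) {t : TensorAlgebra k V}
    (ht : t ∈ Im) : incV δ t ∈ J := by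
  have h : incV δ t * incH δ 1 * incF δ 1 ∈ J.restrictScalars k :=
    hJ.eq.ge (mul_mem_triangularForm_left ht 1 1)
  simpa [incH_one] using h

theorem HasTriangularForm.incF_mem (hJ : HasTriangularForm δ J Im Ip)
    {s : TensorAlgebra k (Module.Dual k V)} (hs : s ∈ Ip) : incF δ s ∈ J := by
  have h : incV δ 1 * incH δ 1 * incF δ s ∈ J.restrictScalars k :=
    hJ.eq.ge (mul_mem_triangularForm_right 1 1 hs)
  simpa [incH_one] using h

/-- The summand with `I⁻` projects into `I⁻`, and the summand with `I⁺` projects to zero because `I⁺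
⊆ T^{>0}(V*)`. The functional `g` is kept arbitrary so that elements of `T(V) H` can later be tested
coefficient by coefficient. -/
theorem HasTriangularForm.projV_mem (hJ : HasTriangularForm δ J Im Ip) (g : Module.Dual k H)
    {a : FreeDouble δ} (ha : a ∈ J) : projV hδ g a ∈ Im := by
  refine triangularForm_le (S := Im.comap (projV hδ g)) ?_ ?_ (hJ.le ha)
  · intro t ht h s
    simpa using Im.smul_mem _ ht
  · intro t h s hs
    have : TensorAlgebra.algebraMapInv s = 0 := hJ.plus_le hs
    simp [this]

theorem HasTriangularForm.projF_mem (hJ : HasTriangularForm δ J Im Ip) (g : Module.Dual k H)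
    {a : FreeDouble δ} (ha : a ∈ J) : projF hδ g a ∈ Ip := by
  refine triangularForm_le (S := Ip.comap (projF hδ g)) ?_ ?_ (hJ.le ha)
  · intro t ht h s
    have : TensorAlgebra.algebraMapInv t = 0 := hJ.minus_le ht
    simp [this]
  · intro t h s hs
    simpa using Ip.smul_mem _ hs

-- The counit sends `1` to `1`, so `projV` with `g = ε` is a retraction of `incV`, and it maps `J`
-- into `I⁻`.
include hδ in
theorem HasTriangularForm.comap_incV (hJ : HasTriangularForm δ J Im Ip) :
    (J.comap (incV δ)).restrictScalars k = Im := by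
  ext t
  refine ⟨fun ht => ?_, fun ht => hJ.incV_mem ht⟩
  rw [← projV_incV hδ t]
  exact hJ.projV_mem hδ _ ht

include hδ in
theorem HasTriangularForm.comap_incF (hJ : HasTriangularForm δ J Im Ip) :
    (J.comap (incF δ)).restrictScalars k = Ip := by
  ext s
  refine ⟨fun hs => ?_, fun hs => hJ.incF_mem hs⟩
  rw [← projF_incF hδ s]
  exact hJ.projF_mem hδ _ hs

theorem sSup_isTwoSided {R : Type*} [Ring R] {S : Set (Ideal R)}
    (hS : ∀ J ∈ S, J.IsTwoSided) : (sSup S).IsTwoSided where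
  mul_mem_of_left {a} b ha := by
    rw [sSup_eq_iSup'] at ha
    induction ha using Submodule.iSup_induction' with
    | mem J x hx => exact le_sSup J.2 ((hS J J.2).mul_mem_of_left b hx)
    | zero => simp
    | add x y _ _ hx hy => rw [add_mul]; exact add_mem hx hy

/-- The sum of all triangular ideals is triangular. -/
theorem isTriangularIdeal_sumTriangular : IsTriangularIdeal δ (sumTriangular δ) := by
  -- The halves of the sum are the sums of the halves.
  refine ⟨sSup {I | ∃ J Ip, HasTriangularForm δ J I Ip},
    sSup {I | ∃ J Im, HasTriangularForm δ J Im I}, HasTriangularForm.mk_of_le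
      (sSup_isTwoSided ?_) (sSup_le ?_) (sSup_le ?_) ?_ ?_ ?_⟩
  · rintro J ⟨Im, Ip, hJ⟩
    exact hJ.twoSided
  · rintro I ⟨J, Ip, hJ⟩
    exact hJ.minus_le
  · rintro I ⟨J, Im, hJ⟩
    exact hJ.plus_le
  · refine fun t ht => (sSup_le ?_ : _ ≤ ((sumTriangular δ).comap (incV δ)).restrictScalars k) ht
    rintro I ⟨J, Ip, hJ⟩ t ht
    exact (le_sSup ⟨I, Ip, hJ⟩ : J ≤ sumTriangular δ) (hJ.incV_mem ht)
  · refine fun t ht => (sSup_le ?_ : _ ≤ ((sumTriangular δ).comap (incF δ)).restrictScalars k) ht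
    rintro I ⟨J, Im, hJ⟩ t ht
    exact (le_sSup ⟨Im, I, hJ⟩ : J ≤ sumTriangular δ) (hJ.incF_mem ht)
  · intro a ha
    have ha' : a ∈ sSup {J | IsTriangularIdeal δ J} := ha
    rw [sSup_eq_iSup'] at ha'
    induction ha' using Submodule.iSup_induction' with
    | mem J x hx =>
      obtain ⟨J, Im, Ip, hJ⟩ := J
      exact triangularForm_mono (le_sSup (by exact ⟨J, Ip, hJ⟩))
        (le_sSup (by exact ⟨J, Im, hJ⟩)) (hJ.le hx)
    | zero => exact zero_mem _
    | add x y hx' hy' hx hy =>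
      rw [← sSup_eq_iSup'] at hx' hy'
      exact add_mem (hx hx') (hy hy')

theorem isGreatest_sumTriangular :
    IsGreatest {J | IsTriangularIdeal δ J} (sumTriangular δ) :=
  ⟨isTriangularIdeal_sumTriangular, fun _ hJ => le_sSup hJ⟩

include hδ in
theorem hasTriangularForm_sumTriangular : HasTriangularForm δ (sumTriangular δ)
    ((idealV δ).restrictScalars k) ((idealF δ).restrictScalars k) := by
  obtain ⟨Im, Ip, hJ⟩ := isTriangularIdeal_sumTriangular (δ := δ)
  have h1 := hJ.comap_incV hδ
  have h2 := hJ.comap_incF hδ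
  rw [idealV, idealF, h1, h2]
  exact hJ

end TriangularForm

section Doubles

variable {A : Type x} [Ring A] [Algebra k A] {q : FreeDouble δ →ₐ[k] A}

-- The map `π` reads off the normal form modulo the two kernels. It is onto, its composite with
-- `triangularMap` is `q`, and it vanishes on `ker q` by the triangular form; bijectivity follows.
include hδ in
theorem triangularMap_bijective (hq : IsBraidedDouble δ q) :
    Function.Bijective (triangularMap δ q) := by
  obtain ⟨hsurj, Im, Ip, hJ⟩ := hq
  set KV := LinearMap.ker (q.comp (incV δ)).toLinearMap
  set KF := LinearMap.ker (q.comp (incF δ)).toLinearMap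
  have hmap : ∀ t h s, triangularMap δ q ((KV.mkQ t ⊗ₜ h) ⊗ₜ KF.mkQ s) =
      q (incV δ t * incH δ h * incF δ s) := by
    intro t h s
    rw [map_mul, map_mul]
    rfl
  let π : FreeDouble δ →ₗ[k] ((TensorAlgebra k V ⧸ KV) ⊗[k] H) ⊗[k]
      (TensorAlgebra k (Module.Dual k V) ⧸ KF) :=
    TensorProduct.map (LinearMap.rTensor H KV.mkQ) KF.mkQ ∘ₗ
      (TensorProduct.assoc k _ H _).symm.toLinearMap ∘ₗ toNormal hδ
  have hπ : ∀ t h s, π (incV δ t * incH δ h * incF δ s) = (KV.mkQ t ⊗ₜ h) ⊗ₜ KF.mkQ s := by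
    intro t h s
    simp [π]
  have hcomp : ∀ a, triangularMap δ q (π a) = q a := by
    intro a
    induction a using normal_induction hδ with
    | add x y hx hy => simp only [map_add, hx, hy]
    | mul t h s => rw [hπ, hmap]
  have hπsurj : ∀ z, ∃ a, π a = z := by
    intro z
    induction z using TensorProduct.induction_on with
    | zero => exact ⟨0, map_zero _⟩
    | add x y hx hy =>
      obtain ⟨a, rfl⟩ := hx
      obtain ⟨b, rfl⟩ := hy
      exact ⟨a + b, map_add _ _ _⟩
    | tmul y s =>
      obtain ⟨s, rfl⟩ := KF.mkQ_surjective s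
      induction y using TensorProduct.induction_on with
      | zero => exact ⟨0, by simp⟩
      | add x y hx hy =>
        obtain ⟨a, ha⟩ := hx
        obtain ⟨b, hb⟩ := hy
        exact ⟨a + b, by rw [map_add, ha, hb, TensorProduct.add_tmul]⟩
      | tmul t h =>
        obtain ⟨t, rfl⟩ := KV.mkQ_surjective t
        exact ⟨_, hπ t h s⟩
  have hker : ∀ a, q a = 0 → π a = 0 := by
    intro a ha
    refine triangularForm_le (S := LinearMap.ker π) ?_ ?_ (hJ.le (x := a) ha)
    · intro t ht h s
      have : KV.mkQ t = 0 := (Submodule.Quotient.mk_eq_zero _).2 (hJ.incV_mem ht)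
      rw [LinearMap.mem_ker, hπ, this]
      simp
    · intro t h s hs
      have : KF.mkQ s = 0 := (Submodule.Quotient.mk_eq_zero _).2 (hJ.incF_mem hs)
      rw [LinearMap.mem_ker, hπ, this]
      simp
  refine ⟨(injective_iff_map_eq_zero _).2 fun z hz => ?_, fun b => ?_⟩
  · obtain ⟨a, rfl⟩ := hπsurj z
    exact hker a (by rw [← hcomp, hz])
  · obtain ⟨a, rfl⟩ := hsurj b
    exact ⟨π a, hcomp a⟩

theorem ker_mkₐ_comp (K : Ideal A) [K.IsTwoSided] :
    RingHom.ker ((Ideal.Quotient.mkₐ k K).comp q) = K.comap q := by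
  ext a
  simp [RingHom.mem_ker, Ideal.Quotient.eq_zero_iff_mem]

theorem map_isTwoSided (hq : Function.Surjective q) (J : Ideal (FreeDouble δ)) [J.IsTwoSided] :
    (J.map q).IsTwoSided where
  mul_mem_of_left {a} b ha := by
    obtain ⟨x, hx, rfl⟩ := (Ideal.mem_map_iff_of_surjective q hq).1 ha
    obtain ⟨y, rfl⟩ := hq b
    rw [← map_mul]
    exact Ideal.mem_map_of_mem q (J.mul_mem_right y hx)

theorem comap_map_of_ker_le (hq : Function.Surjective q) {J : Ideal (FreeDouble δ)}
    (hJ : RingHom.ker q ≤ J) : (J.map q).comap q = J := by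
  refine le_antisymm (fun a ha => ?_) Ideal.le_comap_map
  obtain ⟨b, hb, hab⟩ := (Ideal.mem_map_iff_of_surjective q hq).1 ha
  have : a - b ∈ J := hJ (by rw [RingHom.mem_ker, map_sub, hab, sub_self])
  simpa using add_mem this hb

/-- Quotient doubles of `A` correspond to triangular ideals containing `ker q`, so there is no
proper one exactly when `ker q` is already the largest. -/
theorem isMinimalDouble_iff :
    IsMinimalDouble δ q ↔ Function.Surjective q ∧ RingHom.ker q = sumTriangular δ := by
  have tw : (sumTriangular δ).IsTwoSided :=
    let ⟨_, _, h⟩ := isTriangularIdeal_sumTriangular (δ := δ)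
    h.twoSided
  constructor
  · rintro ⟨⟨hq, hJ⟩, hmin⟩
    have hle : RingHom.ker q ≤ sumTriangular δ := isGreatest_sumTriangular.2 hJ
    have tw' := map_isTwoSided hq (sumTriangular δ)
    have h := hmin ((sumTriangular δ).map q) ⟨tw', (Ideal.Quotient.mkₐ_surjective k _).comp hq, by
      rw [ker_mkₐ_comp, comap_map_of_ker_le hq hle]
      exact isTriangularIdeal_sumTriangular⟩
    refine ⟨hq, ?_⟩
    rw [← comap_map_of_ker_le hq hle, h]
    rfl
  · rintro ⟨hq, hker⟩
    refine ⟨⟨hq, by rw [hker]; exact isTriangularIdeal_sumTriangular⟩, ?_⟩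
    rintro K ⟨tw', -, hK⟩
    rw [ker_mkₐ_comp] at hK
    have hle : K.comap q ≤ RingHom.ker q := by
      rw [hker]; exact isGreatest_sumTriangular.2 hK
    rw [eq_bot_iff]
    intro b hb
    obtain ⟨a, rfl⟩ := hq b
    exact hle (x := a) hb

/-- The preimage of `K` has to be the largest triangular ideal, and this determines `K` because `q`
is onto. -/
theorem existsUnique_minimal_quotient (hq : IsBraidedDouble δ q) :
    ∃! K : Ideal A, ∃ _ : K.IsTwoSided, IsMinimalDouble δ ((Ideal.Quotient.mkₐ k K).comp q) := by
  have tw : (sumTriangular δ).IsTwoSided :=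
    let ⟨_, _, h⟩ := isTriangularIdeal_sumTriangular (δ := δ)
    h.twoSided
  obtain ⟨hsurj, hJ⟩ := hq
  have hle : RingHom.ker q ≤ sumTriangular δ := isGreatest_sumTriangular.2 hJ
  refine ⟨(sumTriangular δ).map q, ⟨map_isTwoSided hsurj _, ?_⟩, ?_⟩
  · have tw' := map_isTwoSided hsurj (sumTriangular δ)
    rw [isMinimalDouble_iff, ker_mkₐ_comp, comap_map_of_ker_le hsurj hle]
    exact ⟨(Ideal.Quotient.mkₐ_surjective k _).comp hsurj, rfl⟩
  · rintro K ⟨tw', hK⟩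
    rw [isMinimalDouble_iff, ker_mkₐ_comp] at hK
    rw [← hK.2, Ideal.map_comap_of_surjective q hsurj]

end Doubles

end TriangularIdeals

/-! ### The `ℤ`-grading of `Ã(V, δ)` and homogeneous hulls. -/

section Homogeneity

variable {k : Type u} {H : Type v} {V : Type w}
variable [Field k] [Ring H] [Bialgebra k H]
variable [AddCommGroup V] [Module k V] [Module H V] [IsScalarTower k H V]
variable (δ : V →ₗ[k] H ⊗[k] V)

section Grading

/-- The homogeneous element `a xⁿ` of `Ã(V, δ)[ℤ]`. -/
def monomial (n : ℤ) : FreeDouble δ →ₗ[k] AddMonoidAlgebra (FreeDouble δ) ℤ :=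
  AddMonoidAlgebra.lsingle n

theorem monomial_mul (m n : ℤ) (a b : FreeDouble δ) :
    monomial δ m a * monomial δ n b = monomial δ (m + n) (a * b) :=
  AddMonoidAlgebra.single_mul_single ..

theorem monomial_zero_algebraMap (c : k) :
    monomial δ 0 (algebraMap k _ c) = algebraMap k _ c := rfl

theorem coeff_monomial (m n : ℤ) (a : FreeDouble δ) :
    (monomial δ m a).coeff n = if m = n then a else 0 :=
  Finsupp.single_apply

theorem coeff_monomial_mul (m n : ℤ) (b : FreeDouble δ)
    (x : AddMonoidAlgebra (FreeDouble δ) ℤ) :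
    (monomial δ m b * x).coeff (m + n) = b * x.coeff n :=
  (AddMonoidAlgebra.coeff_single_mul_apply ..).trans (by rw [neg_add_cancel_left])

theorem coeff_mul_monomial (m n : ℤ) (b : FreeDouble δ)
    (x : AddMonoidAlgebra (FreeDouble δ) ℤ) :
    (x * monomial δ m b).coeff (n + m) = x.coeff n * b :=
  (AddMonoidAlgebra.coeff_mul_single_apply ..).trans (by rw [add_neg_cancel_right])

/-- The grading on the generators `V`. -/
def gradingV : V →ₗ[k] AddMonoidAlgebra (FreeDouble δ) ℤ :=
  monomial δ 1 ∘ₗ (incV δ).toLinearMap ∘ₗ TensorAlgebra.ι k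

/-- The grading on the generators `H`. -/
def gradingH : H →ₗ[k] AddMonoidAlgebra (FreeDouble δ) ℤ :=
  monomial δ 0 ∘ₗ incH δ

/-- The grading on the generators `V*`. -/
def gradingF : Module.Dual k V →ₗ[k] AddMonoidAlgebra (FreeDouble δ) ℤ :=
  monomial δ (-1) ∘ₗ (incF δ).toLinearMap ∘ₗ TensorAlgebra.ι k

/-- The `ℤ`-grading of `Ã(V, δ)` with `V` in degree `1`, `H` in degree `0` and `V*` in degree `-1`,
as a coaction `Ã(V, δ) → Ã(V, δ)[ℤ]`. -/
def grading : FreeDouble δ →ₐ[k] AddMonoidAlgebra (FreeDouble δ) ℤ :=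
  freeDoubleLift δ (A := AddMonoidAlgebra (FreeDouble δ) ℤ)
    (gradingV δ) (gradingH δ) (gradingF δ)
    (by
      rw [gradingH, LinearMap.comp_apply, incH_one, ← map_one (algebraMap k _),
        monomial_zero_algebraMap,
        map_one])
    (fun x y => by simp [gradingH, incH_mul, monomial_mul])
    -- The defining relations are homogeneous: each is transported into `Ã[ℤ]` by the monomial of
    -- its degree.
    (fun h v => by
      have r := Coalgebra.Repr.arbitrary k h
      have e := congrArg (monomial δ (1 : ℤ)) (incH_mul_incV_ι δ h v)
      rw [sweedler_eq_sum _ r, map_sum] at e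
      rw [sweedler_eq_sum _ r]
      simpa [gradingV, gradingH, gradingF, monomial_mul] using e)
    (fun f h => by
      have r := Coalgebra.Repr.arbitrary k h
      have e := congrArg (monomial δ (-1 : ℤ)) (incF_ι_mul_incH δ f h)
      rw [sweedler_eq_sum _ r, map_sum] at e
      rw [sweedler_eq_sum _ r]
      simpa [gradingV, gradingH, gradingF, monomial_mul] using e)
    (fun f v => by
      have e := congrArg (monomial δ (0 : ℤ)) (incF_ι_mul_incV_ι δ f v)
      rw [map_add] at e
      simpa [gradingV, gradingH, gradingF, monomial_mul] using e)

theorem grading_incV_ι (v : V) : grading δ (incV δ (TensorAlgebra.ι k v)) =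
    monomial δ 1 (incV δ (TensorAlgebra.ι k v)) :=
  freeDoubleLift_incV_ι ..

theorem grading_incH (h : H) : grading δ (incH δ h) = monomial δ 0 (incH δ h) :=
  freeDoubleLift_incH ..

theorem grading_incF_ι (f : Module.Dual k V) : grading δ (incF δ (TensorAlgebra.ι k f)) =
    monomial δ (-1) (incF δ (TensorAlgebra.ι k f)) :=
  freeDoubleLift_incF_ι ..

/-- The homogeneous component of degree `n`. -/
def component (n : ℤ) : FreeDouble δ →ₗ[k] FreeDouble δ where
  toFun a := (grading δ a).coeff n
  map_add' a b := by simp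
  map_smul' c a := by simp

theorem component_apply (n : ℤ) (a : FreeDouble δ) :
    component δ n a = (grading δ a).coeff n := rfl

variable {δ}

theorem component_mul_left {b : FreeDouble δ} {m : ℤ}
    (hb : grading δ b = monomial δ m b) (n : ℤ) (a : FreeDouble δ) :
    component δ (m + n) (b * a) = b * component δ n a := by
  simp [component_apply, hb, coeff_monomial_mul]

theorem component_mul_right {b : FreeDouble δ} {m : ℤ}
    (hb : grading δ b = monomial δ m b) (n : ℤ) (a : FreeDouble δ) :
    component δ (n + m) (a * b) = component δ n a * b := by
  simp [component_apply, hb, coeff_mul_monomial]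

theorem grading_incV {n : ℕ} {t : TensorAlgebra k V}
    (ht : t ∈ LinearMap.range (TensorAlgebra.ι k : V →ₗ[k] TensorAlgebra k V) ^ n) :
    grading δ (incV δ t) = monomial δ (n : ℤ) (incV δ t) := by
  induction ht using Submodule.pow_induction_on_left' with
  | algebraMap r =>
    rw [AlgHom.commutes, AlgHom.commutes]
    simp [monomial_zero_algebraMap]
  | add x y i hx hy ihx ihy => simp [ihx, ihy]
  | mem_mul m hm i x hx ih =>
    obtain ⟨v, rfl⟩ := hm
    rw [map_mul, map_mul, ih, grading_incV_ι, monomial_mul]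
    push_cast
    rw [add_comm]

theorem grading_incF {n : ℕ} {s : TensorAlgebra k (Module.Dual k V)}
    (hs : s ∈ LinearMap.range
      (TensorAlgebra.ι k : Module.Dual k V →ₗ[k] TensorAlgebra k (Module.Dual k V)) ^ n) :
    grading δ (incF δ s) = monomial δ (-n : ℤ) (incF δ s) := by
  induction hs using Submodule.pow_induction_on_left' with
  | algebraMap r =>
    rw [AlgHom.commutes, AlgHom.commutes]
    simp [monomial_zero_algebraMap]
  | add x y i hx hy ihx ihy => simp [ihx, ihy]
  | mem_mul m hm i x hx ih =>
    obtain ⟨v, rfl⟩ := hm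
    rw [map_mul, map_mul, ih, grading_incF_ι, monomial_mul]
    push_cast
    rw [neg_add_rev]

end Grading

section TensorParts

variable {M : Type x} [AddCommGroup M] [Module k M]

/-- The component of degree `n` of an element of the tensor algebra. -/
def tensorPart (n : ℕ) (t : TensorAlgebra k M) : TensorAlgebra k M :=
  (DirectSum.decompose
    (fun n : ℕ => LinearMap.range (TensorAlgebra.ι k : M →ₗ[k] TensorAlgebra k M) ^ n) t n :
    TensorAlgebra k M)

theorem tensorPart_mem (n : ℕ) (t : TensorAlgebra k M) : tensorPart n t ∈
    LinearMap.range (TensorAlgebra.ι k : M →ₗ[k] TensorAlgebra k M) ^ n :=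
  SetLike.coe_mem _

theorem exists_sum_tensorPart (t : TensorAlgebra k M) :
    ∃ S : Finset ℕ, t = ∑ n ∈ S, tensorPart n t := by
  classical
  exact ⟨_, (DirectSum.sum_support_decompose
    (fun n : ℕ => LinearMap.range (TensorAlgebra.ι k : M →ₗ[k] TensorAlgebra k M) ^ n) t).symm⟩

theorem tensorPart_of_mem {n : ℕ} {t : TensorAlgebra k M} (ht : t ∈
    LinearMap.range (TensorAlgebra.ι k : M →ₗ[k] TensorAlgebra k M) ^ n) (m : ℕ) :
    tensorPart m t = if n = m then t else 0 := by
  split_ifs with h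
  · subst h
    exact DirectSum.decompose_of_mem_same _ ht
  · exact DirectSum.decompose_of_mem_ne _ ht h

theorem mem_posPart_of_mem {n : ℕ} (hn : 1 ≤ n) {t : TensorAlgebra k M} (ht : t ∈
    LinearMap.range (TensorAlgebra.ι k : M →ₗ[k] TensorAlgebra k M) ^ n) : t ∈ posPart k M := by
  obtain ⟨n, rfl⟩ := Nat.exists_eq_add_of_le' hn
  rw [pow_succ'] at ht
  induction ht using Submodule.mul_induction_on' with
  | mem_mul_mem x hx y hy =>
    obtain ⟨m, rfl⟩ := hx
    simp [posPart, TensorAlgebra.algebraMapInv]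
  | add x _ y _ hx hy => exact add_mem hx hy

/-- The remainder `t - tensorPart 0 t` is a sum of components of positive degree, and the
augmentation kills those. -/
theorem algebraMapInv_tensorPart_zero (t : TensorAlgebra k M) :
    tensorPart 0 t = algebraMap k _ (TensorAlgebra.algebraMapInv t) := by
  have h0 := tensorPart_mem 0 t
  rw [pow_zero, Submodule.mem_one] at h0
  obtain ⟨c, hc⟩ := h0
  have hsub : t - tensorPart 0 t ∈ posPart k M := by
    obtain ⟨S, hS⟩ := exists_sum_tensorPart t
    -- Being additive, `d` can be evaluated on one homogeneous component at a time.
    let d : TensorAlgebra k M →+ TensorAlgebra k M :=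
      { toFun := fun u => u - tensorPart 0 u
        map_zero' := by simp [tensorPart]
        map_add' := fun a b => by simp [tensorPart, DirectSum.decompose_add]; abel }
    change d t ∈ _
    rw [hS, map_sum]
    refine sum_mem fun n _ => ?_
    change tensorPart n t - tensorPart 0 (tensorPart n t) ∈ _
    rw [tensorPart_of_mem (tensorPart_mem n t)]
    split_ifs with h
    · simp
    · rw [sub_zero]
      exact mem_posPart_of_mem (Nat.one_le_iff_ne_zero.2 h) (tensorPart_mem n t)
  have h2 : TensorAlgebra.algebraMapInv (t - tensorPart 0 t) = 0 := hsub
  rw [map_sub, sub_eq_zero] at h2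
  rw [h2, ← hc, TensorAlgebra.algebraMap_leftInverse]

theorem tensorPart_mem_posPart {t : TensorAlgebra k M} (ht : t ∈ posPart k M) (n : ℕ) :
    tensorPart n t ∈ posPart k M := by
  rcases Nat.eq_zero_or_pos n with rfl | hn
  · have : TensorAlgebra.algebraMapInv t = 0 := ht
    rw [algebraMapInv_tensorPart_zero, this, map_zero]
    exact zero_mem _
  · exact mem_posPart_of_mem hn (tensorPart_mem n t)

end TensorParts

section Hull

variable {δ}

theorem component_incV (t : TensorAlgebra k V) (n : ℕ) :
    component δ n (incV δ t) = incV δ (tensorPart n t) := by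
  obtain ⟨S, hS⟩ := exists_sum_tensorPart t
  let d : TensorAlgebra k V →+ FreeDouble δ :=
    { toFun := fun u => component δ n (incV δ u) - incV δ (tensorPart n u)
      map_zero' := by simp [tensorPart]
      map_add' := fun a b => by simp [tensorPart, DirectSum.decompose_add]; abel }
  rw [← sub_eq_zero]
  change d t = 0
  rw [hS, map_sum]
  refine Finset.sum_eq_zero fun m _ => ?_
  change component δ n (incV δ (tensorPart m t)) - incV δ (tensorPart n (tensorPart m t)) = 0
  rw [tensorPart_of_mem (tensorPart_mem m t), component_apply, grading_incV (tensorPart_mem m t)]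
  by_cases h : m = n <;> simp [h, coeff_monomial]

theorem component_incF (t : TensorAlgebra k (Module.Dual k V)) (n : ℕ) :
    component δ (-n) (incF δ t) = incF δ (tensorPart n t) := by
  obtain ⟨S, hS⟩ := exists_sum_tensorPart t
  let d : TensorAlgebra k (Module.Dual k V) →+ FreeDouble δ :=
    { toFun := fun u => component δ (-n) (incF δ u) - incF δ (tensorPart n u)
      map_zero' := by simp [tensorPart]
      map_add' := fun a b => by simp [tensorPart, DirectSum.decompose_add]; abel }
  rw [← sub_eq_zero]
  change d t = 0
  rw [hS, map_sum]
  refine Finset.sum_eq_zero fun m _ => ?_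
  change component δ (-n) (incF δ (tensorPart m t)) - incF δ (tensorPart n (tensorPart m t)) = 0
  rw [tensorPart_of_mem (tensorPart_mem m t), component_apply, grading_incF (tensorPart_mem m t)]
  by_cases h : m = n <;> simp [h, coeff_monomial]

variable (J : Ideal (FreeDouble δ))

/-- The span of the homogeneous components of the elements of `J`. -/
def hullSubmodule : Submodule k (FreeDouble δ) :=
  Submodule.span k {x | ∃ n, ∃ a ∈ J, component δ n a = x}

variable {J}

theorem component_mem_hull {a : FreeDouble δ} (ha : a ∈ J) (n : ℤ) :
    component δ n a ∈ hullSubmodule J :=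
  Submodule.subset_span ⟨n, a, ha, rfl⟩

/-- A homogeneous factor of degree `m` shifts components, `b aₙ = (b a)ₘ₊ₙ`, and `b a` is again in
`J`. -/
theorem mul_mem_hull_of_grading {b : FreeDouble δ} {m : ℤ}
    (hb : grading δ b = monomial δ m b) :
    ∀ x ∈ hullSubmodule J, b * x ∈ hullSubmodule J := by
  intro x hx
  induction hx using Submodule.span_induction with
  | mem x hx =>
    obtain ⟨n, a, ha, rfl⟩ := hx
    rw [← component_mul_left hb]
    exact component_mem_hull (J.mul_mem_left b ha) _
  | zero => simp
  | add x y _ _ hx hy => rw [mul_add]; exact add_mem hx hy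
  | smul c x _ hx => rw [mul_smul_comm]; exact Submodule.smul_mem _ c hx

theorem mem_hull_mul_of_grading [J.IsTwoSided] {b : FreeDouble δ} {m : ℤ}
    (hb : grading δ b = monomial δ m b) :
    ∀ x ∈ hullSubmodule J, x * b ∈ hullSubmodule J := by
  intro x hx
  induction hx using Submodule.span_induction with
  | mem x hx =>
    obtain ⟨n, a, ha, rfl⟩ := hx
    rw [← component_mul_right hb]
    exact component_mem_hull (J.mul_mem_right b ha) _
  | zero => simp
  | add x y _ _ hx hy => rw [add_mul]; exact add_mem hx hy
  | smul c x _ hx => rw [smul_mul_assoc]; exact Submodule.smul_mem _ c hx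

theorem mul_mem_hull (b : FreeDouble δ) :
    ∀ x ∈ hullSubmodule J, b * x ∈ hullSubmodule J := by
  induction b using freeDouble_induction with
  | add a b ha hb => exact fun x hx => by rw [add_mul]; exact add_mem (ha x hx) (hb x hx)
  | scalar c =>
    exact fun x hx => by rw [← Algebra.smul_def]; exact Submodule.smul_mem _ c hx
  | mul a b ha hb => exact fun x hx => by rw [mul_assoc]; exact ha _ (hb x hx)
  | hV v => exact mul_mem_hull_of_grading (grading_incV_ι δ v)
  | hH h => exact mul_mem_hull_of_grading (grading_incH δ h)
  | hF f => exact mul_mem_hull_of_grading (grading_incF_ι δ f)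

theorem mem_hull_mul [J.IsTwoSided] (b : FreeDouble δ) :
    ∀ x ∈ hullSubmodule J, x * b ∈ hullSubmodule J := by
  induction b using freeDouble_induction with
  | add a b ha hb => exact fun x hx => by rw [mul_add]; exact add_mem (ha x hx) (hb x hx)
  | scalar c =>
    exact fun x hx => by
      rw [← Algebra.commutes, ← Algebra.smul_def]; exact Submodule.smul_mem _ c hx
  | mul a b ha hb => exact fun x hx => by rw [← mul_assoc]; exact hb _ (ha x hx)
  | hV v => exact mem_hull_mul_of_grading (grading_incV_ι δ v)
  | hH h => exact mem_hull_mul_of_grading (grading_incH δ h)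
  | hF f => exact mem_hull_mul_of_grading (grading_incF_ι δ f)

variable (J) in
/-- The homogeneous hull of an ideal. -/
def hull : Ideal (FreeDouble δ) where
  toAddSubmonoid := (hullSubmodule J).toAddSubmonoid
  smul_mem' b x hx := mul_mem_hull b x hx

theorem hull_isTwoSided [J.IsTwoSided] : (hull J).IsTwoSided where
  mul_mem_of_left b hx := mem_hull_mul b _ hx

theorem component_mul_mem (n : ℤ) {S : Submodule k (FreeDouble δ)} (t : TensorAlgebra k V) (h : H)
    (s : TensorAlgebra k (Module.Dual k V))
    (hS : ∀ i j, incV δ (tensorPart i t) * incH δ h * incF δ (tensorPart j s) ∈ S) :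
    component δ n (incV δ t * incH δ h * incF δ s) ∈ S := by
  obtain ⟨A, hA⟩ := exists_sum_tensorPart t
  obtain ⟨B, hB⟩ := exists_sum_tensorPart s
  have e : incV δ t * incH δ h * incF δ s = ∑ i ∈ A, ∑ j ∈ B,
      incV δ (tensorPart i t) * incH δ h * incF δ (tensorPart j s) := by
    conv_lhs => rw [hA, hB]
    simp only [map_sum, Finset.sum_mul, Finset.mul_sum]
    exact Finset.sum_comm
  rw [e, map_sum]
  refine sum_mem fun i _ => ?_
  rw [map_sum]
  refine sum_mem fun j _ => ?_
  rw [component_apply, map_mul, map_mul, grading_incV (tensorPart_mem i t), grading_incH,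
    grading_incF (tensorPart_mem j s), monomial_mul,
    monomial_mul, coeff_monomial]
  split_ifs
  · exact hS i j
  · exact zero_mem _

/-- The homogeneous hull of a triangular ideal is triangular. -/
theorem IsTriangularIdeal.hull (hJ : IsTriangularIdeal δ J) : IsTriangularIdeal δ (hull J) := by
  obtain ⟨Im, Ip, hJ⟩ := hJ
  have tw := hJ.twoSided
  -- The halves are the preimages of the hull, cut down to positive degree as the triangular form
  -- demands; they still contain the components of `I⁻` and `I⁺`.
  refine ⟨((BraidedDouble.hull J).comap (incV δ)).restrictScalars k ⊓ posPart k V,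
    ((BraidedDouble.hull J).comap (incF δ)).restrictScalars k ⊓ posPart k (Module.Dual k V),
    HasTriangularForm.mk_of_le hull_isTwoSided inf_le_right inf_le_right (fun t ht => ht.1)
      (fun s hs => hs.1) ?_⟩
  refine Submodule.span_le.2 ?_
  rintro _ ⟨n, a, ha, rfl⟩
  refine triangularForm_le (S := (triangularForm δ _ _).comap (component δ n)) ?_ ?_ (hJ.le ha)
  · refine fun t ht h s => component_mul_mem n t h s fun i j => mul_mem_triangularForm_left ?_ h _
    refine ⟨?_, tensorPart_mem_posPart (hJ.minus_le ht) i⟩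
    change incV δ (tensorPart i t) ∈ BraidedDouble.hull J
    rw [← component_incV]
    exact component_mem_hull (hJ.incV_mem ht) i
  · refine fun t h s hs => component_mul_mem n t h s fun i j => mul_mem_triangularForm_right _ h ?_
    refine ⟨?_, tensorPart_mem_posPart (hJ.plus_le hs) j⟩
    change incF δ (tensorPart j s) ∈ BraidedDouble.hull J
    rw [← component_incF]
    exact component_mem_hull (hJ.incF_mem hs) _

/-- The hull of the largest triangular ideal is triangular, hence contained in it. -/
theorem component_mem_sumTriangular {a : FreeDouble δ} (ha : a ∈ sumTriangular δ) (n : ℤ) :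
    component δ n a ∈ sumTriangular δ :=
  isGreatest_sumTriangular.2 (isTriangularIdeal_sumTriangular (δ := δ)).hull
    (component_mem_hull ha n : _ ∈ hull (sumTriangular δ))

variable (δ) in
theorem idealV_isHomogeneous : (idealV δ).IsHomogeneous
    (fun n : ℕ => LinearMap.range (TensorAlgebra.ι k : V →ₗ[k] TensorAlgebra k V) ^ n) := by
  intro n t ht
  change incV δ (tensorPart n t) ∈ sumTriangular δ
  rw [← component_incV]
  exact component_mem_sumTriangular ht n

variable (δ) in
theorem idealF_isHomogeneous : (idealF δ).IsHomogeneous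
    (fun n : ℕ => LinearMap.range
      (TensorAlgebra.ι k : Module.Dual k V →ₗ[k] TensorAlgebra k (Module.Dual k V)) ^ n) := by
  intro n s hs
  change incF δ (tensorPart n s) ∈ sumTriangular δ
  rw [← component_incF]
  exact component_mem_sumTriangular hs _

end Hull

end Homogeneity

/-! ### Tensor powers in `Ã(V, δ)` and commutators as quasibraided integers. -/

section CommutatorFormulas

section TensorPowers

variable {k : Type u} {M : Type x} [Field k] [AddCommGroup M] [Module k M]

theorem toTensorAlgebra_consEquiv (n : ℕ) (m : M) (t : ⨂[k]^n M) :
    TensorPower.toTensorAlgebra (consEquiv k M n (m ⊗ₜ t)) =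
      TensorAlgebra.ι k m * TensorPower.toTensorAlgebra t := by
  induction t using PiTensorProduct.induction_on with
  | smul_tprod c a =>
    rw [TensorProduct.tmul_smul, map_smul, map_smul, map_smul, consEquiv_tprod, mul_smul_comm]
    simp [TensorAlgebra.tprod_apply, List.ofFn_succ]
  | add x y hx hy => rw [TensorProduct.tmul_add, map_add, map_add, map_add, hx, hy, mul_add]

theorem toTensorAlgebra_snocEquiv (n : ℕ) (m : M) (t : ⨂[k]^n M) :
    TensorPower.toTensorAlgebra (snocEquiv k M n (t ⊗ₜ m)) =
      TensorPower.toTensorAlgebra t * TensorAlgebra.ι k m := by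
  induction t using PiTensorProduct.induction_on with
  | smul_tprod c a =>
    rw [← TensorProduct.smul_tmul', map_smul, map_smul, map_smul, snocEquiv_tprod, smul_mul_assoc]
    rw [TensorPower.toTensorAlgebra_tprod, TensorPower.toTensorAlgebra_tprod,
      TensorAlgebra.tprod_apply, TensorAlgebra.tprod_apply, List.ofFn_succ', List.concat_eq_append,
      List.prod_append]
    simp
  | add x y hx hy => rw [TensorProduct.add_tmul, map_add, map_add, map_add, hx, hy, add_mul]

theorem exists_toTensorAlgebra_zero (t : ⨂[k]^0 M) :
    ∃ c : k, t = c • PiTensorProduct.tprod k (fun i : Fin 0 => i.elim0) ∧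
      TensorPower.toTensorAlgebra t = algebraMap k (TensorAlgebra k M) c := by
  have h : ∃ c : k, t = c • PiTensorProduct.tprod k (fun i : Fin 0 => i.elim0) := by
    induction t using PiTensorProduct.induction_on with
    | smul_tprod c a => exact ⟨c, by rw [Subsingleton.elim a (fun i : Fin 0 => i.elim0)]⟩
    | add x y hx hy =>
      obtain ⟨a, rfl⟩ := hx
      obtain ⟨b, rfl⟩ := hy
      exact ⟨a + b, by rw [add_smul]⟩
  obtain ⟨c, hc⟩ := h
  refine ⟨c, hc, ?_⟩
  rw [hc, map_smul, TensorPower.toTensorAlgebra_tprod, TensorAlgebra.tprod_apply, List.ofFn_zero,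
    List.prod_nil, Algebra.algebraMap_eq_smul_one]

theorem consEquiv_induction {n : ℕ} {p : (⨂[k]^(n + 1) M) → Prop}
    (add : ∀ x y, p x → p y → p (x + y)) (cons : ∀ m t, p (consEquiv k M n (m ⊗ₜ t)))
    (u : ⨂[k]^(n + 1) M) : p u := by
  obtain ⟨z, rfl⟩ := (consEquiv k M n).surjective u
  induction z using TensorProduct.induction_on with
  | zero => simpa using cons 0 0
  | add x y hx hy => rw [map_add]; exact add _ _ hx hy
  | tmul m t => exact cons m t

theorem snocEquiv_induction {n : ℕ} {p : (⨂[k]^(n + 1) M) → Prop}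
    (add : ∀ x y, p x → p y → p (x + y)) (snoc : ∀ t m, p (snocEquiv k M n (t ⊗ₜ m)))
    (u : ⨂[k]^(n + 1) M) : p u := by
  obtain ⟨z, rfl⟩ := (snocEquiv k M n).surjective u
  induction z using TensorProduct.induction_on with
  | zero => simpa using snoc 0 0
  | add x y hx hy => rw [map_add]; exact add _ _ hx hy
  | tmul t m => exact snoc t m

theorem toTensorAlgebra_mem (n : ℕ) (u : ⨂[k]^n M) : TensorPower.toTensorAlgebra u ∈
    LinearMap.range (TensorAlgebra.ι k : M →ₗ[k] TensorAlgebra k M) ^ n := by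
  induction n with
  | zero =>
    obtain ⟨c, -, hc⟩ := exists_toTensorAlgebra_zero u
    rw [hc, pow_zero]
    exact Submodule.mem_one.2 ⟨c, rfl⟩
  | succ n ih =>
    induction u using consEquiv_induction with
    | add x y hx hy => rw [map_add]; exact add_mem hx hy
    | cons m t =>
      rw [toTensorAlgebra_consEquiv, pow_succ']
      exact Submodule.mul_mem_mul (LinearMap.mem_range_self _ m) (ih t)

theorem exists_toTensorAlgebra_eq {n : ℕ} {t : TensorAlgebra k M}
    (ht : t ∈ LinearMap.range (TensorAlgebra.ι k : M →ₗ[k] TensorAlgebra k M) ^ n) :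
    ∃ u : ⨂[k]^n M, TensorPower.toTensorAlgebra u = t := by
  induction ht using Submodule.pow_induction_on_left' with
  | algebraMap c =>
    refine ⟨c • PiTensorProduct.tprod k (fun i : Fin 0 => i.elim0), ?_⟩
    rw [map_smul, TensorPower.toTensorAlgebra_tprod, TensorAlgebra.tprod_apply, List.ofFn_zero,
      List.prod_nil, Algebra.algebraMap_eq_smul_one]
  | add x y i hx hy ihx ihy =>
    obtain ⟨u, rfl⟩ := ihx
    obtain ⟨u', rfl⟩ := ihy
    exact ⟨u + u', map_add _ _ _⟩
  | mem_mul m hm i x hx ih =>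
    obtain ⟨v, rfl⟩ := hm
    obtain ⟨u, rfl⟩ := ih
    exact ⟨consEquiv k M i (v ⊗ₜ u), toTensorAlgebra_consEquiv i v u⟩

end TensorPowers

variable {k : Type u} {H : Type v} {V : Type w}
variable [Field k] [Ring H] [Bialgebra k H]

theorem powAct_consEquiv {M : Type w} [AddCommGroup M] [Module k M] (act : H →ₗ[k] M →ₗ[k] M)
    (n : ℕ) {ι : Type*} {h : H} (r : Coalgebra.Repr k h ι) (m : M) (t : ⨂[k]^n M) :
    powAct act (n + 1) h (consEquiv k M n (m ⊗ₜ t)) =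
      ∑ i ∈ r.index, consEquiv k M n (act (r.left i) m ⊗ₜ powAct act n (r.right i) t) := by
  simp [powAct, ← r.eq, LinearEquiv.conj_apply]

theorem sum_smul_counit {ι : Type*} {h : H} (r : Coalgebra.Repr k h ι) :
    ∑ i ∈ r.index, Coalgebra.counit (R := k) (r.right i) • r.left i = h := by
  have e := congrArg (TensorProduct.rid k H) (Coalgebra.sum_tmul_counit_eq r)
  rw [map_sum] at e
  simpa using e

theorem powAct_zero_apply {M : Type w} [AddCommGroup M] [Module k M] (act : H →ₗ[k] M →ₗ[k] M)
    (h : H) (t : ⨂[k]^0 M) : powAct act 0 h t = Coalgebra.counit (R := k) h • t := rfl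

variable [AddCommGroup V] [Module k V] [Module H V] [IsScalarTower k H V]
variable (δ : V →ₗ[k] H ⊗[k] V)

/-- `h t = (h₍₁₎ ▷ t) h₍₂₎` for `t ∈ V^{⊗n}`. -/
theorem incH_mul_incV (n : ℕ) {ι : Type v} {h : H} (r : Coalgebra.Repr k h ι) (u : ⨂[k]^n V) :
    incH δ h * incV δ (TensorPower.toTensorAlgebra u) =
      ∑ i ∈ r.index, incV δ (TensorPower.toTensorAlgebra (powAct (lact k H V) n (r.left i) u)) *
        incH δ (r.right i) := by
  induction n generalizing ι h with
  | zero =>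
    simp only [powAct_zero_apply, map_smul, smul_mul_assoc, ← mul_smul_comm, ← Finset.mul_sum]
    simp only [← map_smul, ← map_sum, Coalgebra.sum_counit_smul r]
    obtain ⟨c, -, hc⟩ := exists_toTensorAlgebra_zero u
    rw [hc, AlgHom.commutes, Algebra.commutes]
  | succ n ih =>
    induction u using consEquiv_induction with
    | add x y hx hy => simp only [map_add, mul_add, add_mul, hx, hy, Finset.sum_add_distrib]
    | cons v t =>
      -- `φ(a, b, c) = (a ▷ v) (b ▷ t) c`.
      let φ : H →ₗ[k] H →ₗ[k] H →ₗ[k] FreeDouble δ :=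
        LinearMap.mk₂ k (fun a b => LinearMap.mulLeft k (incV δ (TensorAlgebra.ι k (a • v)) *
            incV δ (TensorPower.toTensorAlgebra (powAct (lact k H V) n b t))) ∘ₗ incH δ)
          (fun a a' b => LinearMap.ext fun _ => by simp [add_smul, add_mul, mul_assoc])
          (fun c a b => LinearMap.ext fun _ => by simp [mul_assoc])
          (fun a b b' => LinearMap.ext fun _ => by simp [add_mul, mul_add, mul_assoc])
          (fun c a b => LinearMap.ext fun _ => by simp [mul_assoc])
      have e := sum_coassoc φ r (fun i => Coalgebra.Repr.arbitrary k _)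
        (fun i => Coalgebra.Repr.arbitrary k _)
      simp only [φ, LinearMap.mk₂_apply, LinearMap.comp_apply, LinearMap.mulLeft_apply] at e
      rw [toTensorAlgebra_consEquiv, map_mul, ← mul_assoc, incH_mul_incV_ι,
        sweedler_eq_sum _ r, Finset.sum_mul]
      simp only [LinearMap.compl₁₂_apply, LinearMap.comp_apply, LinearMap.flip_apply, lact_apply,
        AlgHom.toLinearMap_apply, LinearMap.mul_apply', mul_assoc,
        ih (Coalgebra.Repr.arbitrary k _), Finset.mul_sum,
        powAct_consEquiv _ n (Coalgebra.Repr.arbitrary k _), map_sum, toTensorAlgebra_consEquiv,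
        map_mul, Finset.sum_mul] at e ⊢
      exact e.symm

/-- `s h = h₍₁₎ (s ◁ h₍₂₎)` for `s ∈ V*^{⊗n}`. -/
theorem incF_mul_incH (n : ℕ) {ι : Type v} {h : H} (r : Coalgebra.Repr k h ι)
    (u : ⨂[k]^n (Module.Dual k V)) :
    incF δ (TensorPower.toTensorAlgebra u) * incH δ h =
      ∑ i ∈ r.index, incH δ (r.left i) *
        incF δ (TensorPower.toTensorAlgebra (powAct (ract k H V) n (r.right i) u)) := by
  induction n generalizing ι h with
  | zero =>
    simp only [powAct_zero_apply, map_smul, mul_smul_comm, ← smul_mul_assoc, ← Finset.sum_mul]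
    simp only [← map_smul, ← map_sum, sum_smul_counit r]
    obtain ⟨c, -, hc⟩ := exists_toTensorAlgebra_zero u
    rw [hc, AlgHom.commutes, Algebra.commutes]
  | succ n ih =>
    induction u using consEquiv_induction with
    | add x y hx hy => simp only [map_add, mul_add, add_mul, hx, hy, Finset.sum_add_distrib]
    | cons f t =>
      -- `φ(a, b, c) = a (f ◁ b) (t ◁ c)`.
      let φ : H →ₗ[k] H →ₗ[k] H →ₗ[k] FreeDouble δ :=
        LinearMap.mk₂ k (fun a b => LinearMap.mulLeft k (incH δ a *
            incF δ (TensorAlgebra.ι k (ract k H V b f))) ∘ₗ (incF δ).toLinearMap ∘ₗ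
            TensorPower.toTensorAlgebra ∘ₗ (powAct (ract k H V) n).flip t)
          (fun a a' b => LinearMap.ext fun _ => by simp [add_mul, mul_assoc])
          (fun c a b => LinearMap.ext fun _ => by simp [mul_assoc])
          (fun a b b' => LinearMap.ext fun _ => by simp [add_mul, mul_add, mul_assoc])
          (fun c a b => LinearMap.ext fun _ => by simp [mul_assoc])
      have e := sum_coassoc φ r (fun i => Coalgebra.Repr.arbitrary k _)
        (fun i => Coalgebra.Repr.arbitrary k _)
      simp only [φ, LinearMap.mk₂_apply, LinearMap.comp_apply, LinearMap.mulLeft_apply] at e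
      rw [toTensorAlgebra_consEquiv, map_mul, mul_assoc, ih r, Finset.mul_sum]
      simp only [← mul_assoc, incF_ι_mul_incH, sweedler_eq_sum _ (Coalgebra.Repr.arbitrary k _)]
      simp only [LinearMap.compl₁₂_apply, LinearMap.comp_apply, LinearMap.flip_apply,
        AlgHom.toLinearMap_apply, LinearMap.mul_apply', mul_assoc, Finset.mul_sum,
        powAct_consEquiv _ n (Coalgebra.Repr.arbitrary k _), map_sum, toTensorAlgebra_consEquiv,
        map_mul, Finset.sum_mul] at e ⊢
      exact e

section Commutators

/-- `t ⊗ (h ⊗ v) ↦ ⟨f, v⟩ t h`. -/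
def contractV (n : ℕ) (f : Module.Dual k V) : (⨂[k]^n V) ⊗[k] (H ⊗[k] V) →ₗ[k] FreeDouble δ :=
  LinearMap.mul' k _ ∘ₗ TensorProduct.map ((incV δ).toLinearMap ∘ₗ TensorPower.toTensorAlgebra)
    (incH δ ∘ₗ (TensorProduct.rid k H).toLinearMap ∘ₗ LinearMap.lTensor H f)

theorem contractV_tmul (n : ℕ) (f : Module.Dual k V) (t : ⨂[k]^n V) (h : H) (v : V) :
    contractV δ n f (t ⊗ₜ (h ⊗ₜ v)) =
      f v • (incV δ (TensorPower.toTensorAlgebra t) * incH δ h) := by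
  simp [contractV]

/-- The commutator of `f` with the first letter leaves `β(f, v)` to the left of `t`; moving it to
the right by `incH_mul_incV` produces the coproduct in `headTerm`. -/
theorem contractV_headTerm (n : ℕ) (f : Module.Dual k V) (v : V) (t : ⨂[k]^n V) :
    contractV δ n f (headTerm δ n (v ⊗ₜ t)) =
      incH δ (pairing δ f v) * incV δ (TensorPower.toTensorAlgebra t) := by
  simp only [headTerm, pairing, LinearMap.comp_apply, LinearMap.rTensor_tmul,
    LinearEquiv.coe_coe]
  induction δ v using TensorProduct.induction_on with
  | zero => simp
  | add x y hx hy => simp only [map_add, TensorProduct.add_tmul, add_mul, hx, hy]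
  | tmul h w =>
    have r := Coalgebra.Repr.arbitrary k h
    rw [LinearMap.rTensor_tmul, ← r.eq, LinearMap.lTensor_tmul, TensorProduct.rid_tmul, map_smul,
      smul_mul_assoc, incH_mul_incV δ n r]
    simp [TensorProduct.sum_tmul, contractV_tmul, Finset.smul_sum]

theorem contractV_consEquiv (n : ℕ) (f : Module.Dual k V) (v : V)
    (z : (⨂[k]^n V) ⊗[k] (H ⊗[k] V)) :
    contractV δ (n + 1) f (LinearMap.rTensor (H ⊗[k] V) (consEquiv k V n).toLinearMap
      ((TensorProduct.assoc k V (⨂[k]^n V) (H ⊗[k] V)).symm (v ⊗ₜ z))) =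
      incV δ (TensorAlgebra.ι k v) * contractV δ n f z := by
  induction z using TensorProduct.induction_on with
  | zero => simp
  | add x y hx hy => simp only [map_add, TensorProduct.tmul_add, mul_add, hx, hy]
  | tmul t y =>
    simp [contractV, toTensorAlgebra_consEquiv, mul_assoc]

/-- The commutator of `f ∈ V*` with `V^{⊗(n+1)}` is given by the quasibraided integer. -/
theorem incF_ι_mul_incV (n : ℕ) (f : Module.Dual k V) (u : ⨂[k]^(n + 1) V) :
    incF δ (TensorAlgebra.ι k f) * incV δ (TensorPower.toTensorAlgebra u) =
      incV δ (TensorPower.toTensorAlgebra u) * incF δ (TensorAlgebra.ι k f) +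
        contractV δ n f (quasiInt δ n u) := by
  induction n with
  | zero =>
    induction u using consEquiv_induction with
    | add x y hx hy => simp only [map_add, mul_add, add_mul, hx, hy]; abel
    | cons v t =>
      have e := contractV_headTerm δ 0 f v t
      rw [toTensorAlgebra_consEquiv, map_mul, ← mul_assoc, incF_ι_mul_incV_ι, add_mul, ← e]
      simp only [quasiInt, LinearMap.comp_apply, LinearEquiv.coe_coe, LinearEquiv.symm_apply_apply]
      obtain ⟨c, -, hc⟩ := exists_toTensorAlgebra_zero t
      rw [hc, AlgHom.commutes, mul_assoc, mul_assoc, Algebra.commutes]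
  | succ n ih =>
    induction u using consEquiv_induction with
    | add x y hx hy => simp only [map_add, mul_add, add_mul, hx, hy]; abel
    | cons v t =>
      -- `f v t = v (f t) + β(f, v) t`: the first summand goes by induction, the second is the head
      -- term.
      rw [toTensorAlgebra_consEquiv, map_mul, ← mul_assoc, incF_ι_mul_incV_ι, add_mul, mul_assoc,
        ih]
      simp only [quasiInt, LinearMap.comp_apply, LinearEquiv.coe_coe, LinearEquiv.symm_apply_apply,
        LinearMap.add_apply, map_add, LinearMap.lTensor_tmul, contractV_headTerm,
        contractV_consEquiv, mul_add, mul_assoc]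
      abel

/-- `(f ⊗ h) ⊗ s ↦ ⟨f, v⟩ h s`. -/
def contractF (n : ℕ) (v : V) :
    (Module.Dual k V ⊗[k] H) ⊗[k] (⨂[k]^n (Module.Dual k V)) →ₗ[k] FreeDouble δ :=
  LinearMap.mul' k _ ∘ₗ TensorProduct.map
    (incH δ ∘ₗ (TensorProduct.lid k H).toLinearMap ∘ₗ
      LinearMap.rTensor H (Module.Dual.eval k V v))
    ((incF δ).toLinearMap ∘ₗ TensorPower.toTensorAlgebra)

theorem contractF_tmul (n : ℕ) (v : V) (f : Module.Dual k V) (h : H)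
    (t : ⨂[k]^n (Module.Dual k V)) :
    contractF δ n v ((f ⊗ₜ h) ⊗ₜ t) =
      f v • (incH δ h * incF δ (TensorPower.toTensorAlgebra t)) := by
  simp [contractF]

theorem contractF_tailTerm [Module.Finite k V] (n : ℕ) (v : V) (f : Module.Dual k V)
    (t : ⨂[k]^n (Module.Dual k V)) :
    contractF δ n v (tailTerm δ n (t ⊗ₜ f)) =
      incF δ (TensorPower.toTensorAlgebra t) * incH δ (pairing δ f v) := by
  -- By construction `δᵣ f` corresponds to `β(f, -)` under `V* ⊗ H ≅ Hom(V, H)`.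
  have hp : pairing δ f v = dualTensorHom k V H (rightQuasicoaction δ f) v := by
    have e := LinearEquiv.apply_symm_apply (dualTensorHomEquiv k V H) (pairingₗ δ f)
    exact (LinearMap.congr_fun e v).symm
  rw [hp]
  simp only [tailTerm, LinearMap.comp_apply, LinearMap.lTensor_tmul, LinearEquiv.coe_coe]
  induction rightQuasicoaction δ f using TensorProduct.induction_on with
  | zero => simp
  | add x y hx hy =>
    simp only [map_add, TensorProduct.tmul_add, mul_add, hx, hy, LinearMap.add_apply]
  | tmul g h =>
    have r := Coalgebra.Repr.arbitrary k h
    rw [LinearMap.lTensor_tmul, ← r.eq, dualTensorHom_apply, map_smul, mul_smul_comm,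
      incF_mul_incH δ n r]
    simp [TensorProduct.tmul_sum, contractF_tmul, Finset.smul_sum]

theorem contractF_snocEquiv (n : ℕ) (v : V) (f : Module.Dual k V)
    (z : (Module.Dual k V ⊗[k] H) ⊗[k] (⨂[k]^n (Module.Dual k V))) :
    contractF δ (n + 1) v (LinearMap.lTensor (Module.Dual k V ⊗[k] H)
      (snocEquiv k (Module.Dual k V) n).toLinearMap
      (TensorProduct.assoc k (Module.Dual k V ⊗[k] H) (⨂[k]^n (Module.Dual k V))
        (Module.Dual k V) (z ⊗ₜ f))) =
      contractF δ n v z * incF δ (TensorAlgebra.ι k f) := by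
  induction z using TensorProduct.induction_on with
  | zero => simp
  | add x y hx hy => simp only [map_add, TensorProduct.add_tmul, add_mul, hx, hy]
  | tmul y t => simp [contractF, toTensorAlgebra_snocEquiv, mul_assoc]

/-- The commutator of `V*^{⊗(n+1)}` with `v ∈ V` is given by the right-handed quasibraided
integer. -/
theorem incF_mul_incV_ι [Module.Finite k V] (n : ℕ) (v : V) (u : ⨂[k]^(n + 1) (Module.Dual k V)) :
    incF δ (TensorPower.toTensorAlgebra u) * incV δ (TensorAlgebra.ι k v) =
      incV δ (TensorAlgebra.ι k v) * incF δ (TensorPower.toTensorAlgebra u) +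
        contractF δ n v (quasiIntRight δ n u) := by
  induction n with
  | zero =>
    induction u using snocEquiv_induction with
    | add x y hx hy => simp only [map_add, mul_add, add_mul, hx, hy]; abel
    | snoc t f =>
      have e := contractF_tailTerm δ 0 v f t
      rw [toTensorAlgebra_snocEquiv, map_mul, mul_assoc, incF_ι_mul_incV_ι, mul_add, ← e]
      simp only [quasiIntRight, LinearMap.comp_apply, LinearEquiv.coe_coe,
        LinearEquiv.symm_apply_apply]
      obtain ⟨c, -, hc⟩ := exists_toTensorAlgebra_zero t
      rw [hc, AlgHom.commutes, ← mul_assoc, ← mul_assoc, Algebra.commutes]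
  | succ n ih =>
    induction u using snocEquiv_induction with
    | add x y hx hy => simp only [map_add, mul_add, add_mul, hx, hy]; abel
    | snoc t f =>
      rw [toTensorAlgebra_snocEquiv, map_mul, mul_assoc, incF_ι_mul_incV_ι, mul_add, ← mul_assoc,
        ih]
      simp only [quasiIntRight, LinearMap.comp_apply, LinearEquiv.coe_coe,
        LinearEquiv.symm_apply_apply, LinearMap.add_apply, map_add, LinearMap.rTensor_tmul,
        contractF_tailTerm, contractF_snocEquiv, add_mul, mul_assoc]
      abel

end Commutators

end CommutatorFormulas

/-! ### Invariance under `H` and the kernels of the quasibraided factorials. -/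

section KernelDescription

variable {k : Type u} {H : Type v} {V : Type w}
variable [Field k] [Ring H] [Bialgebra k H]
variable [AddCommGroup V] [Module k V] [Module H V] [IsScalarTower k H V]
variable {δ : V →ₗ[k] H ⊗[k] V} (hδ : IsQuasiYD δ)

theorem sum_smul_counit_map {X : Type*} [AddCommGroup X] [Module k X] (φ : H →ₗ[k] X)
    {ι : Type*} {h : H} (r : Coalgebra.Repr k h ι) :
    ∑ i ∈ r.index, Coalgebra.counit (R := k) (r.right i) • φ (r.left i) = φ h := by
  simp only [← map_smul, ← map_sum, sum_smul_counit r]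

theorem sum_counit_smul_map {X : Type*} [AddCommGroup X] [Module k X] (φ : H →ₗ[k] X)
    {ι : Type*} {h : H} (r : Coalgebra.Repr k h ι) :
    ∑ i ∈ r.index, Coalgebra.counit (R := k) (r.left i) • φ (r.right i) = φ h := by
  simp only [← map_smul, ← map_sum, Coalgebra.sum_counit_smul r]

section Invariance

include hδ

/-- Applying the counit to the middle factor of `h t = (h₍₁₎ ▷ t) h₍₂₎` returns `h ▷ t`, and
`projV_mem` keeps it in the ideal. -/
theorem powAct_lact_mem_idealV (n : ℕ) (h : H) (t : ⨂[k]^n V)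
    (ht : TensorPower.toTensorAlgebra t ∈ idealV δ) :
    TensorPower.toTensorAlgebra (powAct (lact k H V) n h t) ∈ idealV δ := by
  have r := Coalgebra.Repr.arbitrary k h
  have hm := (hasTriangularForm_sumTriangular hδ).projV_mem hδ (Coalgebra.counit (R := k) (A := H))
    (Ideal.mul_mem_left _ (incH δ h) ht : incH δ h * incV δ (TensorPower.toTensorAlgebra t) ∈ _)
  rw [incH_mul_incV δ n r, map_sum] at hm
  simp only [projV_incV_mul_incH] at hm
  exact (sum_smul_counit_map (TensorPower.toTensorAlgebra ∘ₗ (powAct (lact k H V) n).flip t) r) ▸ hm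

theorem powAct_ract_mem_idealF (n : ℕ) (h : H) (t : ⨂[k]^n (Module.Dual k V))
    (ht : TensorPower.toTensorAlgebra t ∈ idealF δ) :
    TensorPower.toTensorAlgebra (powAct (ract k H V) n h t) ∈ idealF δ := by
  have r := Coalgebra.Repr.arbitrary k h
  have tw := (hasTriangularForm_sumTriangular hδ).twoSided
  have hm := (hasTriangularForm_sumTriangular hδ).projF_mem hδ (Coalgebra.counit (R := k) (A := H))
    (Ideal.mul_mem_right (incH δ h) _ ht : incF δ (TensorPower.toTensorAlgebra t) * incH δ h ∈ _)
  rw [incF_mul_incH δ n r, map_sum] at hm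
  simp only [projF_incH_mul_incF] at hm
  exact (sum_counit_smul_map (TensorPower.toTensorAlgebra ∘ₗ (powAct (ract k H V) n).flip t) r) ▸ hm

theorem idealV_isTwoSided : (idealV δ).IsTwoSided := by
  have tw := (hasTriangularForm_sumTriangular hδ).twoSided
  exact ⟨fun b hx => by
    change incV δ _ ∈ sumTriangular δ
    rw [map_mul]
    exact Ideal.mul_mem_right _ _ hx⟩

theorem idealF_isTwoSided : (idealF δ).IsTwoSided := by
  have tw := (hasTriangularForm_sumTriangular hδ).twoSided
  exact ⟨fun b hx => by
    change incF δ _ ∈ sumTriangular δ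
    rw [map_mul]
    exact Ideal.mul_mem_right _ _ hx⟩

end Invariance

section Contraction

variable {X Y : Type*} [AddCommMonoid X] [Module k X] [AddCommMonoid Y] [Module k Y]
variable {A B : Type*} [AddCommGroup A] [Module k A] [AddCommGroup B] [Module k B]

/-- `x ⊗ (a ⊗ b) ↦ g(a) f(b) x`. -/
def pairRight (X : Type*) [AddCommMonoid X] [Module k X] (g : Module.Dual k A)
    (f : Module.Dual k B) : X ⊗[k] (A ⊗[k] B) →ₗ[k] X :=
  (TensorProduct.rid k X).toLinearMap ∘ₗ
    LinearMap.lTensor X (LinearMap.mul' k k ∘ₗ TensorProduct.map g f)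

/-- `(a ⊗ b) ⊗ x ↦ g(a) f(b) x`. -/
def pairLeft (X : Type*) [AddCommMonoid X] [Module k X] (g : Module.Dual k A)
    (f : Module.Dual k B) : (A ⊗[k] B) ⊗[k] X →ₗ[k] X :=
  (TensorProduct.lid k X).toLinearMap ∘ₗ
    LinearMap.rTensor X (LinearMap.mul' k k ∘ₗ TensorProduct.map g f)

theorem pairRight_tmul (g : Module.Dual k A) (f : Module.Dual k B) (x : X) (a : A) (b : B) :
    pairRight X g f (x ⊗ₜ (a ⊗ₜ b)) = (g a * f b) • x := by
  simp [pairRight]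

theorem pairLeft_tmul (g : Module.Dual k A) (f : Module.Dual k B) (x : X) (a : A) (b : B) :
    pairLeft X g f ((a ⊗ₜ b) ⊗ₜ x) = (g a * f b) • x := by
  simp [pairLeft]

theorem pairRight_rTensor (g : Module.Dual k A) (f : Module.Dual k B) (φ : X →ₗ[k] Y)
    (z : X ⊗[k] (A ⊗[k] B)) :
    pairRight Y g f (LinearMap.rTensor (A ⊗[k] B) φ z) = φ (pairRight X g f z) := by
  induction z using TensorProduct.induction_on with
  | zero => simp
  | add x y hx hy => simp only [map_add, hx, hy]
  | tmul x y => simp [pairRight]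

theorem pairLeft_lTensor (g : Module.Dual k A) (f : Module.Dual k B) (φ : X →ₗ[k] Y)
    (z : (A ⊗[k] B) ⊗[k] X) :
    pairLeft Y g f (LinearMap.lTensor (A ⊗[k] B) φ z) = φ (pairLeft X g f z) := by
  induction z using TensorProduct.induction_on with
  | zero => simp
  | add x y hx hy => simp only [map_add, hx, hy]
  | tmul x y => simp [pairLeft]

/-- The coordinate functionals of bases of `A` and `B` already separate the coefficients of `z`. -/
theorem eq_zero_of_pairRight {z : X ⊗[k] (A ⊗[k] B)}
    (hz : ∀ (g : Module.Dual k A) (f : Module.Dual k B), pairRight X g f z = 0) : z = 0 := by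
  classical
  let a := Module.Basis.ofVectorSpace k A
  let b := Module.Basis.ofVectorSpace k B
  let e := TensorProduct.equivFinsuppOfBasisRight (M := X) (a.tensorProduct b)
  have key : ∀ (z : X ⊗[k] (A ⊗[k] B)) i, e z i = pairRight X (a.coord i.1) (b.coord i.2) z := by
    intro z i
    induction z using TensorProduct.induction_on with
    | zero => simp
    | add x y hx hy => simp only [map_add, Finsupp.add_apply, hx, hy]
    | tmul x y =>
      induction y using TensorProduct.induction_on with
      | zero => simp
      | add y y' hy hy' =>
        simp only [TensorProduct.tmul_add, map_add, Finsupp.add_apply, hy, hy']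
      | tmul y y' =>
        rw [TensorProduct.equivFinsuppOfBasisRight_apply_tmul_apply, pairRight_tmul,
          Module.Basis.tensorProduct_repr_tmul_apply, smul_eq_mul, mul_comm]
        rfl
  refine e.injective (Finsupp.ext fun i => ?_)
  rw [key, hz, map_zero, Finsupp.zero_apply]

theorem eq_zero_of_pairLeft {z : (A ⊗[k] B) ⊗[k] X}
    (hz : ∀ (g : Module.Dual k A) (f : Module.Dual k B), pairLeft X g f z = 0) : z = 0 := by
  have key : ∀ (g : Module.Dual k A) (f : Module.Dual k B) (z : (A ⊗[k] B) ⊗[k] X),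
      pairRight X g f (TensorProduct.comm k _ _ z) = pairLeft X g f z := by
    intro g f z
    induction z using TensorProduct.induction_on with
    | zero => simp
    | add x y hx hy => simp only [map_add, hx, hy]
    | tmul x y => simp [pairRight, pairLeft]
  refine (TensorProduct.comm k _ _).injective ?_
  rw [map_zero]
  exact eq_zero_of_pairRight fun g f => by rw [key, hz]

end Contraction

/-! ### The defining ideals are contained in the kernels. -/

section LowerBound

theorem projV_contractV (n : ℕ) (g : Module.Dual k H) (f : Module.Dual k V)
    (z : (⨂[k]^n V) ⊗[k] (H ⊗[k] V)) :
    projV hδ g (contractV δ n f z) = TensorPower.toTensorAlgebra (pairRight _ g f z) := by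
  induction z using TensorProduct.induction_on with
  | zero => simp
  | add x y hx hy => simp only [map_add, hx, hy]
  | tmul t y =>
    induction y using TensorProduct.induction_on with
    | zero => simp
    | add x y hx hy => simp only [TensorProduct.tmul_add, map_add, hx, hy]
    | tmul h v =>
      rw [contractV_tmul, map_smul, projV_incV_mul_incH, pairRight_tmul, map_smul, smul_smul,
        mul_comm]

theorem projF_contractF (n : ℕ) (g : Module.Dual k H) (v : V)
    (z : (Module.Dual k V ⊗[k] H) ⊗[k] (⨂[k]^n (Module.Dual k V))) :
    projF hδ g (contractF δ n v z) =
      TensorPower.toTensorAlgebra (pairLeft _ (Module.Dual.eval k V v) g z) := by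
  induction z using TensorProduct.induction_on with
  | zero => simp
  | add x y hx hy => simp only [map_add, hx, hy]
  | tmul y t =>
    induction y using TensorProduct.induction_on with
    | zero => simp
    | add x y hx hy => simp only [TensorProduct.add_tmul, map_add, hx, hy]
    | tmul f h =>
      rw [contractF_tmul, map_smul, projF_incH_mul_incF, pairLeft_tmul, map_smul, smul_smul,
        Module.Dual.eval_apply]

theorem eq_zero_of_toTensorAlgebra_mem_posPart {M : Type x} [AddCommGroup M] [Module k M]
    {u : ⨂[k]^0 M} (hu : TensorPower.toTensorAlgebra u ∈ posPart k M) : u = 0 := by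
  obtain ⟨c, hc, hc'⟩ := exists_toTensorAlgebra_zero u
  have h : TensorAlgebra.algebraMapInv (TensorPower.toTensorAlgebra u) = 0 := hu
  rw [hc', TensorAlgebra.algebraMap_leftInverse] at h
  rw [hc, h, zero_smul]

-- Induction on the degree: `f u` and `u` lie in the largest triangular ideal, and `u f` projects to
-- zero, so every contraction of `[n+1]~ u` lies in `I(V, δ)` and is killed by `[n]~!`. As
-- contractions separate points, `([n]~! ⊗ id) [n+1]~ u = 0`.
include hδ in
theorem quasiFactorial_eq_zero (n : ℕ) (u : ⨂[k]^n V)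
    (hu : TensorPower.toTensorAlgebra u ∈ idealV δ) : quasiFactorial δ n u = 0 := by
  have hJ := hasTriangularForm_sumTriangular hδ
  induction n with
  | zero => rw [eq_zero_of_toTensorAlgebra_mem_posPart (hJ.minus_le hu), map_zero]
  | succ n ih =>
    have h0 : LinearMap.rTensor (H ⊗[k] V) (quasiFactorial δ n) (quasiInt δ n u) = 0 := by
      refine eq_zero_of_pairRight (X := ⨂[k]^n (H ⊗[k] V)) (A := H) (B := V) fun g f => ?_
      rw [pairRight_rTensor]
      refine ih _ ?_
      have hm := hJ.projV_mem hδ g (Ideal.mul_mem_left _ (incF δ (TensorAlgebra.ι k f)) hu :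
        incF δ (TensorAlgebra.ι k f) * incV δ (TensorPower.toTensorAlgebra u) ∈ _)
      -- The right-hand factor is a letter of `V*`, which the augmentation kills.
      have hz : projV hδ g (incV δ (TensorPower.toTensorAlgebra u) *
          incF δ (TensorAlgebra.ι k f)) = 0 := by
        have := projV_mul hδ g (TensorPower.toTensorAlgebra u) 1 (TensorAlgebra.ι k f)
        simpa [incH_one, TensorAlgebra.algebraMapInv] using this
      rw [incF_ι_mul_incV, map_add, hz, zero_add, projV_contractV] at hm
      exact hm
    simp only [quasiFactorial, LinearMap.comp_apply, h0, map_zero]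

include hδ in
theorem quasiFactorialRight_eq_zero [Module.Finite k V] (n : ℕ) (u : ⨂[k]^n (Module.Dual k V))
    (hu : TensorPower.toTensorAlgebra u ∈ idealF δ) : quasiFactorialRight δ n u = 0 := by
  have hJ := hasTriangularForm_sumTriangular hδ
  have tw := hJ.twoSided
  induction n with
  | zero => rw [eq_zero_of_toTensorAlgebra_mem_posPart (hJ.plus_le hu), map_zero]
  | succ n ih =>
    have h0 : LinearMap.lTensor (Module.Dual k V ⊗[k] H) (quasiFactorialRight δ n)
        (quasiIntRight δ n u) = 0 := by
      refine eq_zero_of_pairLeft (X := ⨂[k]^n (Module.Dual k V ⊗[k] H)) (A := Module.Dual k V)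
        (B := H) fun φ g => ?_
      -- By finite dimension a functional on `V*` is evaluation at some `v`, so commutators with
      -- vectors realise all contractions.
      obtain ⟨v, rfl⟩ := (Module.bijective_dual_eval k V).2 φ
      rw [pairLeft_lTensor]
      refine ih _ ?_
      have hm := hJ.projF_mem hδ g (Ideal.mul_mem_right (incV δ (TensorAlgebra.ι k v)) _ hu :
        incF δ (TensorPower.toTensorAlgebra u) * incV δ (TensorAlgebra.ι k v) ∈ _)
      have hz : projF hδ g (incV δ (TensorAlgebra.ι k v) *
          incF δ (TensorPower.toTensorAlgebra u)) = 0 := by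
        have := projF_mul hδ g (TensorAlgebra.ι k v) 1 (TensorPower.toTensorAlgebra u)
        simpa [incH_one, TensorAlgebra.algebraMapInv] using this
      rw [incF_mul_incV_ι, map_add, hz, zero_add, projF_contractF] at hm
      exact hm
    simp only [quasiFactorialRight, LinearMap.comp_apply, h0, map_zero]

/-- A graded ideal is the sum of its components, and its component of degree zero vanishes because
it lies in `T^{>0}`. -/
theorem le_iSup_of_homogeneous {M : Type x} [AddCommGroup M] [Module k M]
    {I : Ideal (TensorAlgebra k M)} (hI : I.IsHomogeneous
      (fun n : ℕ => LinearMap.range (TensorAlgebra.ι k : M →ₗ[k] TensorAlgebra k M) ^ n))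
    (hpos : I.restrictScalars k ≤ posPart k M) (C : ∀ n, Submodule k (⨂[k]^n M))
    (hC : ∀ n u, TensorPower.toTensorAlgebra u ∈ I → u ∈ C n) :
    I.restrictScalars k ≤ ⨆ n : ℕ, ⨆ _ : 1 ≤ n, (C n).map TensorPower.toTensorAlgebra := by
  intro t ht
  obtain ⟨S, hS⟩ := exists_sum_tensorPart t
  rw [hS]
  refine sum_mem fun n _ => ?_
  obtain ⟨u, hu⟩ := exists_toTensorAlgebra_eq (tensorPart_mem n t)
  have hmem : tensorPart n t ∈ I := hI n ht
  rw [← hu] at hmem ⊢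
  rcases Nat.eq_zero_or_pos n with rfl | hn
  · rw [eq_zero_of_toTensorAlgebra_mem_posPart (hpos hmem), map_zero]
    exact zero_mem _
  · exact Submodule.mem_iSup_of_mem n (Submodule.mem_iSup_of_mem hn
      (Submodule.mem_map_of_mem (hC n u hmem)))

end LowerBound

/-! ### Over a Hopf algebra the kernels are contained in the defining ideals. -/

section UpperBound

/-- The antipode identities for the given coproduct, with the index type of
`Coalgebra.Repr.arbitrary`. -/
theorem IsHopf.exists_antipode {k : Type u} {H : Type v} [Field k] [Ring H] [Bialgebra k H]
    (hH : IsHopf k H) : ∃ S : H →ₗ[k] H, ∀ (h : H) (r : Coalgebra.Repr k h (H × H)),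
      ∑ i ∈ r.index, S (r.left i) * r.right i = algebraMap k H (Coalgebra.counit h) ∧
      ∑ i ∈ r.index, r.left i * S (r.right i) = algebraMap k H (Coalgebra.counit h) := by
  obtain ⟨A, rfl⟩ := hH
  exact ⟨HopfAlgebra.antipode k, fun h r =>
    ⟨HopfAlgebra.sum_antipode_mul_eq_algebraMap_counit r,
      HopfAlgebra.sum_mul_antipode_eq_algebraMap_counit r⟩⟩

/-- Inside `Ã` one has `h ▷ u = h₍₁₎ u S(h₍₂₎)`, since the right side equals `(h₍₁₎ ▷ u) h₍₂₎
S(h₍₃₎)`; so every two-sided ideal absorbs `h ▷ u`. This is the use of the antipode on the `V` side.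
-/
theorem incV_powAct_mem (hH : IsHopf k H) {J : Ideal (FreeDouble δ)} [J.IsTwoSided] {n : ℕ}
    {u : ⨂[k]^n V} (hu : incV δ (TensorPower.toTensorAlgebra u) ∈ J) (h : H) :
    incV δ (TensorPower.toTensorAlgebra (powAct (lact k H V) n h u)) ∈ J := by
  obtain ⟨S, hS⟩ := hH.exists_antipode
  have r := Coalgebra.Repr.arbitrary k h
  let φ : H →ₗ[k] H →ₗ[k] H →ₗ[k] FreeDouble δ :=
    LinearMap.mk₂ k (fun a b => LinearMap.mulLeft k
        (incV δ (TensorPower.toTensorAlgebra (powAct (lact k H V) n a u))) ∘ₗ incH δ ∘ₗ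
        LinearMap.mulLeft k b ∘ₗ S)
      (fun a a' b => LinearMap.ext fun _ => by simp [add_mul])
      (fun c a b => LinearMap.ext fun _ => by simp)
      (fun a b b' => LinearMap.ext fun _ => by simp [add_mul, mul_add])
      (fun c a b => LinearMap.ext fun _ => by simp)
  have e := sum_coassoc φ r (fun i => Coalgebra.Repr.arbitrary k _)
    (fun i => Coalgebra.Repr.arbitrary k _)
  simp only [φ, LinearMap.mk₂_apply, LinearMap.comp_apply, LinearMap.mulLeft_apply,
    ← Finset.mul_sum, ← map_sum, (hS _ _).2, Algebra.algebraMap_eq_smul_one, map_smul, incH_one,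
    mul_smul_comm, mul_one] at e
  have e' := sum_smul_counit_map ((incV δ).toLinearMap ∘ₗ TensorPower.toTensorAlgebra ∘ₗ
    (powAct (lact k H V) n).flip u) r
  simp only [LinearMap.comp_apply, LinearMap.flip_apply, AlgHom.toLinearMap_apply] at e'
  rw [← e', ← e]
  refine sum_mem fun i _ => ?_
  simp only [incH_mul, ← mul_assoc]
  rw [← Finset.sum_mul, ← incH_mul_incV]
  exact J.mul_mem_right _ (J.mul_mem_left _ hu)

/-- The mirror identity is `u ◁ h = S(h₍₁₎) u h₍₂₎`. -/
theorem incF_powAct_mem (hH : IsHopf k H) {J : Ideal (FreeDouble δ)} [J.IsTwoSided] {n : ℕ}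
    {u : ⨂[k]^n (Module.Dual k V)} (hu : incF δ (TensorPower.toTensorAlgebra u) ∈ J) (h : H) :
    incF δ (TensorPower.toTensorAlgebra (powAct (ract k H V) n h u)) ∈ J := by
  obtain ⟨S, hS⟩ := hH.exists_antipode
  have r := Coalgebra.Repr.arbitrary k h
  let φ : H →ₗ[k] H →ₗ[k] H →ₗ[k] FreeDouble δ :=
    LinearMap.mk₂ k (fun a b => LinearMap.mulLeft k (incH δ (S a * b)) ∘ₗ (incF δ).toLinearMap ∘ₗ
        TensorPower.toTensorAlgebra ∘ₗ (powAct (ract k H V) n).flip u)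
      (fun a a' b => LinearMap.ext fun _ => by simp [add_mul])
      (fun c a b => LinearMap.ext fun _ => by simp)
      (fun a b b' => LinearMap.ext fun _ => by simp [add_mul, mul_add])
      (fun c a b => LinearMap.ext fun _ => by simp)
  have e := sum_coassoc φ r (fun i => Coalgebra.Repr.arbitrary k _)
    (fun i => Coalgebra.Repr.arbitrary k _)
  simp only [φ, LinearMap.mk₂_apply, LinearMap.comp_apply, LinearMap.mulLeft_apply,
    ← Finset.sum_mul, ← map_sum, (hS _ _).1, Algebra.algebraMap_eq_smul_one, map_smul, incH_one,
    smul_mul_assoc, one_mul, LinearMap.flip_apply, AlgHom.toLinearMap_apply] at e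
  have e' := sum_counit_smul_map ((incF δ).toLinearMap ∘ₗ TensorPower.toTensorAlgebra ∘ₗ
    (powAct (ract k H V) n).flip u) r
  simp only [LinearMap.comp_apply, LinearMap.flip_apply, AlgHom.toLinearMap_apply] at e'
  rw [← e', e]
  refine sum_mem fun i _ => ?_
  simp only [incH_mul, mul_assoc]
  rw [← Finset.mul_sum, ← incF_mul_incH]
  exact J.mul_mem_left _ (J.mul_mem_right _ hu)

/-- The two-sided ideal generated by a subspace. -/
def idealSpan {A : Type*} [Ring A] [Algebra k A] (K : Submodule k A) : Ideal A where
  toAddSubmonoid := (⊤ * K * ⊤ : Submodule k A).toAddSubmonoid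
  smul_mem' b x hx := by
    have h : (⊤ : Submodule k A) * (⊤ * K * ⊤) ≤ ⊤ * K * ⊤ := by
      rw [← mul_assoc, ← mul_assoc]
      exact mul_le_mul' (mul_le_mul' le_top le_rfl) le_rfl
    exact h (Submodule.mul_mem_mul (Submodule.mem_top (x := b)) hx)

theorem idealSpan_isTwoSided {A : Type*} [Ring A] [Algebra k A] (K : Submodule k A) :
    (idealSpan K).IsTwoSided where
  mul_mem_of_left {x} b hx := by
    have h : (⊤ * K * ⊤ : Submodule k A) * ⊤ ≤ ⊤ * K * ⊤ := by
      rw [mul_assoc]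
      exact mul_le_mul' le_rfl le_top
    exact h (Submodule.mul_mem_mul hx (Submodule.mem_top (x := b)))

theorem le_idealSpan {A : Type*} [Ring A] [Algebra k A] {K : Submodule k A} {x : A} (hx : x ∈ K) :
    x ∈ idealSpan K := by
  have := Submodule.mul_mem_mul (Submodule.mul_mem_mul (Submodule.mem_top (x := (1 : A))) hx)
    (Submodule.mem_top (R := k) (x := (1 : A)))
  rw [one_mul, mul_one] at this
  exact this

variable (δ) in
theorem range_incH_mul_range_incH :
    LinearMap.range (incH δ) * LinearMap.range (incH δ) ≤ LinearMap.range (incH δ) := by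
  refine Submodule.mul_le.2 ?_
  rintro _ ⟨a, rfl⟩ _ ⟨b, rfl⟩
  exact ⟨a * b, incH_mul δ a b⟩

include hδ in
theorem top_le_mul : (⊤ : Submodule k (FreeDouble δ)) ≤
    LinearMap.range (incV δ).toLinearMap * LinearMap.range (incH δ) *
      LinearMap.range (incF δ).toLinearMap := by
  intro a _
  induction a using normal_induction hδ with
  | add x y hx hy => exact add_mem (hx trivial) (hy trivial)
  | mul t h s =>
    exact Submodule.mul_mem_mul (Submodule.mul_mem_mul ⟨t, rfl⟩ ⟨h, rfl⟩) ⟨s, rfl⟩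

theorem posPart_mul_mem {M : Type x} [AddCommGroup M] [Module k M] (a : TensorAlgebra k M)
    {t : TensorAlgebra k M} (ht : t ∈ posPart k M) :
    a * t ∈ posPart k M ∧ t * a ∈ posPart k M := by
  have h : TensorAlgebra.algebraMapInv t = 0 := ht
  simp [posPart, h]

include hδ in
/-- Over a Hopf algebra, a graded subspace of `T^{>0}(V)` which is stable under the commutators
with `V*` lies in `I(V, δ)`. -/
theorem iSup_le_idealV (hH : IsHopf k H) (C : ∀ n, Submodule k (⨂[k]^n V))
    (hC : ∀ n, ∀ u ∈ C (n + 1), ∀ f, contractV δ n f (quasiInt δ n u) ∈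
      (⨆ n : ℕ, ⨆ _ : 1 ≤ n, (C n).map TensorPower.toTensorAlgebra).map (incV δ).toLinearMap *
        LinearMap.range (incH δ)) :
    ⨆ n : ℕ, ⨆ _ : 1 ≤ n, (C n).map TensorPower.toTensorAlgebra ≤
      (idealV δ).restrictScalars k := by
  set K := ⨆ n : ℕ, ⨆ _ : 1 ≤ n, (C n).map TensorPower.toTensorAlgebra with hK
  set Kh := K.map (incV δ).toLinearMap with hKh
  set Vh := LinearMap.range (incV δ).toLinearMap
  set Hh := LinearMap.range (incH δ)
  set Fh := LinearMap.range (incF δ).toLinearMap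
  have tw := idealSpan_isTwoSided Kh
  -- `W`, and not `K`, serves as `I⁻`: `K` is not known at this point to be stable under `H` or to
  -- be an ideal of `T(V)`, while `W` absorbs both by construction of the ideal.
  let W : Submodule k (TensorAlgebra k V) :=
    ((idealSpan Kh).comap (incV δ)).restrictScalars k ⊓ posPart k V
  set Wh := W.map (incV δ).toLinearMap
  have Kind : ∀ S : Submodule k (FreeDouble δ), (∀ n, ∀ u ∈ C (n + 1),
      incV δ (TensorPower.toTensorAlgebra u) ∈ S) → Kh ≤ S := by
    intro S hS
    rw [hKh, Submodule.map_le_iff_le_comap, hK]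
    refine iSup₂_le fun n hn => ?_
    obtain ⟨n, rfl⟩ := Nat.exists_eq_add_of_le' hn
    rw [Submodule.map_le_iff_le_comap]
    exact fun u hu => hS n u hu
  have Kmem : ∀ n, ∀ u ∈ C (n + 1), incV δ (TensorPower.toTensorAlgebra u) ∈ Kh :=
    fun n u hu => Submodule.mem_map_of_mem (f := (incV δ).toLinearMap)
      (Submodule.mem_iSup_of_mem (n + 1) (Submodule.mem_iSup_of_mem (Nat.le_add_left 1 n)
        (Submodule.mem_map_of_mem hu)))
  -- `f κ h s = κ f h s + [f, κ] h s`. In the first term `f` moves past `h` into `T(V*)`; the second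
  -- lies in `K H h s` by `hC`.
  have hf : ∀ f, ∀ x ∈ Kh * Hh * Fh, incF δ (TensorAlgebra.ι k f) * x ∈ Kh * Hh * Fh := by
    intro f
    suffices h : Kh * Hh * Fh ≤
        (Kh * Hh * Fh).comap (LinearMap.mulLeft k (incF δ (TensorAlgebra.ι k f))) from h
    refine mul_mul_le ?_
    rintro κ hκ _ ⟨h, rfl⟩ _ ⟨s, rfl⟩
    revert κ
    suffices h : Kh ≤ (Kh * Hh * Fh).comap (LinearMap.mulRight k (incH δ h * incF δ s) ∘ₗ
        LinearMap.mulLeft k (incF δ (TensorAlgebra.ι k f))) by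
      intro κ hκ
      simpa [mul_assoc] using h hκ
    refine Kind _ fun n u hu => ?_
    have r := Coalgebra.Repr.arbitrary k h
    simp only [Submodule.mem_comap, LinearMap.comp_apply, LinearMap.mulRight_apply,
      LinearMap.mulLeft_apply, incF_ι_mul_incV, add_mul]
    refine add_mem ?_ ?_
    · rw [mul_assoc (incV δ _), ← mul_assoc (incF δ _) (incH δ h), incF_ι_mul_incH,
        sweedler_eq_sum _ r, Finset.sum_mul, Finset.mul_sum]
      refine sum_mem fun i _ => ?_
      simp only [LinearMap.compl₁₂_apply, LinearMap.comp_apply, LinearMap.flip_apply,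
        AlgHom.toLinearMap_apply, LinearMap.mul_apply']
      rw [mul_assoc (incH δ _), ← map_mul, ← mul_assoc]
      exact Submodule.mul_mem_mul (Submodule.mul_mem_mul (Kmem n u hu) ⟨_, rfl⟩) ⟨_, rfl⟩
    · rw [← mul_assoc]
      refine Submodule.mul_mem_mul ?_ ⟨s, rfl⟩
      refine mul_le_mul' le_rfl (range_incH_mul_range_incH δ) (?_ : _ ∈ Kh * (Hh * Hh))
      rw [← mul_assoc]
      exact Submodule.mul_mem_mul (hC n u hu f) ⟨h, rfl⟩
  have hF : ∀ s, ∀ x ∈ Kh * Hh * Fh, incF δ s * x ∈ Kh * Hh * Fh := by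
    intro s
    induction s using TensorAlgebra.induction with
    | algebraMap c =>
      intro x hx
      rw [AlgHom.commutes, ← Algebra.smul_def]
      exact Submodule.smul_mem _ c hx
    | ι f => exact hf f
    | mul a b ha hb => exact fun x hx => by rw [map_mul, mul_assoc (incF δ a)]; exact ha _ (hb x hx)
    | add a b ha hb => exact fun x hx => by rw [map_add, add_mul]; exact add_mem (ha x hx) (hb x hx)
  have FK : Fh * Kh ≤ Kh * Hh * Fh := by
    refine Submodule.mul_le.2 ?_
    rintro _ ⟨s, rfl⟩ κ hκ
    refine hF s κ ?_
    have hH1 : (1 : FreeDouble δ) ∈ Hh := ⟨1, incH_one δ⟩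
    have hF1 : (1 : FreeDouble δ) ∈ Fh := ⟨1, map_one (incF δ)⟩
    have := Submodule.mul_mem_mul (Submodule.mul_mem_mul hκ hH1) hF1
    rwa [mul_one, mul_one] at this
  -- In `h u = (h₍₁₎ ▷ u) h₍₂₎` the factor `h₍₁₎ ▷ u` lies in the ideal thanks to the antipode,
  -- hence in `W`.
  have HK : Hh * Kh ≤ Wh * Hh := by
    refine Submodule.mul_le.2 ?_
    rintro _ ⟨h, rfl⟩
    refine Kind ((Wh * Hh).comap (LinearMap.mulLeft k (incH δ h))) fun n u hu => ?_
    rw [Submodule.mem_comap, LinearMap.mulLeft_apply,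
      incH_mul_incV δ (n + 1) (Coalgebra.Repr.arbitrary k h)]
    refine sum_mem fun i _ => Submodule.mul_mem_mul (Submodule.mem_map_of_mem
      (f := (incV δ).toLinearMap) ⟨?_, ?_⟩) ⟨_, rfl⟩
    · exact incV_powAct_mem hH (le_idealSpan (Kmem n u hu)) _
    · exact mem_posPart_of_mem (Nat.le_add_left 1 n) (toTensorAlgebra_mem _ _)
  have VW : Vh * Wh ≤ Wh := by
    refine Submodule.mul_le.2 ?_
    rintro _ ⟨t, rfl⟩ _ ⟨a, ⟨ha, ha'⟩, rfl⟩
    refine ⟨t * a, ⟨?_, (posPart_mul_mem t ha').1⟩, map_mul (incV δ) t a⟩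
    exact Ideal.mul_mem_left _ t ha
  have WV : Wh * Vh ≤ Wh := by
    refine Submodule.mul_le.2 ?_
    rintro _ ⟨a, ⟨ha, ha'⟩, rfl⟩ _ ⟨t, rfl⟩
    refine ⟨a * t, ⟨?_, (posPart_mul_mem t ha').2⟩, map_mul (incV δ) a t⟩
    have : incV δ a * incV δ t ∈ idealSpan Kh := Ideal.mul_mem_right _ _ ha
    rwa [← map_mul] at this
  have htri : HasTriangularForm δ (idealSpan Kh) W ⊥ := by
    refine HasTriangularForm.mk_of_le tw inf_le_right bot_le (fun t ht => ht.1) ?_ ?_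
    · rintro s rfl
      rw [map_zero]
      exact zero_mem _
    · refine le_trans ?_ (le_sup_left : Wh * Hh * Fh ≤ _)
      -- Normal ordering around `K`: `T(V*)` moves right past `K`, then `H` does, turning `K` into
      -- `W`; finally `W` absorbs `T(V)` from both sides.
      calc ⊤ * Kh * ⊤ ≤ Vh * Hh * Fh * Kh * ⊤ :=
            mul_le_mul' (mul_le_mul' (top_le_mul hδ) le_rfl) le_rfl
        _ = Vh * Hh * (Fh * Kh) * ⊤ := by rw [mul_assoc (Vh * Hh)]
        _ ≤ Vh * Hh * (Kh * Hh * Fh) * ⊤ := mul_le_mul' (mul_le_mul' le_rfl FK) le_rfl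
        _ = Vh * (Hh * Kh) * (Hh * Fh * ⊤) := by simp only [mul_assoc]
        _ ≤ Vh * (Wh * Hh) * ⊤ := mul_le_mul' (mul_le_mul' le_rfl HK) le_top
        _ = Vh * Wh * (Hh * ⊤) := by simp only [mul_assoc]
        _ ≤ Wh * (Vh * Hh * Fh) := mul_le_mul' VW (le_top.trans (top_le_mul hδ))
        _ = Wh * Vh * Hh * Fh := by simp only [mul_assoc]
        _ ≤ Wh * Hh * Fh := mul_le_mul' (mul_le_mul' WV le_rfl) le_rfl
  intro t ht
  exact isGreatest_sumTriangular.2 ⟨W, ⊥, htri⟩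
    (le_idealSpan (Submodule.mem_map_of_mem (f := (incV δ).toLinearMap) ht))

include hδ in
/-- Over a Hopf algebra, a graded subspace of `T^{>0}(V*)` which is stable under the commutators
with `V` lies in `I(V*, δ)`. -/
theorem iSup_le_idealF [Module.Finite k V] (hH : IsHopf k H)
    (C : ∀ n, Submodule k (⨂[k]^n (Module.Dual k V)))
    (hC : ∀ n, ∀ u ∈ C (n + 1), ∀ v, contractF δ n v (quasiIntRight δ n u) ∈
      LinearMap.range (incH δ) *
      (⨆ n : ℕ, ⨆ _ : 1 ≤ n, (C n).map TensorPower.toTensorAlgebra).map (incF δ).toLinearMap) :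
    ⨆ n : ℕ, ⨆ _ : 1 ≤ n, (C n).map TensorPower.toTensorAlgebra ≤
      (idealF δ).restrictScalars k := by
  set K := ⨆ n : ℕ, ⨆ _ : 1 ≤ n, (C n).map TensorPower.toTensorAlgebra with hK
  set Kh := K.map (incF δ).toLinearMap with hKh
  set Vh := LinearMap.range (incV δ).toLinearMap
  set Hh := LinearMap.range (incH δ)
  set Fh := LinearMap.range (incF δ).toLinearMap
  have tw := idealSpan_isTwoSided Kh
  let W : Submodule k (TensorAlgebra k (Module.Dual k V)) :=
    ((idealSpan Kh).comap (incF δ)).restrictScalars k ⊓ posPart k (Module.Dual k V)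
  set Wh := W.map (incF δ).toLinearMap
  have Kind : ∀ S : Submodule k (FreeDouble δ), (∀ n, ∀ u ∈ C (n + 1),
      incF δ (TensorPower.toTensorAlgebra u) ∈ S) → Kh ≤ S := by
    intro S hS
    rw [hKh, Submodule.map_le_iff_le_comap, hK]
    refine iSup₂_le fun n hn => ?_
    obtain ⟨n, rfl⟩ := Nat.exists_eq_add_of_le' hn
    rw [Submodule.map_le_iff_le_comap]
    exact fun u hu => hS n u hu
  have Kmem : ∀ n, ∀ u ∈ C (n + 1), incF δ (TensorPower.toTensorAlgebra u) ∈ Kh :=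
    fun n u hu => Submodule.mem_map_of_mem (f := (incF δ).toLinearMap)
      (Submodule.mem_iSup_of_mem (n + 1) (Submodule.mem_iSup_of_mem (Nat.le_add_left 1 n)
        (Submodule.mem_map_of_mem hu)))
  -- Mirror image of the step for `V`: `v` moves to the left past `K` and then past `h`, the
  -- commutator being controlled by `hC`.
  have hv : ∀ v, ∀ x ∈ Vh * Hh * Kh, x * incV δ (TensorAlgebra.ι k v) ∈ Vh * Hh * Kh := by
    intro v
    suffices h : Vh * Hh * Kh ≤
        (Vh * Hh * Kh).comap (LinearMap.mulRight k (incV δ (TensorAlgebra.ι k v))) from h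
    refine mul_mul_le ?_
    rintro _ ⟨t, rfl⟩ _ ⟨h, rfl⟩
    suffices h : Kh ≤ (Vh * Hh * Kh).comap (LinearMap.mulLeft k (incV δ t * incH δ h) ∘ₗ
        LinearMap.mulRight k (incV δ (TensorAlgebra.ι k v))) by
      intro κ hκ
      simpa [mul_assoc] using h hκ
    refine Kind _ fun n u hu => ?_
    have r := Coalgebra.Repr.arbitrary k h
    simp only [Submodule.mem_comap, LinearMap.comp_apply, LinearMap.mulRight_apply,
      LinearMap.mulLeft_apply, incF_mul_incV_ι, mul_add]
    refine add_mem ?_ ?_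
    · rw [← mul_assoc, mul_assoc (incV δ t), incH_mul_incV_ι, sweedler_eq_sum _ r,
        Finset.mul_sum, Finset.sum_mul]
      refine sum_mem fun i _ => ?_
      simp only [LinearMap.compl₁₂_apply, LinearMap.comp_apply, LinearMap.flip_apply,
        AlgHom.toLinearMap_apply, LinearMap.mul_apply', ← mul_assoc]
      rw [← map_mul]
      exact Submodule.mul_mem_mul (Submodule.mul_mem_mul ⟨_, rfl⟩ ⟨_, rfl⟩) (Kmem n u hu)
    · rw [mul_assoc (incV δ t), mul_assoc Vh]
      refine Submodule.mul_mem_mul ⟨t, rfl⟩ ?_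
      refine mul_le_mul' (range_incH_mul_range_incH δ) le_rfl (?_ : _ ∈ Hh * Hh * Kh)
      rw [mul_assoc Hh]
      exact Submodule.mul_mem_mul ⟨h, rfl⟩ (hC n u hu v)
  have hV : ∀ t, ∀ x ∈ Vh * Hh * Kh, x * incV δ t ∈ Vh * Hh * Kh := by
    intro t
    induction t using TensorAlgebra.induction with
    | algebraMap c =>
      intro x hx
      rw [AlgHom.commutes, ← Algebra.commutes, ← Algebra.smul_def]
      exact Submodule.smul_mem _ c hx
    | ι v => exact hv v
    | mul a b ha hb => exact fun x hx => by rw [map_mul, ← mul_assoc]; exact hb _ (ha x hx)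
    | add a b ha hb => exact fun x hx => by rw [map_add, mul_add]; exact add_mem (ha x hx) (hb x hx)
  have KV : Kh * Vh ≤ Vh * Hh * Kh := by
    refine Submodule.mul_le.2 ?_
    rintro κ hκ _ ⟨t, rfl⟩
    refine hV t κ ?_
    have hH1 : (1 : FreeDouble δ) ∈ Hh := ⟨1, incH_one δ⟩
    have hV1 : (1 : FreeDouble δ) ∈ Vh := ⟨1, map_one (incV δ)⟩
    have := Submodule.mul_mem_mul (Submodule.mul_mem_mul hV1 hH1) hκ
    rwa [one_mul, one_mul] at this
  have KH : Kh * Hh ≤ Hh * Wh := by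
    suffices h : ∀ h : H, Kh ≤ (Hh * Wh).comap (LinearMap.mulRight k (incH δ h)) by
      refine Submodule.mul_le.2 ?_
      rintro κ hκ _ ⟨x, rfl⟩
      exact h x hκ
    intro h
    refine Kind _ fun n u hu => ?_
    rw [Submodule.mem_comap, LinearMap.mulRight_apply,
      incF_mul_incH δ (n + 1) (Coalgebra.Repr.arbitrary k h)]
    refine sum_mem fun i _ => Submodule.mul_mem_mul ⟨_, rfl⟩ (Submodule.mem_map_of_mem
      (f := (incF δ).toLinearMap) ⟨?_, ?_⟩)
    · exact incF_powAct_mem hH (le_idealSpan (Kmem n u hu)) _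
    · exact mem_posPart_of_mem (Nat.le_add_left 1 n) (toTensorAlgebra_mem _ _)
  have FW : Fh * Wh ≤ Wh := by
    refine Submodule.mul_le.2 ?_
    rintro _ ⟨t, rfl⟩ _ ⟨a, ⟨ha, ha'⟩, rfl⟩
    refine ⟨t * a, ⟨?_, (posPart_mul_mem t ha').1⟩, map_mul (incF δ) t a⟩
    exact Ideal.mul_mem_left _ t ha
  have WF : Wh * Fh ≤ Wh := by
    refine Submodule.mul_le.2 ?_
    rintro _ ⟨a, ⟨ha, ha'⟩, rfl⟩ _ ⟨t, rfl⟩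
    refine ⟨a * t, ⟨?_, (posPart_mul_mem t ha').2⟩, map_mul (incF δ) a t⟩
    have : incF δ a * incF δ t ∈ idealSpan Kh := Ideal.mul_mem_right _ _ ha
    rwa [← map_mul] at this
  have htri : HasTriangularForm δ (idealSpan Kh) ⊥ W := by
    refine HasTriangularForm.mk_of_le tw bot_le inf_le_right ?_ (fun t ht => ht.1) ?_
    · rintro s rfl
      rw [map_zero]
      exact zero_mem _
    · refine le_trans ?_ (le_sup_right : Vh * Hh * Wh ≤ _)
      -- Here the right-hand factor is expanded: `T(V)` and then `H` move left past `K`, and `W`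
      -- absorbs `T(V*)` from both sides.
      calc ⊤ * Kh * ⊤ ≤ ⊤ * Kh * (Vh * Hh * Fh) := mul_le_mul' le_rfl (top_le_mul hδ)
        _ = ⊤ * (Kh * Vh) * (Hh * Fh) := by simp only [mul_assoc]
        _ ≤ ⊤ * (Vh * Hh * Kh) * (Hh * Fh) := mul_le_mul' (mul_le_mul' le_rfl KV) le_rfl
        _ = ⊤ * Vh * Hh * (Kh * Hh) * Fh := by simp only [mul_assoc]
        _ ≤ ⊤ * (Hh * Wh) * Fh := mul_le_mul' (mul_le_mul' le_top KH) le_rfl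
        _ = ⊤ * Hh * (Wh * Fh) := by simp only [mul_assoc]
        _ ≤ Vh * Hh * Fh * Wh := mul_le_mul' (le_top.trans (top_le_mul hδ)) WF
        _ = Vh * Hh * (Fh * Wh) := by simp only [mul_assoc]
        _ ≤ Vh * Hh * Wh := mul_le_mul' le_rfl FW
  intro t ht
  exact isGreatest_sumTriangular.2 ⟨⊥, W, htri⟩
    (le_idealSpan (Submodule.mem_map_of_mem (f := (incF δ).toLinearMap) ht))

/-- The supremum omits degree zero, which is harmless because `C 0 = ⊥`. -/
theorem mem_iSup_of_mem_ker {M : Type*} [AddCommGroup M] [Module k M]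
    (C : ∀ n, Submodule k (⨂[k]^n M)) (h0 : C 0 = ⊥) {n : ℕ} {t : ⨂[k]^n M} (ht : t ∈ C n) :
    TensorPower.toTensorAlgebra t ∈
      ⨆ n : ℕ, ⨆ _ : 1 ≤ n, (C n).map TensorPower.toTensorAlgebra := by
  rcases Nat.eq_zero_or_pos n with rfl | hn
  · rw [h0, Submodule.mem_bot] at ht
    rw [ht, map_zero]
    exact zero_mem _
  · exact Submodule.mem_iSup_of_mem n (Submodule.mem_iSup_of_mem hn (Submodule.mem_map_of_mem ht))

theorem ker_quasiFactorial_zero : LinearMap.ker (quasiFactorial δ 0) = ⊥ := by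
  rw [quasiFactorial]
  exact LinearEquiv.ker _

theorem ker_quasiFactorialRight_zero [Module.Finite k V] :
    LinearMap.ker (quasiFactorialRight δ 0) = ⊥ := by
  rw [quasiFactorialRight]
  exact LinearEquiv.ker _

/-- With `D` the kernel of `[n]~!`, this is the form in which the hypothesis `hC` of
`iSup_le_idealV` is supplied. -/
theorem contractV_rTensor_subtype_mem {n : ℕ} {D : Submodule k (⨂[k]^n V)}
    {K : Submodule k (TensorAlgebra k V)} (hK : ∀ t ∈ D, TensorPower.toTensorAlgebra t ∈ K)
    (f : Module.Dual k V) (z : D ⊗[k] (H ⊗[k] V)) :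
    contractV δ n f (LinearMap.rTensor (H ⊗[k] V) D.subtype z) ∈
      K.map (incV δ).toLinearMap * LinearMap.range (incH δ) := by
  induction z using TensorProduct.induction_on with
  | zero => rw [map_zero, map_zero]; exact zero_mem _
  | add x y hx hy => rw [map_add, map_add]; exact add_mem hx hy
  | tmul t y =>
    induction y using TensorProduct.induction_on with
    | zero => rw [TensorProduct.tmul_zero, map_zero, map_zero]; exact zero_mem _
    | add x y hx hy => rw [TensorProduct.tmul_add, map_add, map_add]; exact add_mem hx hy
    | tmul h v =>
      rw [LinearMap.rTensor_tmul, contractV_tmul]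
      exact Submodule.smul_mem _ _ (Submodule.mul_mem_mul (Submodule.mem_map_of_mem
        (f := (incV δ).toLinearMap) (hK _ t.2)) ⟨h, rfl⟩)

theorem contractF_lTensor_subtype_mem {n : ℕ} {D : Submodule k (⨂[k]^n (Module.Dual k V))}
    {K : Submodule k (TensorAlgebra k (Module.Dual k V))}
    (hK : ∀ t ∈ D, TensorPower.toTensorAlgebra t ∈ K)
    (v : V) (z : (Module.Dual k V ⊗[k] H) ⊗[k] D) :
    contractF δ n v (LinearMap.lTensor (Module.Dual k V ⊗[k] H) D.subtype z) ∈
      LinearMap.range (incH δ) * K.map (incF δ).toLinearMap := by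
  induction z using TensorProduct.induction_on with
  | zero => rw [map_zero, map_zero]; exact zero_mem _
  | add x y hx hy => rw [map_add, map_add]; exact add_mem hx hy
  | tmul y t =>
    induction y using TensorProduct.induction_on with
    | zero => rw [TensorProduct.zero_tmul, map_zero, map_zero]; exact zero_mem _
    | add x y hx hy => rw [TensorProduct.add_tmul, map_add, map_add]; exact add_mem hx hy
    | tmul f h =>
      rw [LinearMap.lTensor_tmul, contractF_tmul]
      exact Submodule.smul_mem _ _ (Submodule.mul_mem_mul ⟨h, rfl⟩ (Submodule.mem_map_of_mem
        (f := (incF δ).toLinearMap) (hK _ t.2)))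

section Exactness

variable {M N : Type*} [AddCommMonoid M] [Module k M] [AddCommMonoid N] [Module k N]
variable (P : Type*) [AddCommMonoid P] [Module k P] (φ : M →ₗ[k] N)

/-- Every module over a field is flat, so the kernel of `φ ⊗ id` is the image of `ker φ ⊗ P`. -/
theorem exists_rTensor_subtype_eq {w : M ⊗[k] P} (hw : LinearMap.rTensor P φ w = 0) :
    ∃ z : LinearMap.ker φ ⊗[k] P, LinearMap.rTensor P (LinearMap.ker φ).subtype z = w := by
  -- Negation is supplied by the scalar `-1`.
  let _ := Module.addCommMonoidToAddCommGroup k (M := M)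
  let _ := Module.addCommMonoidToAddCommGroup k (M := N)
  let _ := Module.addCommMonoidToAddCommGroup k (M := P)
  exact (Module.Flat.rTensor_exact P (LinearMap.exact_subtype_ker_map φ) w).1 hw

theorem exists_lTensor_subtype_eq {w : P ⊗[k] M} (hw : LinearMap.lTensor P φ w = 0) :
    ∃ z : P ⊗[k] LinearMap.ker φ, LinearMap.lTensor P (LinearMap.ker φ).subtype z = w := by
  let _ := Module.addCommMonoidToAddCommGroup k (M := M)
  let _ := Module.addCommMonoidToAddCommGroup k (M := N)
  let _ := Module.addCommMonoidToAddCommGroup k (M := P)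
  exact (Module.Flat.lTensor_exact P (LinearMap.exact_subtype_ker_map φ) w).1 hw

end Exactness

theorem quasiFactorial_succ_eq_zero {n : ℕ} {u : ⨂[k]^(n + 1) V}
    (hu : quasiFactorial δ (n + 1) u = 0) :
    LinearMap.rTensor (H ⊗[k] V) (quasiFactorial δ n) (quasiInt δ n u) = 0 := by
  refine (snocEquiv k (H ⊗[k] V) n).injective ?_
  rw [map_zero]
  exact hu

theorem quasiFactorialRight_succ_eq_zero [Module.Finite k V] {n : ℕ}
    {u : ⨂[k]^(n + 1) (Module.Dual k V)} (hu : quasiFactorialRight δ (n + 1) u = 0) :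
    LinearMap.lTensor (Module.Dual k V ⊗[k] H) (quasiFactorialRight δ n)
      (quasiIntRight δ n u) = 0 := by
  refine (consEquiv k (Module.Dual k V ⊗[k] H) n).injective ?_
  rw [map_zero]
  exact hu

-- One inclusion is the grading with `quasiFactorial_eq_zero`. For the other, `[n+1]~! u = 0` places
-- `[n+1]~ u` in `ker [n]~! ⊗ (H ⊗ V)` by exactness, and this is the commutator condition of
-- `iSup_le_idealV`.
include hδ in
theorem idealV_eq_iSup_ker (hH : IsHopf k H) : (idealV δ).restrictScalars k =
    ⨆ n : ℕ, ⨆ _ : 1 ≤ n,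
      (LinearMap.ker (quasiFactorial δ n)).map TensorPower.toTensorAlgebra := by
  have h0 := ker_quasiFactorial_zero (δ := δ)
  have hle : ∀ n u, TensorPower.toTensorAlgebra u ∈ idealV δ →
      u ∈ LinearMap.ker (quasiFactorial δ n) := fun n u hu => quasiFactorial_eq_zero hδ n u hu
  refine le_antisymm (le_iSup_of_homogeneous (idealV_isHomogeneous δ)
    (hasTriangularForm_sumTriangular hδ).minus_le
    (fun n => LinearMap.ker (quasiFactorial δ n)) hle)
    (iSup_le_idealV hδ hH (fun n => LinearMap.ker (quasiFactorial δ n)) fun n u hu f => ?_)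
  obtain ⟨z, hz⟩ := exists_rTensor_subtype_eq (H ⊗[k] V) (quasiFactorial δ n)
    (quasiFactorial_succ_eq_zero (LinearMap.mem_ker.1 hu))
  rw [← hz]
  exact contractV_rTensor_subtype_mem (fun t ht =>
    mem_iSup_of_mem_ker (fun n => LinearMap.ker (quasiFactorial δ n)) h0 ht) f z

include hδ in
theorem idealF_eq_iSup_ker [Module.Finite k V] (hH : IsHopf k H) :
    (idealF δ).restrictScalars k = ⨆ n : ℕ, ⨆ _ : 1 ≤ n,
      (LinearMap.ker (quasiFactorialRight δ n)).map TensorPower.toTensorAlgebra := by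
  have h0 := ker_quasiFactorialRight_zero (δ := δ)
  have hle : ∀ n u, TensorPower.toTensorAlgebra u ∈ idealF δ →
      u ∈ LinearMap.ker (quasiFactorialRight δ n) :=
    fun n u hu => quasiFactorialRight_eq_zero hδ n u hu
  have hle' := le_iSup_of_homogeneous (idealF_isHomogeneous δ)
    (hasTriangularForm_sumTriangular hδ).plus_le
    (fun n => LinearMap.ker (quasiFactorialRight δ n)) hle
  have hge := iSup_le_idealF hδ hH (fun n => LinearMap.ker (quasiFactorialRight δ n))
    fun n u hu v => by
      have hu' : quasiFactorialRight δ (n + 1) u = 0 := hu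
      have hw := quasiFactorialRight_succ_eq_zero hu'
      obtain ⟨z, hz⟩ := exists_lTensor_subtype_eq (Module.Dual k V ⊗[k] H)
        (quasiFactorialRight δ n) hw
      rw [← hz]
      exact contractF_lTensor_subtype_mem (fun t ht =>
        mem_iSup_of_mem_ker (fun n => LinearMap.ker (quasiFactorialRight δ n)) h0 ht) v z
  exact le_antisymm hle' hge

end UpperBound

end KernelDescription

end BraidedDouble

end

/-! ### The main theorem. -/

theorem theoremB {k : Type*} {H : Type*} {V : Type*} [Field k] [Ring H] [Bialgebra k H]
    [AddCommGroup V] [Module k V] [Module H V] [IsScalarTower k H V] [Module.Finite k V]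
    (δ : V →ₗ[k] H ⊗[k] V) (hδ : BraidedDouble.IsQuasiYD δ) :
    -- the sum of all triangular ideals is the largest triangular ideal
    IsGreatest {J | BraidedDouble.IsTriangularIdeal δ J} (BraidedDouble.sumTriangular δ) ∧
    -- a triangular ideal determines its two halves, and every braided double has triangular
    -- decomposition
    (∀ J Im Ip, BraidedDouble.HasTriangularForm δ J Im Ip →
      (J.comap (BraidedDouble.incV δ)).restrictScalars k = Im ∧
      (J.comap (BraidedDouble.incF δ)).restrictScalars k = Ip) ∧
    (∀ (A : Type*) [Ring A] [Algebra k A] (q : BraidedDouble.FreeDouble δ →ₐ[k] A),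
      BraidedDouble.IsBraidedDouble δ q → Function.Bijective (BraidedDouble.triangularMap δ q)) ∧
    -- a braided double has no proper quotient doubles exactly when it is the quotient of the free
    -- double by the largest triangular ideal
    (∀ (A : Type*) [Ring A] [Algebra k A] (q : BraidedDouble.FreeDouble δ →ₐ[k] A),
      BraidedDouble.IsMinimalDouble δ q ↔
        Function.Surjective q ∧ RingHom.ker q = BraidedDouble.sumTriangular δ) ∧
    -- every braided double has a unique quotient that is a minimal double
    (∀ (A : Type*) [Ring A] [Algebra k A] (q : BraidedDouble.FreeDouble δ →ₐ[k] A),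
      BraidedDouble.IsBraidedDouble δ q →
        ∃! K : Ideal A, ∃ _ : K.IsTwoSided,
          BraidedDouble.IsMinimalDouble δ ((Ideal.Quotient.mkₐ k K).comp q)) ∧
    -- the defining ideals of the minimal double: two-sided, `H`-invariant, graded
    BraidedDouble.HasTriangularForm δ (BraidedDouble.sumTriangular δ)
      ((BraidedDouble.idealV δ).restrictScalars k) ((BraidedDouble.idealF δ).restrictScalars k) ∧
    (BraidedDouble.idealV δ).IsTwoSided ∧ (BraidedDouble.idealF δ).IsTwoSided ∧
    (∀ (n : ℕ) (h : H) (t : ⨂[k]^n V),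
      TensorPower.toTensorAlgebra t ∈ BraidedDouble.idealV δ →
        TensorPower.toTensorAlgebra (BraidedDouble.powAct (BraidedDouble.lact k H V) n h t) ∈
          BraidedDouble.idealV δ) ∧
    (∀ (n : ℕ) (h : H) (t : ⨂[k]^n (Module.Dual k V)),
      TensorPower.toTensorAlgebra t ∈ BraidedDouble.idealF δ →
        TensorPower.toTensorAlgebra (BraidedDouble.powAct (BraidedDouble.ract k H V) n h t) ∈
          BraidedDouble.idealF δ) ∧
    (BraidedDouble.idealV δ).IsHomogeneous
      (fun n : ℕ => LinearMap.range (TensorAlgebra.ι k : V →ₗ[k] TensorAlgebra k V) ^ n) ∧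
    (BraidedDouble.idealF δ).IsHomogeneous
      (fun n : ℕ => LinearMap.range
        (TensorAlgebra.ι k : Module.Dual k V →ₗ[k] TensorAlgebra k (Module.Dual k V)) ^ n) ∧
    -- over a Hopf algebra they are the sums of the kernels of the quasibraided factorials
    (BraidedDouble.IsHopf k H →
      (BraidedDouble.idealV δ).restrictScalars k =
        ⨆ n : ℕ, ⨆ _ : 1 ≤ n,
          (LinearMap.ker (BraidedDouble.quasiFactorial δ n)).map TensorPower.toTensorAlgebra ∧
      (BraidedDouble.idealF δ).restrictScalars k =
        ⨆ n : ℕ, ⨆ _ : 1 ≤ n,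
          (LinearMap.ker (BraidedDouble.quasiFactorialRight δ n)).map
            TensorPower.toTensorAlgebra) :=
  ⟨BraidedDouble.isGreatest_sumTriangular,
    fun _ _ _ hJ => ⟨hJ.comap_incV hδ, hJ.comap_incF hδ⟩,
    fun _ _ _ _ hq => BraidedDouble.triangularMap_bijective hδ hq,
    fun _ _ _ _ => BraidedDouble.isMinimalDouble_iff,
    fun _ _ _ _ hq => BraidedDouble.existsUnique_minimal_quotient hq,
    BraidedDouble.hasTriangularForm_sumTriangular hδ,
    BraidedDouble.idealV_isTwoSided hδ, BraidedDouble.idealF_isTwoSided hδ,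
    BraidedDouble.powAct_lact_mem_idealV hδ, BraidedDouble.powAct_ract_mem_idealF hδ,
    BraidedDouble.idealV_isHomogeneous δ, BraidedDouble.idealF_isHomogeneous δ,
    fun hH => ⟨BraidedDouble.idealV_eq_iSup_ker hδ hH, BraidedDouble.idealF_eq_iSup_ker hδ hH⟩⟩
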